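/- Let $n\ge 1$ and let $K\subset S^{n+2}$ be an oriented smooth $n$-knot: the image of a smooth embedding of an oriented smooth $n$-manifold $M$ homeomorphic to $S^n$. Suppose that $K$ is fibered, i.e. there is a locally trivial fibration $\pi:S^{n+2}\setminus K\to S^1$ such that for every $s\in S^1$ the closure of $\pi^{-1}(s)$ is a Seifert surface of $K$ (a compact orientable smoothly embedded $(n+1)$-manifold with boundary $K$). Put $F=\pi^{-1}(1)$. Let $N(K)\cong M\times D^2$ be a closed, smoothly trivialized tubular neighborhood of $K$, compatible with the orientations of $K$ and $S^{n+2}$, such that $F\cap N(K)$ is the half-open collar corresponding to $M\times(0,1]\subset M\times D^2$, and let $E(K)=S^{n+2}\setminus\operatorname{int}N(K)$. A meridional disk is an oriented disk $D$, smoothly and properly embedded in $N(K)$, which meets $K$ transversely in exactly one point, with intersection number $+1$. Fix a meridional disk $D_0$ and a point $p_0\in F\cap\partial D_0$ (so $p_0\in\partial E(K)$). All products of paths are by concatenation, the left factor first. *Knot quandle.* A noose is a pair $(D,\alpha)$ of a meridional disk $D$ and a path $\alpha$ in $E(K)$ from a point of $\partial D$ to $p_0$. Two nooses are homotopic if they are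 joined by a homotopy of maps of the disk into $N(K)$, at each time sending exactly the boundary of the disk to $\partial N(K)$ and meeting $K$ in exactly one point, together with a homotopy of paths in $E(K)$ that at each time lead from the boundary of the disk to $p_0$. $Q(K)$ is the set of homotopy classes of nooses, with the operation $[(D,\alpha)]*[(E,\beta)]=[(D,\alpha\cdot\beta^{-1}\cdot\partial E\cdot\beta)]$, where $\partial E$ is the positively oriented boundary loop of $E$ based at the initial point of $\beta$. *Group data.* Let $G=\pi_1(F,p_0)$ and let $H\le G$ be the subgroup of the classes of loops in $F\cap N(K)$. The monodromy is the automorphism $\varphi$ of $G$ such that, for loops $\gamma,\delta$ in $F$ based at $p_0$, $\varphi([\gamma])=[\delta]$ if and only if $(\partial D_0)^{-1}\cdot\gamma\cdot\partial D_0$ is homotopic to $\delta$ in $S^{n+2}\setminus K$ relative to $p_0$. **Theorem.** The monodromy $\varphi$ exists and is unique, and it fixes every element of $H$. Both $Q(K)$ and the set $H\backslash G$ of right cosets with the operation $$Hx*Hy=H\,\varphi(xy^{-1})\,y$$ (the quotient of the generalized Alexander quandle $(G,\varphi)$ by $H$) are quandles, and they are isomorphic: there is a bijection $Q(K)\to H\backslash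 G$ that preserves the operations. -/

import Mathlib

open scoped Manifold ContDiff unitInterval Topology
open Set

noncomputable section

namespace FiberedKnot

/-! ### Quandles -/

/-- The axioms of a quandle for a binary operation on a set. -/
structure IsQuandle {X : Type*} (op : X → X → X) : Prop where
  nonempty : Nonempty X
  idem : ∀ x, op x x = x
  bijective : ∀ x, Function.Bijective fun w => op w x
  distrib : ∀ x y z, op (op x y) z = op (op x z) (op y z)

/-- The set `H \ G` of right cosets `H x`. -/
abbrev RightCosets {G : Type*} [Group G] (H : Subgroup G) : Type _ :=
  Quotient (QuotientGroup.rightRel H)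

/-- The operation `Hx ∗ Hy = H φ(x y⁻¹) y` on right cosets, where `φ` is an automorphism of `G`
fixing every element of `H`. -/
def quotientAlexanderOp {G : Type*} [Group G] (φ : G ≃* G) (H : Subgroup G)
    (hφ : ∀ h ∈ H, φ h = h) : RightCosets H → RightCosets H → RightCosets H :=
  Quotient.map₂ (fun x y => φ (x * y⁻¹) * y) (by
    intro x x' hx y y' hy
    have hx : x' * x⁻¹ ∈ H := QuotientGroup.rightRel_apply.1 hx
    have hy : y' * y⁻¹ ∈ H := QuotientGroup.rightRel_apply.1 hy
    refine QuotientGroup.rightRel_apply.2 ?_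
    have e1 : φ x' = x' * x⁻¹ * φ x := by
      rw [← hφ _ hx, ← map_mul]; simp
    have e2 : φ y' = y' * y⁻¹ * φ y := by
      rw [← hφ _ hy, ← map_mul]; simp
    have : φ (x' * y'⁻¹) * y' * (φ (x * y⁻¹) * y)⁻¹ = x' * x⁻¹ := by
      simp only [map_mul, map_inv, e1, e2]
      group
    rw [this]
    exact hx)

/-! ### The fundamental group, with concatenation of loops as product -/

/-- `π₁(X, x)` with the product `[γ] [δ] = [γ · δ]` (first `γ`, then `δ`).  Mathlib's
`FundamentalGroup` is multiplied in the opposite order. -/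
abbrev PiOne (X : Type*) [TopologicalSpace X] (x : X) : Type _ := (FundamentalGroup X x)ᵐᵒᵖ

/-- The class `[γ]` of a loop. -/
def loopClass {X : Type*} [TopologicalSpace X] {x : X} (γ : Path x x) : PiOne X x :=
  MulOpposite.op (FundamentalGroup.fromPath (Path.Homotopic.Quotient.mk γ))

theorem loopClass_trans {X : Type*} [TopologicalSpace X] {x : X} (γ δ : Path x x) :
    loopClass (γ.trans δ) = loopClass γ * loopClass δ := rfl

theorem loopClass_refl {X : Type*} [TopologicalSpace X] (x : X) :
    loopClass (Path.refl x) = 1 := rfl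

theorem loopClass_symm {X : Type*} [TopologicalSpace X] {x : X} (γ : Path x x) :
    loopClass γ.symm = (loopClass γ)⁻¹ := rfl

/-- The subgroup of `π₁(X, x)` consisting of the classes of the loops that lie in `A`. -/
def loopsIn {X : Type*} [TopologicalSpace X] (A : Set X) (x : X) (hx : x ∈ A) :
    Subgroup (PiOne X x) where
  carrier := {g | ∃ γ : Path x x, (∀ s, γ s ∈ A) ∧ loopClass γ = g}
  one_mem' := ⟨Path.refl x, fun _ => hx, loopClass_refl x⟩
  mul_mem' := by
    rintro _ _ ⟨γ, hγ, rfl⟩ ⟨δ, hδ, rfl⟩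
    refine ⟨γ.trans δ, fun s => ?_, loopClass_trans γ δ⟩
    have : γ.trans δ s ∈ range γ ∪ range δ := by
      rw [← Path.trans_range]; exact mem_range_self s
    rcases this with ⟨u, hu⟩ | ⟨u, hu⟩
    · rw [← hu]; exact hγ u
    · rw [← hu]; exact hδ u
  inv_mem' := by
    rintro _ ⟨γ, hγ, rfl⟩
    exact ⟨γ.symm, fun s => hγ _, loopClass_symm γ⟩

/-! ### Orientations and Seifert surfaces -/

/-- A family of orientations of the tangent spaces of a manifold (each tangent space being
identified with the model space by the preferred chart at the point) is continuous if, near each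
point `x`, it is constant when read in the chart at `x`. -/
def IsManifoldOrientation {m : ℕ} {H : Type*} [TopologicalSpace H]
    (J : ModelWithCorners ℝ (EuclideanSpace ℝ (Fin m)) H) {V : Type*} [TopologicalSpace V]
    [ChartedSpace H V] [IsManifold J 1 V]
    (o : V → Orientation ℝ (EuclideanSpace ℝ (Fin m)) (Fin m)) : Prop :=
  ∀ x, ∀ᶠ y in 𝓝 x, (o y = o x ↔ 0 < (tangentCoordChange J y x y).det)

/-- The ambient Euclidean space `ℝ^{n+3}`. -/
abbrev Amb (n : ℕ) : Type := EuclideanSpace ℝ (Fin (n + 2 + 1))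

/-- The sphere `S^{n+2}`. -/
abbrev Sph (n : ℕ) : Type := Metric.sphere (0 : Amb n) 1

/-- `Σ` is a Seifert surface of `K ⊆ S^{n+2}`: the image of a compact orientable smooth
`(n+1)`-manifold with boundary under a smooth embedding that maps the boundary onto `K`. -/
def IsSeifertSurface {n : ℕ} (K S : Set (Sph n)) : Prop :=
  ∃ (V : Type) (_ : TopologicalSpace V) (_ : ChartedSpace (EuclideanHalfSpace (n + 1)) V)
    (_ : IsManifold (𝓡∂ (n + 1)) ∞ V) (j : V → Sph n),
    CompactSpace V ∧ (∃ o, IsManifoldOrientation (𝓡∂ (n + 1)) (V := V) o) ∧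
    Manifold.IsSmoothEmbedding (𝓡∂ (n + 1)) (𝓡 (n + 2)) ∞ j ∧
    range j = S ∧ j '' (𝓡∂ (n + 1)).boundary V = K

/-! ### Knots, fibrations, tubular neighbourhoods -/

variable {n : ℕ} {M : Type*} [TopologicalSpace M] [ChartedSpace (EuclideanSpace ℝ (Fin n)) M]
  [IsManifold (𝓡 n) ∞ M]

/-- An `n`-knot: a smooth embedding into `S^{n+2}` of an oriented smooth manifold `M`
homeomorphic to `S^n`. -/
structure NKnot (n : ℕ) (M : Type*) [TopologicalSpace M]
    [ChartedSpace (EuclideanSpace ℝ (Fin n)) M]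
    [IsManifold (𝓡 n) ∞ M] where
  homeo : Nonempty (M ≃ₜ Metric.sphere (0 : EuclideanSpace ℝ (Fin (n + 1))) 1)
  orient : M → Orientation ℝ (EuclideanSpace ℝ (Fin n)) (Fin n)
  isOrientation : IsManifoldOrientation (𝓡 n) orient
  emb : M → Sph n
  smooth : Manifold.IsSmoothEmbedding (𝓡 n) (𝓡 (n + 2)) ∞ emb

namespace NKnot

variable (K : NKnot n M)

/-- The underlying subset of `S^{n+2}`. -/
def carrier : Set (Sph n) := range K.emb

/-- The complement `S^{n+2} \ K`. -/
abbrev Compl : Type := {y : Sph n // y ∉ K.carrier}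

/-- Two tangent vectors `a, b` of `S^{n+2}` at the point `x` of `K` span a plane transverse to `K`
whose intersection number with `K` is `+1`: if `e` is a positive basis of `T_x K`, then
`(e, a, b)` is a positive basis of `T_x S^{n+2}`, the sphere being oriented as the boundary of
the unit ball. -/
def IsPositiveNormalPair (x : M) (a b : Amb n) : Prop :=
  ∀ e : Module.Basis (Fin n) ℝ (EuclideanSpace ℝ (Fin n)), e.orientation = K.orient x →
    let de : Fin n → Amb n := fun i =>
      mfderiv (𝓡 n) 𝓘(ℝ, Amb n) (fun y => (K.emb y : Amb n)) x (e i)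
    let v : Fin (n + 2 + 1) → Amb n := Fin.cons (K.emb x : Amb n) (Fin.append de ![a, b])
    0 < Matrix.det (Matrix.of fun i j => v i j)

end NKnot

/-- A fibration of the complement of `K` over the circle that makes `K` a fibered knot. -/
structure Fibration (K : NKnot n M) where
  proj : K.Compl → Circle
  /-- local triviality, with fiber the preimage of `1` -/
  locally_trivial : ∀ s : Circle, ∃ e : Bundle.Trivialization {y : K.Compl // proj y = 1} proj,
    s ∈ e.baseSet
  seifert : ∀ s : Circle,
    IsSeifertSurface K.carrier (closure (Subtype.val '' {y : K.Compl | proj y = s}))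

/-- The fiber `F₀ = π⁻¹(1)`. -/
abbrev Fibration.Fiber {K : NKnot n M} (P : Fibration K) : Type :=
  {y : K.Compl // P.proj y = 1}

/-- A (trivialized, oriented) tubular neighbourhood of `K`: a diffeomorphism `τ` of `M × ℂ` onto an
open neighbourhood of `K`, given by the knot on `M × 0`, such that each `τ({x} × ℂ)` meets `K` with
intersection number `+1`.  The closed tubular neighbourhood `N(K)` is the image of `M × D²`. -/
structure Tube (K : NKnot n M) where
  toFun : M × ℂ → Sph n
  localDiffeo : IsLocalDiffeomorph ((𝓡 n).prod 𝓘(ℝ, ℂ)) (𝓡 (n + 2)) ∞ toFun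
  injective : Function.Injective toFun
  zero_section : ∀ x, toFun (x, 0) = K.emb x
  oriented : ∀ x, K.IsPositiveNormalPair x
    (fderiv ℝ (fun z : ℂ => (toFun (x, z) : Amb n)) 0 1)
    (fderiv ℝ (fun z : ℂ => (toFun (x, z) : Amb n)) 0 Complex.I)

namespace Tube

variable {K : NKnot n M} (T : Tube K)

/-- The closed tubular neighbourhood `N(K)`. -/
def nbhd : Set (Sph n) := T.toFun '' {q | ‖q.2‖ ≤ 1}

/-- The boundary `∂N(K) = ∂E(K)`. -/
def bdry : Set (Sph n) := T.toFun '' {q | ‖q.2‖ = 1}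

/-- The exterior `E(K)`, the complement of the interior of `N(K)`. -/
def exterior : Set (Sph n) := (T.toFun '' {q | ‖q.2‖ < 1})ᶜ

/-- `N(K)` is adapted to the fibration: `F₀ ∩ N(K)` is an (open at `K`) collar `M × (0, 1]`
of the boundary `K` of the closure of `F₀`. -/
def IsAdapted (P : Fibration K) : Prop :=
  Subtype.val '' {y : K.Compl | P.proj y = 1} ∩ T.nbhd =
    T.toFun '' {q | ∃ r : ℝ, 0 < r ∧ r ≤ 1 ∧ q.2 = (r : ℂ)}

theorem bdry_disjoint {y : Sph n} (hy : y ∈ T.bdry) : y ∉ K.carrier := by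
  rintro ⟨x, rfl⟩
  obtain ⟨q, hq, h⟩ := hy
  rw [← T.zero_section] at h
  have := T.injective h
  subst this
  simp at hq

theorem bdry_subset_nbhd {y : Sph n} (hy : y ∈ T.bdry) : y ∈ T.nbhd := by
  obtain ⟨q, hq, h⟩ := hy
  exact ⟨q, le_of_eq hq, h⟩

theorem bdry_subset_exterior {y : Sph n} (hy : y ∈ T.bdry) : y ∈ T.exterior := by
  obtain ⟨q, hq, rfl⟩ := hy
  rintro ⟨q', hq', h⟩
  have := T.injective h
  subst this
  exact (ne_of_lt hq') hq

end Tube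

/-! ### Meridional disks, nooses, and the knot quandle -/

/-- The closed unit disk `D²`. -/
abbrev D2 : Type := Metric.closedBall (0 : ℂ) 1

/-- The point `exp(2πis)` of the boundary of the disk. -/
def circlePt (s : ℝ) : D2 :=
  ⟨Complex.exp (2 * Real.pi * s * Complex.I), by
    have : (2 * Real.pi * s * Complex.I : ℂ) = ((2 * Real.pi * s : ℝ) : ℂ) * Complex.I := by
      push_cast; ring
    rw [mem_closedBall_zero_iff, this, Complex.norm_exp_ofReal_mul_I]⟩

theorem norm_circlePt (s : ℝ) : ‖(circlePt s : ℂ)‖ = 1 := by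
  have : (2 * Real.pi * s * Complex.I : ℂ) = ((2 * Real.pi * s : ℝ) : ℂ) * Complex.I := by
    push_cast; ring
  change ‖Complex.exp (2 * Real.pi * s * Complex.I)‖ = 1
  rw [this, Complex.norm_exp_ofReal_mul_I]

theorem continuous_circlePt : Continuous circlePt := by
  unfold circlePt
  fun_prop

theorem circlePt_zero_eq_one : circlePt 0 = circlePt 1 := by
  apply Subtype.ext
  simp [circlePt, Complex.exp_two_pi_mul_I]

/-- A positive meridional disk of `K`, given by an orientation preserving parametrization by `D²`
(only the values on `D²` matter): a disk smoothly and properly embedded in `N(K)` that meets `K`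
transversely in exactly one point, with intersection number `+1`. -/
structure MeridionalDisk {K : NKnot n M} (T : Tube K) where
  toFun : ℂ → Sph n
  smooth : ContMDiffOn 𝓘(ℝ, ℂ) (𝓡 (n + 2)) ∞ toFun (Metric.closedBall 0 1)
  injOn : InjOn toFun (Metric.closedBall 0 1)
  immersion : ∀ z ∈ Metric.closedBall (0 : ℂ) 1, Function.Injective
    (mfderivWithin 𝓘(ℝ, ℂ) (𝓡 (n + 2)) toFun (Metric.closedBall 0 1) z)
  mem_nbhd : ∀ z ∈ Metric.closedBall (0 : ℂ) 1, toFun z ∈ T.nbhd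
  mem_bdry : ∀ z ∈ Metric.closedBall (0 : ℂ) 1, (toFun z ∈ T.bdry ↔ ‖z‖ = 1)
  meets : ∃ x : M, ∃ w ∈ Metric.closedBall (0 : ℂ) 1, toFun w = K.emb x ∧
    (∀ z ∈ Metric.closedBall (0 : ℂ) 1, toFun z ∈ K.carrier → z = w) ∧
    K.IsPositiveNormalPair x
      (fderiv ℝ (fun z : ℂ => (toFun z : Amb n)) w 1)
      (fderiv ℝ (fun z : ℂ => (toFun z : Amb n)) w Complex.I)

/-- A map `D² → N(K)` that is proper, i.e. exactly the boundary of the disk is sent to `∂N(K)`,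
and that meets `K` in exactly one point. -/
def IsProperDiskMap {K : NKnot n M} (T : Tube K) (f : D2 → Sph n) : Prop :=
  (∀ z, f z ∈ T.nbhd) ∧ (∀ z, f z ∈ T.bdry ↔ ‖(z : ℂ)‖ = 1) ∧ ∃! z, f z ∈ K.carrier

namespace MeridionalDisk

variable {K : NKnot n M} {T : Tube K} (D : MeridionalDisk T)

theorem continuous_restrict : Continuous fun z : D2 => D.toFun z :=
  continuousOn_iff_continuous_domRestrict.1 D.smooth.continuousOn

theorem isProperDiskMap : IsProperDiskMap T fun z : D2 => D.toFun z := by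
  refine ⟨fun z => D.mem_nbhd z z.2, fun z => D.mem_bdry z z.2, ?_⟩
  obtain ⟨x, w, hw, hx, huniq, -⟩ := D.meets
  exact ⟨⟨w, hw⟩, ⟨x, hx.symm⟩, fun z hz => Subtype.ext (huniq z z.2 hz)⟩

end MeridionalDisk

/-- The loop `s ↦ f(exp(2πis))` running once around the boundary of a disk along its
orientation. -/
def diskLoop {X : Type*} [TopologicalSpace X] (f : D2 → X) (hf : Continuous f) :
    Path (f (circlePt 0)) (f (circlePt 0)) where
  toFun s := f (circlePt s)
  continuous_toFun := hf.comp (continuous_circlePt.comp continuous_subtype_val)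
  source' := rfl
  target' := by simp only [circlePt_zero_eq_one]; rfl

/-- A noose of `K` with base point `p`: a meridional disk `D` and a path in `E(K)` from a point of
`∂D` to `p`.  The orientation preserving parametrization of `D` is chosen such that the path starts
at the image of `1 = circlePt 0`. -/
structure Noose {K : NKnot n M} (T : Tube K) (p : Sph n) where
  disk : MeridionalDisk T
  path : Path (disk.toFun (circlePt 0)) p
  path_mem : ∀ s, path s ∈ T.exterior

namespace Noose

variable {K : NKnot n M} {T : Tube K} {p : Sph n}

/-- The loop `∂D` of a noose `(D, α)`, based at the initial point of `α`. -/
def boundaryLoop (a : Noose T p) :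
    Path (a.disk.toFun (circlePt 0)) (a.disk.toFun (circlePt 0)) :=
  diskLoop (fun z : D2 => a.disk.toFun z) a.disk.continuous_restrict

/-- The noose `(D, α · β⁻¹ · ∂E · β)` obtained from the nooses `(D, α)` and `(E, β)`. -/
def op (a b : Noose T p) : Noose T p where
  disk := a.disk
  path := ((a.path.trans b.path.symm).trans b.boundaryLoop).trans b.path
  path_mem s := by
    have h1 := mem_range_self (f := ((a.path.trans b.path.symm).trans b.boundaryLoop).trans b.path)
      s
    rw [Path.trans_range, Path.trans_range, Path.trans_range, Path.symm_range] at h1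
    rcases h1 with ((⟨u, hu⟩ | ⟨u, hu⟩) | ⟨u, hu⟩) | ⟨u, hu⟩
    · rw [← hu]; exact a.path_mem u
    · rw [← hu]; exact b.path_mem u
    · rw [← hu]
      exact T.bdry_subset_exterior ((b.disk.mem_bdry _ (circlePt u).2).2 (norm_circlePt u))
    · rw [← hu]; exact b.path_mem u

/-- Homotopy of nooses: a homotopy `HD` of maps of the disk into `N(K)`, each proper and meeting
`K` in exactly one point (the intersection number stays `+1`, being the winding number of the
boundary around `K`), and a homotopy `HP` of paths in `E(K)`, the path at time `t` leading from the
boundary of the disk at time `t` to `p`. -/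
def Homotopic (a b : Noose T p) : Prop :=
  ∃ (HD : C(D2 × I, Sph n)) (HP : ∀ t : I, Path (HD (circlePt 0, t)) p),
    Continuous (fun q : I × I => HP q.1 q.2) ∧
    (∀ t, IsProperDiskMap T fun z => HD (z, t)) ∧
    (∀ t s, HP t s ∈ T.exterior) ∧
    (∀ z : D2, HD (z, 0) = a.disk.toFun z) ∧ (∀ s, HP 0 s = a.path s) ∧
    (∀ z : D2, HD (z, 1) = b.disk.toFun z) ∧ (∀ s, HP 1 s = b.path s)

theorem Homotopic.refl (a : Noose T p) : Homotopic a a :=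
  ⟨⟨fun q => a.disk.toFun q.1, a.disk.continuous_restrict.comp continuous_fst⟩, fun _ => a.path,
    a.path.continuous.comp continuous_snd, fun _ => a.disk.isProperDiskMap,
    fun _ s => a.path_mem s, fun _ => rfl, fun _ => rfl, fun _ => rfl, fun _ => rfl⟩

theorem path_trans_congr {X : Type*} [TopologicalSpace X] {x y z x' y' z' : X}
    {γ : Path x y} {δ : Path y z} {γ' : Path x' y'} {δ' : Path y' z'}
    (h1 : ∀ s, γ s = γ' s) (h2 : ∀ s, δ s = δ' s) (s : I) :
    γ.trans δ s = γ'.trans δ' s := by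
  simp only [Path.trans_apply, h1, h2]

theorem Homotopic.op {a a' b b' : Noose T p} (h : Homotopic a a') (h' : Homotopic b b') :
    Homotopic (a.op b) (a'.op b') := by
  obtain ⟨HD, HP, hc, hD, hE, hD0, hP0, hD1, hP1⟩ := h
  obtain ⟨GD, GP, gc, gD, gE, gD0, gP0, gD1, gP1⟩ := h'
  have hGt : ∀ t : I, Continuous fun z : D2 => GD (z, t) := fun t => by fun_prop
  let L : ∀ t : I, Path (GD (circlePt 0, t)) (GD (circlePt 0, t)) := fun t =>
    diskLoop (fun z => GD (z, t)) (hGt t)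
  have hL : Continuous fun q : I × I => L q.1 q.2 := by
    change Continuous fun q : I × I => GD (circlePt q.2, q.1)
    exact GD.continuous.comp (((continuous_circlePt.comp continuous_subtype_val).comp
      continuous_snd).prodMk continuous_fst)
  refine ⟨HD, fun t => (((HP t).trans (GP t).symm).trans (L t)).trans (GP t), ?_, hD, ?_, hD0, ?_,
    hD1, ?_⟩
  · exact Path.trans_continuous_family _
      (Path.trans_continuous_family _
        (Path.trans_continuous_family _ hc _ (Path.symm_continuous_family _ gc)) _ hL) _ gc
  · intro t s
    have h1 := mem_range_self (f := (((HP t).trans (GP t).symm).trans (L t)).trans (GP t)) s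
    rw [Path.trans_range, Path.trans_range, Path.trans_range, Path.symm_range] at h1
    rcases h1 with ((⟨u, hu⟩ | ⟨u, hu⟩) | ⟨u, hu⟩) | ⟨u, hu⟩
    · rw [← hu]; exact hE t u
    · rw [← hu]; exact gE t u
    · rw [← hu]; exact T.bdry_subset_exterior (((gD t).2.1 _).2 (norm_circlePt u))
    · rw [← hu]; exact gE t u
  · exact path_trans_congr (path_trans_congr (path_trans_congr hP0 fun s => gP0 _)
      fun s => gD0 _) gP0
  · exact path_trans_congr (path_trans_congr (path_trans_congr hP1 fun s => gP1 _)
      fun s => gD1 _) gP1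

end Noose

/-- The underlying set of the knot quandle `Q(K)`: the homotopy classes of nooses. -/
def KnotQuandle {K : NKnot n M} (T : Tube K) (p : Sph n) : Type :=
  Quot (Noose.Homotopic (T := T) (p := p))

/-- The operation `[(D, α)] ∗ [(E, β)] = [(D, α · β⁻¹ · ∂E · β)]` on the knot quandle. -/
def KnotQuandle.op {K : NKnot n M} {T : Tube K} {p : Sph n} :
    KnotQuandle T p → KnotQuandle T p → KnotQuandle T p :=
  Quot.map₂ Noose.op (fun a _ _ h => (Noose.Homotopic.refl a).op h)
    (fun _ _ b h => h.op (Noose.Homotopic.refl b))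

/-! ### The peripheral subgroup and the monodromy -/

section Monodromy

variable {K : NKnot n M} {T : Tube K}

/-- The loop `∂D₀` in the complement of `K`, based at the point `p₀` of the fiber. -/
def meridian {P : Fibration K} (D₀ : MeridionalDisk T) (p₀ : P.Fiber)
    (hp₀ : D₀.toFun (circlePt 0) = p₀.1.1) : Path p₀.1 p₀.1 where
  toFun s := ⟨D₀.toFun (circlePt s),
    T.bdry_disjoint ((D₀.mem_bdry _ (circlePt s).2).2 (norm_circlePt s))⟩
  continuous_toFun := (D₀.continuous_restrict.comp
    (continuous_circlePt.comp continuous_subtype_val)).subtype_mk _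
  source' := Subtype.ext hp₀
  target' := Subtype.ext (by
    change D₀.toFun (circlePt 1) = _
    rw [← circlePt_zero_eq_one]; exact hp₀)

/-- `φ` is the monodromy: it sends the class of a loop `γ` in the fiber to the class of a loop `δ`
in the fiber precisely if `(∂D₀)⁻¹ · γ · ∂D₀` is homotopic to `δ`, relative to the base point, in
the complement of `K`. -/
def IsMonodromy (P : Fibration K) (D₀ : MeridionalDisk T) (p₀ : P.Fiber)
    (hp₀ : D₀.toFun (circlePt 0) = p₀.1.1) (φ : PiOne P.Fiber p₀ ≃* PiOne P.Fiber p₀) : Prop :=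
  ∀ γ δ : Path p₀ p₀, φ (loopClass γ) = loopClass δ ↔
    Path.Homotopic
      (((meridian D₀ p₀ hp₀).symm.trans (γ.map continuous_subtype_val)).trans (meridian D₀ p₀ hp₀))
      (δ.map continuous_subtype_val)

/-- The subgroup `H` of `π₁(F₀, p₀)` consisting of the classes of the loops in `F₀ ∩ N(K)`. -/
def peripheral (P : Fibration K) (D₀ : MeridionalDisk T) (p₀ : P.Fiber)
    (hp₀ : D₀.toFun (circlePt 0) = p₀.1.1) : Subgroup (PiOne P.Fiber p₀) :=
  loopsIn {y : P.Fiber | y.1.1 ∈ T.nbhd} p₀ (by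
    change p₀.1.1 ∈ T.nbhd
    rw [← hp₀]
    exact D₀.mem_nbhd _ (circlePt 0).2)

end Monodromy

end FiberedKnot

end

open FiberedKnot

/-! Let Γ be the fundamental group of the complement of K at p₀, and m the class of ∂D₀. The total
angle of π along a loop is a homomorphism Γ → ℝ. The pullback of π to the line is trivial over every
compact interval, so loops and homotopies of angle zero can be pushed into F: G embeds in Γ as the
kernel of the angle (`Fibration.inclHom_injective`, `Fibration.exists_inclHom_eq`). Conjugation by m
preserves the kernel because ℝ is commutative, and this is φ. Some integral multiple of the angle of
m is 2π (`Tube.IsAdapted.exists_int_mul_angle`), hence Γ = ⟨m⟩G and ⟨m⟩ ∩ G = 1.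

Running from p₀ to ∂D inside the tube minus K and then along α turns a noose (D, α) into an element
of Γ (`Noose.Represents`), defined up to left multiplication by classes of loops in the tube minus
K. Conversely, nooses whose elements differ by such a class are homotopic. Thus Q(K) is the set of
right cosets of this peripheral subgroup. Logarithmic polar coordinates M × ℂ show that the subgroup
is H⟨m⟩ and that H commutes with m; so φ fixes H, and each coset meets G in exactly one coset of H.
If g and g' in G represent two nooses, their product is represented by g g'⁻¹ m g', hence also by
m⁻¹ g g'⁻¹ m g' = φ(g g'⁻¹) g', which is the quandle operation on H\G.

The main geometric point is that every meridional disk can be deformed to a fiber of the tube,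
through proper disks that meet K once, with the starting point of the noose path fixed
(`MeridionalDisk.joinedIn_stdDisk`). The M-coordinate is contracted along the disk. The normal
coordinate is a proper self-map of the disk with one zero w; positivity of the intersection makes it
a Blaschke factor times exp h with h continuous away from w, and deforming h to a constant and w to
0 leaves a rotation (`joinedIn_diskRotation`). Homotopies of paths are pushed out of the tube by the
radial retraction onto the exterior. -/

noncomputable section

namespace FiberedKnot

/-! ### Homotopy squares -/

/-- The retraction of the plane onto the unit square. -/
def squareProj (q : ℝ × ℝ) : I × I :=
  (projIcc 0 1 zero_le_one q.1, projIcc 0 1 zero_le_one q.2)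

theorem continuous_squareProj : Continuous squareProj :=
  (continuous_projIcc.comp continuous_fst).prodMk (continuous_projIcc.comp continuous_snd)

@[simp] theorem squareProj_coe (s t : I) : squareProj (s, t) = (s, t) := by
  simp [squareProj]

/-- The two ways around the unit square are homotopic in the plane, which is simply connected;
composing `F` with the retraction onto the square carries that homotopy to `X`. -/
theorem homotopic_of_square {X : Type*} [TopologicalSpace X] {a b c d : X} (p : Path a b)
    (q : Path b d) (r : Path a c) (s : Path c d) (F : I × I → X) (hF : Continuous F)
    (hp : ∀ t, F (t, 0) = p t) (hq : ∀ t, F (1, t) = q t) (hr : ∀ t, F (0, t) = r t)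
    (hs : ∀ t, F (t, 1) = s t) : (p.trans q).Homotopic (r.trans s) := by
  obtain rfl : F (0, 0) = a := by rw [hp, p.source]
  obtain rfl : F (1, 0) = b := by rw [hp, p.target]
  obtain rfl : F (0, 1) = c := by rw [hr, r.target]
  obtain rfl : F (1, 1) = d := by rw [hq, q.target]
  let p' : Path (((0 : I), (0 : I)) : ℝ × ℝ) ((1 : I), (0 : I)) :=
    ⟨⟨fun t => (t, (0 : I)), by fun_prop⟩, rfl, rfl⟩
  let q' : Path (((1 : I), (0 : I)) : ℝ × ℝ) ((1 : I), (1 : I)) :=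
    ⟨⟨fun t => ((1 : I), t), by fun_prop⟩, rfl, rfl⟩
  let r' : Path (((0 : I), (0 : I)) : ℝ × ℝ) ((0 : I), (1 : I)) :=
    ⟨⟨fun t => ((0 : I), t), by fun_prop⟩, rfl, rfl⟩
  let s' : Path (((0 : I), (1 : I)) : ℝ × ℝ) ((1 : I), (1 : I)) :=
    ⟨⟨fun t => (t, (1 : I)), by fun_prop⟩, rfl, rfl⟩
  have hFs : Continuous (F ∘ squareProj) := hF.comp continuous_squareProj
  have ext {u v : ℝ × ℝ} {w z : X} (γ : Path u v) (δ : Path w z)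
      (h : ∀ t, F (squareProj (γ t)) = δ t) (hu : w = F (squareProj u))
      (hv : z = F (squareProj v)) : δ = (γ.map hFs).cast hu hv := by
    ext t; exact (h t).symm
  have c0 : F (0, 0) = F (squareProj ((0 : I), (0 : I))) := by rw [squareProj_coe]
  have c1 : F (1, 0) = F (squareProj ((1 : I), (0 : I))) := by rw [squareProj_coe]
  have c2 : F (0, 1) = F (squareProj ((0 : I), (1 : I))) := by rw [squareProj_coe]
  have c3 : F (1, 1) = F (squareProj ((1 : I), (1 : I))) := by rw [squareProj_coe]
  rw [ext p' p (fun t => (congrArg F (squareProj_coe _ _)).trans (hp t)) c0 c1,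
    ext q' q (fun t => (congrArg F (squareProj_coe _ _)).trans (hq t)) c1 c3,
    ext r' r (fun t => (congrArg F (squareProj_coe _ _)).trans (hr t)) c0 c2,
    ext s' s (fun t => (congrArg F (squareProj_coe _ _)).trans (hs t)) c2 c3]
  have := ((SimplyConnectedSpace.paths_homotopic (p'.trans q') (r'.trans s')).map
    ⟨_, hFs⟩).pathCast c0 c3
  convert! this using 1
  · ext t; simp [Path.trans_apply]
  · ext t; simp [Path.trans_apply]

/-! ### The total angle of a path in the circle -/

/-- Extended to the plane through `squareProj`, the map has a simply connected domain and lifts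
through the covering ℝ → S¹. -/
theorem exists_lift_square (F : I × I → Circle) (hF : Continuous F) (t₀ : ℝ)
    (h : Circle.exp t₀ = F (0, 0)) :
    ∃ G : I × I → ℝ, Continuous G ∧ (∀ q, Circle.exp (G q) = F q) ∧ G (0, 0) = t₀ := by
  obtain ⟨G, ⟨hG0, hG⟩, -⟩ := Circle.isCoveringMap_exp.existsUnique_continuousMap_lifts
    (⟨F ∘ squareProj, hF.comp continuous_squareProj⟩ : C(ℝ × ℝ, Circle)) ((0 : I), (0 : I)) t₀
    (by rw [h]; exact (congrArg F (squareProj_coe 0 0)).symm)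
  refine ⟨fun q => G (q.1, q.2), by fun_prop, fun q => ?_, by simpa using hG0⟩
  exact (congrFun hG (q.1, q.2)).trans (congrArg F (squareProj_coe _ _))

/-- The path `f` in the circle winds by the total angle `θ`. -/
def HasAngle (f : I → Circle) (θ : ℝ) : Prop :=
  ∃ g : I → ℝ, Continuous g ∧ (∀ s, Circle.exp (g s) = f s) ∧ g 1 - g 0 = θ

theorem exists_circle_exp (z : Circle) : ∃ t : ℝ, Circle.exp t = z :=
  ⟨_, Circle.exp_arg z⟩

theorem exists_lift_path (f : I → Circle) (hf : Continuous f) (t₀ : ℝ)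
    (h : Circle.exp t₀ = f 0) :
    ∃ g : I → ℝ, Continuous g ∧ (∀ s, Circle.exp (g s) = f s) ∧ g 0 = t₀ := by
  obtain ⟨G, hG, hG', h0⟩ := exists_lift_square (fun q => f q.2) (by fun_prop) t₀ h
  exact ⟨fun s => G (0, s), by fun_prop, fun s => hG' _, h0⟩

theorem exists_hasAngle (f : I → Circle) (hf : Continuous f) : ∃ θ, HasAngle f θ := by
  obtain ⟨t, ht⟩ := exists_circle_exp (f 0)
  obtain ⟨g, hg, hg', -⟩ := exists_lift_path f hf t ht
  exact ⟨_, g, hg, hg', rfl⟩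

/-- Uniqueness of lifts: `g'` shifted by `g 0 - g' 0` is another lift of the same path and agrees
with `g` at 0. -/
theorem lift_path_sub_eq {g g' : I → ℝ} (hg : Continuous g) (hg' : Continuous g')
    (h : ∀ s, Circle.exp (g s) = Circle.exp (g' s)) (s : I) : g s - g' s = g 0 - g' 0 := by
  have := Circle.isCoveringMap_exp.eq_of_comp_eq (A := I) (g₁ := g)
    (g₂ := fun s => g' s + (g 0 - g' 0)) hg (by fun_prop) (by
      ext1 s
      simp [Circle.exp_add, Circle.exp_sub, h]) 0 (by simp)
  have := congrFun this s
  linarith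

theorem HasAngle.unique {f : I → Circle} {θ θ' : ℝ} (h : HasAngle f θ) (h' : HasAngle f θ') :
    θ = θ' := by
  obtain ⟨g, hg, hgf, rfl⟩ := h
  obtain ⟨g', hg', hgf', rfl⟩ := h'
  have := lift_path_sub_eq hg hg' (fun s => by rw [hgf, hgf']) 1
  linarith

theorem HasAngle.const (c : Circle) : HasAngle (fun _ => c) 0 := by
  obtain ⟨t, ht⟩ := exists_circle_exp c
  exact ⟨fun _ => t, by fun_prop, fun _ => ht, by simp⟩

theorem HasAngle.eq_int {f : I → Circle} {θ : ℝ} (h : HasAngle f θ) (hf : f 0 = f 1) :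
    ∃ k : ℤ, θ = k * (2 * Real.pi) := by
  obtain ⟨g, hg, hgf, rfl⟩ := h
  obtain ⟨k, hk⟩ := Circle.exp_eq_exp.1 ((hgf 1).trans (hf.symm.trans (hgf 0).symm))
  exact ⟨k, by rw [hk]; ring⟩

section

variable {X : Type*} [TopologicalSpace X] {f : X → Circle}

theorem HasAngle.trans {a b c : X} {γ : Path a b} {δ : Path b c} {θ θ' : ℝ}
    (h : HasAngle (fun s => f (γ s)) θ) (h' : HasAngle (fun s => f (δ s)) θ') :
    HasAngle (fun s => f (γ.trans δ s)) (θ + θ') := by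
  obtain ⟨g, hg, hgf, rfl⟩ := h
  obtain ⟨g', hg', hgf', rfl⟩ := h'
  let p : Path (g 0) (g 1) := ⟨⟨g, hg⟩, rfl, rfl⟩
  let q : Path (g 1) (g 1 + (g' 1 - g' 0)) :=
    ⟨⟨fun s => g 1 + (g' s - g' 0), by fun_prop⟩, by simp, by simp⟩
  have hq : ∀ s, Circle.exp (q s) = f (δ s) := fun s => by
    change Circle.exp (g 1 + (g' s - g' 0)) = _
    rw [Circle.exp_add, Circle.exp_sub, hgf, hgf', hgf']
    simp
  refine ⟨p.trans q, (p.trans q).continuous, fun s => ?_, ?_⟩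
  · simp only [Path.trans_apply]
    split_ifs
    · exact hgf _
    · exact hq _
  · simp only [Path.target, Path.source]; ring

theorem HasAngle.symm {a b : X} {γ : Path a b} {θ : ℝ}
    (h : HasAngle (fun s => f (γ s)) θ) : HasAngle (fun s => f (γ.symm s)) (-θ) := by
  obtain ⟨g, hg, hgf, rfl⟩ := h
  exact ⟨fun s => g (σ s), by fun_prop, fun s => hgf _, by simp⟩

/-- A lift of the homotopy is constant on the two sides of the square where the endpoints stay
fixed, so both remaining sides have the same increment. -/
theorem HasAngle.of_homotopic (hf : Continuous f) {a b : X} {γ δ : Path a b} {θ : ℝ}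
    (H : γ.Homotopic δ)
    (h : HasAngle (fun s => f (γ s)) θ) : HasAngle (fun s => f (δ s)) θ := by
  obtain ⟨H⟩ := H
  obtain ⟨t, ht⟩ := exists_circle_exp (f (H (0, 0)))
  obtain ⟨G, hG, hGf, -⟩ := exists_lift_square (fun q => f (H q)) (by fun_prop) t ht
  have e0 := lift_path_sub_eq (g := fun t => G (t, 0)) (g' := fun _ => G (0, 0)) (by fun_prop)
    (by fun_prop) (fun s => by rw [hGf, hGf, H.source, H.source]) 1
  have e1 := lift_path_sub_eq (g := fun t => G (t, 1)) (g' := fun _ => G (0, 1)) (by fun_prop)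
    (by fun_prop) (fun s => by rw [hGf, hGf, H.target, H.target]) 1
  have : HasAngle (fun s => f (γ s)) (G (0, 1) - G (0, 0)) :=
    ⟨fun s => G (0, s), by fun_prop, fun s => by rw [hGf]; simp, rfl⟩
  rw [h.unique this]
  refine ⟨fun s => G (1, s), by fun_prop, fun s => by rw [hGf]; simp, ?_⟩
  linarith

end

/-! ### Bundles over the circle -/

section Bundle

variable {X : Type*} [TopologicalSpace X] {p : X → Circle} {F : Type*} [TopologicalSpace F]

/-- The pullback of `p : X → S¹` to the real line. -/
abbrev CyclicCover (p : X → Circle) : Type _ := {q : X × ℝ // p q.1 = Circle.exp q.2}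

/-- The projection of the cyclic cover to the real line. -/
abbrev cyclicProj (p : X → Circle) (q : CyclicCover p) : ℝ := q.1.2

open Classical in
/-- The pullback to the cyclic cover of a local trivialization. -/
def pullbackTrivialization [Nonempty (CyclicCover p)] (e : Bundle.Trivialization F p) :
    Bundle.Trivialization F (cyclicProj p) where
  toFun q := (q.1.2, (e q.1.1).2)
  invFun y := if h : Circle.exp y.1 ∈ e.baseSet then
      ⟨(e.toOpenPartialHomeomorph.symm (Circle.exp y.1, y.2), y.1), e.proj_symm_apply' h⟩
    -- An irrelevant value outside the target; only here is a point of the cyclic cover needed.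
    else Classical.arbitrary _
  source := {q | Circle.exp q.1.2 ∈ e.baseSet}
  target := {y | Circle.exp y.1 ∈ e.baseSet}
  map_source' q hq := hq
  map_target' y hy := by
    have hy : Circle.exp y.1 ∈ e.baseSet := hy
    simp [hy]
  left_inv' q hq := by
    have hq : Circle.exp q.1.2 ∈ e.baseSet := hq
    have hq' : p q.1.1 ∈ e.baseSet := by rw [q.2]; exact hq
    simp only [hq, dif_pos]
    refine Subtype.ext (Prod.ext ?_ rfl)
    simp only
    rw [← q.2]
    exact e.symm_apply_mk_proj (e.mem_source.2 hq')
  right_inv' y hy := by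
    have hy : Circle.exp y.1 ∈ e.baseSet := hy
    simp only [hy, dif_pos]
    rw [e.apply_symm_apply' hy]
  open_source := e.open_baseSet.preimage (by fun_prop)
  open_target := e.open_baseSet.preimage (by fun_prop)
  continuousOn_toFun := by
    refine ContinuousOn.prodMk (by fun_prop) (continuous_snd.comp_continuousOn ?_)
    refine e.continuousOn_toFun.comp (by fun_prop) fun q hq => ?_
    have hq : Circle.exp q.1.2 ∈ e.baseSet := hq
    refine e.mem_source.2 ?_
    rw [q.2]; exact hq
  continuousOn_invFun := by
    refine (Topology.IsInducing.subtypeVal (t := fun q : X × ℝ => p q.1 = Circle.exp q.2)).continuousOn_iff.2 ?_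
    have : ContinuousOn (fun y : ℝ × F =>
        (e.toOpenPartialHomeomorph.symm (Circle.exp y.1, y.2), y.1))
        {y | Circle.exp y.1 ∈ e.baseSet} := by
      refine ContinuousOn.prodMk ?_ (by fun_prop)
      refine e.continuousOn_invFun.comp (by fun_prop) fun y hy => ?_
      exact e.mem_target.2 hy
    refine this.congr fun y hy => ?_
    have hy : Circle.exp y.1 ∈ e.baseSet := hy
    simp [hy]
  baseSet := {t | Circle.exp t ∈ e.baseSet}
  open_baseSet := e.open_baseSet.preimage (by fun_prop)
  source_eq := rfl
  target_eq := by ext; simp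
  proj_toFun q hq := rfl

/-- A locally trivial map to a linear order can be trivialized over each closed interval. -/
theorem exists_trivialization_Icc {Z B : Type*} [TopologicalSpace Z] [TopologicalSpace B]
    [ConditionallyCompleteLinearOrder B] [OrderTopology B] [DenselyOrdered B] {q : Z → B}
    (hq : ∀ x, ∃ e : Bundle.Trivialization F q, x ∈ e.baseSet) (a b : B) :
    ∃ e : Bundle.Trivialization F q, Icc a b ⊆ e.baseSet := by
  obtain ⟨ea, hea⟩ := hq a
  rcases lt_or_ge b a with _ | hab
  · exact ⟨ea, by simp [*]⟩
  set s : Set B := {x ∈ Icc a b | ∃ e : Bundle.Trivialization F q, Icc a x ⊆ e.baseSet}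
  have ha : a ∈ s := ⟨left_mem_Icc.2 hab, ea, by simp [hea]⟩
  have hsb : b ∈ upperBounds s := fun x hx => hx.1.2
  set c := sSup s
  have hsc : IsLUB s c := isLUB_csSup ⟨a, ha⟩ ⟨b, hsb⟩
  have hc : c ∈ Icc a b := ⟨hsc.1 ha, hsc.2 hsb⟩
  obtain ⟨-, ec, hec⟩ : c ∈ s := by
    rcases hc.1.eq_or_lt with heq | hlt
    · rwa [← heq]
    refine ⟨hc, ?_⟩
    obtain ⟨ec, hc⟩ := hq c
    obtain ⟨c', hc', hc'e⟩ : ∃ c' ∈ Ico a c, Ioc c' c ⊆ ec.baseSet :=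
      (mem_nhdsLE_iff_exists_mem_Ico_Ioc_subset hlt).1
        (mem_nhdsWithin_of_mem_nhds <| ec.open_baseSet.mem_nhds hc)
    obtain ⟨d, ⟨hdab, ead, had⟩, hd⟩ : ∃ d ∈ s, d ∈ Ioc c' c := hsc.exists_between hc'.2
    refine ⟨ead.piecewiseLe ec d (had ⟨hdab.1, le_rfl⟩) (hc'e hd), subset_ite.2 ?_⟩
    exact ⟨fun x hx => had ⟨hx.1.1, hx.2⟩, fun x hx => hc'e ⟨hd.1.trans (not_le.1 hx.2), hx.1.2⟩⟩
  -- If `c < b`, the open base set of `ec` reaches beyond `c`, against the choice of `c` as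
  -- supremum.
  rcases hc.2.eq_or_lt with heq | hlt
  · exact ⟨ec, heq ▸ hec⟩
  obtain ⟨d, hdcb, hd⟩ : ∃ d ∈ Ioc c b, Ico c d ⊆ ec.baseSet :=
    (mem_nhdsGE_iff_exists_mem_Ioc_Ico_subset hlt).1
      (mem_nhdsWithin_of_mem_nhds <| ec.open_baseSet.mem_nhds (hec ⟨hc.1, le_rfl⟩))
  obtain ⟨d', hcd', hd'd⟩ := exists_between hdcb.1
  have : d' ∈ s := ⟨⟨hc.1.trans hcd'.le, hd'd.le.trans hdcb.2⟩, ec, fun x hx => by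
    rcases le_total x c with h | h
    · exact hec ⟨hx.1, h⟩
    · exact hd ⟨h, hx.2.trans_lt hd'd⟩⟩
  exact absurd (hsc.1 this) (not_le.2 hcd')

/-- A map to a bundle over the circle, whose projection lifts to the real line, can be deformed
into the fiber over `1`, following the linear deformation of the lift. -/
theorem exists_deformation_to_fiber (hp : ∀ s, ∃ e : Bundle.Trivialization F p, s ∈ e.baseSet)
    {A : Type*} [TopologicalSpace A] [CompactSpace A] [Nonempty A] {f : A → X} {h : A → ℝ}
    (hf : Continuous f) (hh : Continuous h) (hfh : ∀ a, p (f a) = Circle.exp (h a)) :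
    ∃ G : I × A → X, Continuous G ∧ (∀ a, G (0, a) = f a) ∧
      (∀ s a, p (G (s, a)) = Circle.exp ((1 - s) * h a)) ∧ ∀ s a, h a = 0 → G (s, a) = f a := by
  have hne : Nonempty (CyclicCover p) :=
    ⟨⟨(f (Classical.arbitrary A), h (Classical.arbitrary A)), hfh _⟩⟩
  -- Compactness of `A` confines the lift to `[-R, R]`, over which one trivialization suffices; the
  -- segments from `h a` to 0 stay in that interval.
  obtain ⟨R, hR⟩ : ∃ R, ∀ a, |h a| ≤ R := by
    obtain ⟨R, hR⟩ := (isCompact_range hh).isBounded.exists_norm_le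
    exact ⟨R, fun a => hR _ (mem_range_self a)⟩
  obtain ⟨e, he⟩ := exists_trivialization_Icc (q := cyclicProj p) (F := F) (fun t => by
    obtain ⟨e, he⟩ := hp (Circle.exp t)
    exact ⟨pullbackTrivialization e, he⟩) (-R) R
  have hmem : ∀ (s : I) a, (1 - s : ℝ) * h a ∈ e.baseSet := fun s a => by
    apply he
    rw [mem_Icc, ← abs_le, abs_mul, abs_of_nonneg (by linarith [s.2.2])]
    nlinarith [hR a, s.2.1, s.2.2, abs_nonneg (h a)]
  have hmem' : ∀ a, h a ∈ e.baseSet := fun a => by simpa using hmem 0 a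
  let j : A → CyclicCover p := fun a => ⟨(f a, h a), hfh a⟩
  have hj : Continuous j := by fun_prop
  have key : ∀ s a, (1 - s : ℝ) * h a = h a →
      e.toOpenPartialHomeomorph.symm ((1 - s : ℝ) * h a, (e (j a)).2) = j a := fun s a hs => by
    rw [hs]
    exact e.symm_apply_mk_proj (x := j a) (e.mem_source.2 (hmem' a : cyclicProj p (j a) ∈ e.baseSet))
  refine ⟨fun q => (e.toOpenPartialHomeomorph.symm ((1 - q.1 : ℝ) * h q.2, (e (j q.2)).2)).1.1,
    ?_, fun a => ?_, fun s a => ?_, fun s a ha => ?_⟩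
  · have : Continuous fun q : I × A =>
        e.toOpenPartialHomeomorph.symm ((1 - q.1 : ℝ) * h q.2, (e (j q.2)).2) := by
      refine e.continuousOn_invFun.comp_continuous ?_ fun q => e.mem_target.2 (hmem _ _)
      refine Continuous.prodMk (by fun_prop) (continuous_snd.comp ?_)
      exact e.continuousOn_toFun.comp_continuous (by fun_prop) fun q => e.mem_source.2 (hmem' _)
    fun_prop
  · simp only
    rw [key _ _ (by simp)]
  · simp only
    rw [(e.toOpenPartialHomeomorph.symm ((1 - s : ℝ) * h a, (e (j a)).2)).2]
    congr 1
    exact e.proj_symm_apply' (hmem _ _)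
  · simp only
    rw [key _ _ (by simp [ha])]

/-- A loop with total angle zero is homotopic into the fiber. -/
theorem exists_homotopic_loop_in_fiber
    (hp : ∀ s, ∃ e : Bundle.Trivialization F p, s ∈ e.baseSet) {x : {y // p y = 1}}
    (γ : Path x.1 x.1) (hγ : HasAngle (fun s => p (γ s)) 0) :
    ∃ δ : Path x x, γ.Homotopic (δ.map continuous_subtype_val) := by
  obtain ⟨g, hg, hgp, hg0⟩ := hγ
  -- The lift is normalized to start at 0; angle zero makes it end at 0 too, so the deformation
  -- fixes both endpoints.
  have hsub : ∀ s, Circle.exp (g s - g 0) = p (γ s) := fun s => by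
    rw [Circle.exp_sub, hgp, hgp]; simp [x.2]
  obtain ⟨G, hG, hG0, hGp, hGf⟩ := exists_deformation_to_fiber hp (f := γ)
    (h := fun s => g s - g 0) γ.continuous (by fun_prop) fun s => (hsub s).symm
  have hs : ∀ s, G (s, 0) = x := fun s => by rw [hGf _ _ (by simp), γ.source]
  have ht : ∀ s, G (s, 1) = x := fun s => by rw [hGf _ _ hg0, γ.target]
  refine ⟨⟨⟨fun s => ⟨G (1, s), by rw [hGp]; simp⟩, by fun_prop⟩, Subtype.ext (hs 1),
    Subtype.ext (ht 1)⟩, ⟨⟨⟨⟨G, hG⟩, hG0, fun s => rfl⟩, ?_⟩⟩⟩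
  rintro t s (rfl | rfl)
  · exact (hs t).trans (γ.source).symm
  · exact (ht t).trans (γ.target).symm

/-- The fiber is `π₁`-injective. -/
theorem homotopic_in_fiber
    (hp : ∀ s, ∃ e : Bundle.Trivialization F p, s ∈ e.baseSet) (hpc : Continuous p)
    {x y : {y // p y = 1}}
    (γ δ : Path x y)
    (h : (γ.map continuous_subtype_val).Homotopic (δ.map continuous_subtype_val)) :
    γ.Homotopic δ := by
  obtain ⟨H⟩ := h
  obtain ⟨L, hL, hLp, hL0⟩ := exists_lift_square (fun q => p (H q)) (by fun_prop) 0 (by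
    rw [H.source, x.2]; simp)
  -- All four sides of the square lie over 1, so the lift `L` vanishes there and the deformation is
  -- relative to the boundary.
  have e0 : ∀ t, L (t, 0) = 0 := fun t => by
    have := lift_path_sub_eq (g := fun t => L (t, 0)) (g' := fun _ => 0) (by fun_prop)
      (by fun_prop) (fun s => by rw [hLp, H.source, x.2]; simp) t
    simpa [hL0] using this
  have e1 : ∀ t, L (0, t) = 0 := fun t => by
    have := lift_path_sub_eq (g := fun t => L (0, t)) (g' := fun _ => 0) (by fun_prop)
      (by fun_prop) (fun s => by rw [hLp]; simpa using (γ s).2) t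
    simpa [hL0] using this
  have e2 : ∀ t, L (1, t) = 0 := fun t => by
    have := lift_path_sub_eq (g := fun t => L (1, t)) (g' := fun _ => 0) (by fun_prop)
      (by fun_prop) (fun s => by rw [hLp]; simpa using (δ s).2) t
    simpa [e0] using this
  have e3 : ∀ t, L (t, 1) = 0 := fun t => by
    have := lift_path_sub_eq (g := fun t => L (t, 1)) (g' := fun _ => 0) (by fun_prop)
      (by fun_prop) (fun s => by rw [hLp, H.target, y.2]; simp) t
    simpa [e1] using this
  obtain ⟨G, hG, -, hGp, hGf⟩ := exists_deformation_to_fiber hp (f := H) (h := L)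
    (by fun_prop) hL fun s => (hLp s).symm
  refine ⟨⟨⟨⟨fun q => ⟨G (1, q), by rw [hGp]; simp⟩, by fun_prop⟩, fun s => ?_, fun s => ?_⟩, ?_⟩⟩
  · refine Subtype.ext ?_
    simp only
    rw [hGf _ _ (e1 s)]; simp
  · refine Subtype.ext ?_
    simp only
    rw [hGf _ _ (e2 s)]; simp
  · rintro t s (rfl | rfl) <;> refine Subtype.ext ?_
    · change G (1, (t, 0)) = _
      rw [hGf _ _ (e0 t)]; simp
    · change G (1, (t, 1)) = _
      rw [hGf _ _ (e3 t)]; simp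

end Bundle

/-! ### Logarithms on a punctured disk -/

/-- The radial retraction of the plane onto the closed unit disk. -/
def diskProj (z : ℂ) : ℂ := z / (max 1 ‖z‖ : ℝ)

theorem continuous_diskProj : Continuous diskProj := by
  unfold diskProj
  refine continuous_id.div (by fun_prop) fun z => ?_
  have : (0 : ℝ) < max 1 ‖z‖ := lt_of_lt_of_le one_pos (le_max_left _ _)
  exact_mod_cast this.ne'

theorem diskProj_mem (z : ℂ) : diskProj z ∈ Metric.closedBall (0 : ℂ) 1 := by
  have : (0 : ℝ) < max 1 ‖z‖ := lt_of_lt_of_le one_pos (le_max_left _ _)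
  rw [mem_closedBall_zero_iff, diskProj, norm_div, Complex.norm_real, Real.norm_of_nonneg this.le,
    div_le_one this]
  exact le_max_right _ _

theorem diskProj_of_mem {z : ℂ} (hz : z ∈ Metric.closedBall (0 : ℂ) 1) : diskProj z = z := by
  rw [mem_closedBall_zero_iff] at hz
  simp [diskProj, hz]

/-- Composition with `diskProj` gives a nowhere zero function on the simply connected plane, which
lifts through exp. -/
theorem exists_log_disk {q : ℂ → ℂ} (hq : ContinuousOn q (Metric.closedBall 0 1))
    (hne : ∀ z ∈ Metric.closedBall (0 : ℂ) 1, q z ≠ 0) :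
    ∃ h : ℂ → ℂ, Continuous h ∧ ∀ z ∈ Metric.closedBall (0 : ℂ) 1, Complex.exp (h z) = q z := by
  have hc : Continuous (q ∘ diskProj) := hq.comp_continuous continuous_diskProj diskProj_mem
  obtain ⟨h, ⟨-, hh⟩, -⟩ := Complex.isCoveringMapOn_exp.existsUnique_continuousMap_lifts
    (⟨q ∘ diskProj, hc⟩ : C(ℂ, ℂ)) (a₀ := 0) (e₀ := Complex.log (q (diskProj 0)))
    (Complex.exp_log (hne _ (diskProj_mem _))) fun z => by simpa using hne _ (diskProj_mem _)
  refine ⟨h, h.continuous, fun z hz => ?_⟩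
  have := congrFun hh z
  simpa [diskProj_of_mem hz] using this

/-- A function on the punctured disk that takes its values in a half plane near the puncture has a
logarithm. -/
theorem exists_log_punctured_disk {w a : ℂ} {q : ℂ → ℂ}
    (hq : ContinuousOn q (Metric.closedBall 0 1 \ {w}))
    (hne : ∀ z ∈ Metric.closedBall (0 : ℂ) 1 \ {w}, q z ≠ 0) (ha : a ≠ 0)
    (hre : ∀ᶠ z in 𝓝[≠] w, 0 < (q z / a).re) :
    ∃ h : ℂ → ℂ, ContinuousOn h (Metric.closedBall 0 1 \ {w}) ∧
      ∀ z ∈ Metric.closedBall (0 : ℂ) 1 \ {w}, Complex.exp (h z) = q z := by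
  obtain ⟨r, hr, hre⟩ : ∃ r > 0, ∀ z, ‖z - w‖ < 2 * r → z ≠ w → 0 < (q z / a).re := by
    obtain ⟨ε, hε, h⟩ := Metric.eventually_nhds_iff.1 (eventually_nhdsWithin_iff.1 hre)
    refine ⟨ε / 2, by positivity, fun z hz hzw => h ?_ hzw⟩
    rw [dist_eq_norm]; linarith
  -- A cutoff equal to 1 for ‖z - w‖ ≤ r/2 and to 0 for ‖z - w‖ ≥ r. The principal logarithm of `q /
  -- a` is continuous on the punctured disk of radius 2r, so the product `L` is continuous away from
  -- `w`.
  let χ : ℂ → ℝ := fun z => max 0 (min 1 (2 - 2 * ‖z - w‖ / r))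
  have hχ : Continuous χ := by fun_prop
  let L : ℂ → ℂ := fun z => χ z * Complex.log (q z / a)
  have hL : ContinuousOn L (Metric.closedBall 0 1 \ {w}) := by
    intro z hz
    by_cases h : ‖z - w‖ < 2 * r
    · refine hχ.continuousWithinAt.ofReal.mul (ContinuousWithinAt.clog ?_ ?_)
      · exact (hq z hz).div_const _
      · exact Or.inl (hre z h hz.2)
    · refine ContinuousAt.continuousWithinAt ?_
      have : L =ᶠ[𝓝 z] fun _ => 0 := by
        have hz' : ∀ᶠ y in 𝓝 z, r < ‖y - w‖ :=
          (continuous_const.continuousAt.eventually_lt (f := fun _ => r)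
            (g := fun y : ℂ => ‖y - w‖) (by fun_prop) (by linarith))
        filter_upwards [hz'] with y hy
        have : χ y = 0 := by
          refine max_eq_left ((min_le_right _ _).trans ?_)
          have : 1 < ‖y - w‖ / r := (one_lt_div hr).2 hy
          rw [mul_div_assoc]; linarith
        simp [L, this]
      exact continuousAt_const.congr this.symm
  have hLw : ∀ z, ‖z - w‖ < r / 2 → z ≠ w → Complex.exp (L z) = q z / a := fun z hz hzw => by
    have h1 : χ z = 1 := by
      have : ‖z - w‖ / r < 1 / 2 := by rw [div_lt_iff₀ hr]; linarith
      have : 1 ≤ 2 - 2 * ‖z - w‖ / r := by rw [mul_div_assoc]; linarith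
      simp [χ, this]
    have h2 : q z / a ≠ 0 := fun h0 => by
      have := hre z (by linarith) hzw
      simp [h0] at this
    simp [L, h1, Complex.exp_log h2]
  classical
  -- Division by exp L makes the function constantly `a` near `w`, which fills the puncture; a
  -- logarithm of `Q` plus `L` is a logarithm of `q`.
  let Q : ℂ → ℂ := fun z => if z = w then a else q z * Complex.exp (-L z)
  have hQw : ∀ z, ‖z - w‖ < r / 2 → Q z = a := fun z hz => by
    by_cases h : z = w
    · simp [Q, h]
    · have h2 : q z ≠ 0 := fun h0 => by
        have := hre z (by linarith) h
        simp [h0] at this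
      simp only [Q, h, if_false, Complex.exp_neg, hLw z hz h]
      field_simp
  have hQ : ContinuousOn Q (Metric.closedBall 0 1) := by
    intro z hz
    by_cases h : z = w
    · subst h
      refine ContinuousAt.continuousWithinAt (continuousAt_const.congr (f := fun _ => a) ?_)
      filter_upwards [Metric.ball_mem_nhds z (half_pos hr)] with y hy
      rw [hQw y (by simpa [dist_eq_norm] using hy)]
    · have h1 : ContinuousWithinAt (fun z => q z * Complex.exp (-L z))
          (Metric.closedBall 0 1 \ {w}) z := (hq z ⟨hz, h⟩).mul (hL z ⟨hz, h⟩).neg.cexp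
      have h2 : ContinuousWithinAt (fun z => q z * Complex.exp (-L z))
          (Metric.closedBall 0 1) z := by
        refine h1.mono_of_mem_nhdsWithin ?_
        exact Filter.inter_mem self_mem_nhdsWithin
          (mem_nhdsWithin_of_mem_nhds (isOpen_compl_singleton.mem_nhds h))
      refine h2.congr_of_eventuallyEq ?_ (by simp [Q, h])
      filter_upwards [mem_nhdsWithin_of_mem_nhds (isOpen_compl_singleton.mem_nhds h)] with y hy
      have hy : y ≠ w := hy
      simp [Q, hy]
  obtain ⟨l, hl, hlQ⟩ := exists_log_disk hQ fun z hz => by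
    by_cases h : z = w
    · simp [Q, h, ha]
    · simp [Q, h, hne z ⟨hz, h⟩]
  refine ⟨fun z => l z + L z, hl.continuousOn.add hL, fun z hz => ?_⟩
  have hzw : z ≠ w := hz.2
  rw [Complex.exp_add, hlQ z hz.1]
  simp only [Q, hzw, if_false]
  rw [mul_assoc, ← Complex.exp_add]; simp

/-- A map with a real derivative of positive determinant at a zero is close, up to a factor, to the
identity in direction. -/
theorem re_div_pos_of_hasFDerivAt {g : ℂ → ℂ} {w : ℂ} {A : ℂ →L[ℝ] ℂ} (hg : HasFDerivAt g A w)
    (h0 : g w = 0) (hA : 0 < (A 1).re * (A Complex.I).im - (A 1).im * (A Complex.I).re) :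
    ∃ a : ℂ, a ≠ 0 ∧ ∀ᶠ z in 𝓝[≠] w, 0 < (g z / (z - w) / a).re := by
  -- The complex linear and antilinear parts: A z = a z + b z̄, with determinant |a|² - |b|².
  -- Positivity means that the complex linear part dominates.
  set a : ℂ := (A 1 - Complex.I * A Complex.I) / 2 with ha
  set b : ℂ := (A 1 + Complex.I * A Complex.I) / 2 with hb
  have hAz : ∀ z : ℂ, A z = a * z + b * (starRingEnd ℂ) z := fun z => by
    have hz : z = z.re • (1 : ℂ) + z.im • Complex.I := by
      simp [Complex.re_add_im]
    have h1 : A z = z.re • A 1 + z.im • A Complex.I := by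
      conv_lhs => rw [hz]
      rw [map_add, map_smul, map_smul]
    rw [h1, ha, hb]
    apply Complex.ext <;> simp <;> ring
  have hab : ‖b‖ < ‖a‖ := by
    have : Complex.normSq b < Complex.normSq a := by
      simp only [Complex.normSq_apply, ha, hb, Complex.div_ofNat_re, Complex.div_ofNat_im,
        Complex.add_re, Complex.add_im, Complex.sub_re, Complex.sub_im, Complex.mul_re,
        Complex.mul_im, Complex.I_re, Complex.I_im]
      nlinarith
    rw [Complex.normSq_eq_norm_sq, Complex.normSq_eq_norm_sq] at this
    exact lt_of_pow_lt_pow_left₀ 2 (norm_nonneg _) this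
  have ha0 : 0 < ‖a‖ := (norm_nonneg b).trans_lt hab
  refine ⟨a, norm_pos_iff.1 ha0, ?_⟩
  -- This error together with the antilinear part stays below ‖a‖‖z - w‖, so g(z)/(a(z - w)) lies in
  -- the open unit disk around 1.
  have hlo := (hasFDerivAt_iff_isLittleO.1 hg).bound (c := (‖a‖ - ‖b‖) / 2) (by linarith)
  filter_upwards [mem_nhdsWithin_of_mem_nhds hlo, self_mem_nhdsWithin] with z hz hzw
  have hzw : z - w ≠ 0 := sub_ne_zero.2 hzw
  have hzw' : 0 < ‖z - w‖ := norm_pos_iff.2 hzw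
  have hz : ‖g z - g w - A (z - w)‖ ≤ (‖a‖ - ‖b‖) / 2 * ‖z - w‖ := hz
  rw [h0, sub_zero] at hz
  have h1 : ‖g z - a * (z - w)‖ < ‖a‖ * ‖z - w‖ := by
    have : g z - a * (z - w) = (g z - A (z - w)) + b * (starRingEnd ℂ) (z - w) := by
      rw [hAz]; ring
    rw [this]
    refine (norm_add_le _ _).trans_lt ?_
    rw [norm_mul, RCLike.norm_conj]
    nlinarith
  have h2 : ‖g z / (z - w) / a - 1‖ < 1 := by
    have : g z / (z - w) / a - 1 = (g z - a * (z - w)) / (a * (z - w)) := by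
      have := norm_pos_iff.1 ha0
      field_simp
    rw [this, norm_div, norm_mul, div_lt_one (by positivity)]
    exact h1
  have h3 := (abs_lt.1 ((Complex.abs_re_le_norm _).trans_lt h2)).1
  simp at h3
  linarith

/-! ### Blaschke factors -/

/-- The automorphism of the disk that sends `w` to `0`. -/
def blaschke (w z : ℂ) : ℂ := (z - w) / (1 - (starRingEnd ℂ) w * z)

theorem one_sub_conj_mul_re_pos {w z : ℂ} (hw : ‖w‖ < 1) (hz : ‖z‖ ≤ 1) :
    0 < (1 - (starRingEnd ℂ) w * z).re := by
  have : ‖(starRingEnd ℂ) w * z‖ < 1 := by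
    rw [norm_mul, RCLike.norm_conj]
    nlinarith [norm_nonneg w, norm_nonneg z]
  have := (abs_lt.1 ((Complex.abs_re_le_norm _).trans_lt this)).2
  rw [Complex.sub_re, Complex.one_re]
  linarith

theorem one_sub_conj_mul_ne_zero {w z : ℂ} (hw : ‖w‖ < 1) (hz : ‖z‖ ≤ 1) :
    1 - (starRingEnd ℂ) w * z ≠ 0 := fun h => by
  have := one_sub_conj_mul_re_pos hw hz
  simp [h] at this

/-- Compares the denominator and the numerator of the Blaschke factor, which yields both that it
maps the disk to itself and which points go to the circle. -/
theorem norm_sq_one_sub_conj_mul (w z : ℂ) :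
    ‖1 - (starRingEnd ℂ) w * z‖ ^ 2 - ‖z - w‖ ^ 2 = (1 - ‖z‖ ^ 2) * (1 - ‖w‖ ^ 2) := by
  simp only [← Complex.normSq_eq_norm_sq, Complex.normSq_apply, Complex.sub_re, Complex.sub_im,
    Complex.mul_re, Complex.mul_im, Complex.one_re, Complex.one_im, Complex.conj_re,
    Complex.conj_im]
  ring

theorem norm_blaschke_le {w z : ℂ} (hw : ‖w‖ < 1) (hz : ‖z‖ ≤ 1) : ‖blaschke w z‖ ≤ 1 := by
  have h0 := norm_pos_iff.2 (one_sub_conj_mul_ne_zero hw hz)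
  rw [blaschke, norm_div, div_le_one h0]
  refine (sq_le_sq₀ (norm_nonneg _) h0.le).1 ?_
  have h1 := norm_sq_one_sub_conj_mul w z
  have h2 : 0 ≤ (1 - ‖z‖ ^ 2) * (1 - ‖w‖ ^ 2) :=
    mul_nonneg (by nlinarith [norm_nonneg z]) (by nlinarith [norm_nonneg w])
  linarith

theorem norm_blaschke_eq_one_iff {w z : ℂ} (hw : ‖w‖ < 1) (hz : ‖z‖ ≤ 1) :
    ‖blaschke w z‖ = 1 ↔ ‖z‖ = 1 := by
  have h0 := norm_pos_iff.2 (one_sub_conj_mul_ne_zero hw hz)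
  have h1 := norm_sq_one_sub_conj_mul w z
  have h3 : 1 - ‖w‖ ^ 2 ≠ 0 := by nlinarith [norm_nonneg w]
  rw [blaschke, norm_div, div_eq_one_iff_eq h0.ne', ← sq_eq_sq₀ (norm_nonneg _) h0.le]
  constructor
  · intro h
    have : (1 - ‖z‖ ^ 2) * (1 - ‖w‖ ^ 2) = 0 := by rw [← h1, h]; ring
    have := (mul_eq_zero.1 this).resolve_right h3
    rw [← sq_eq_sq₀ (norm_nonneg _) zero_le_one]; linarith
  · intro h
    rw [h] at h1; linarith

theorem blaschke_eq_zero_iff {w z : ℂ} (hw : ‖w‖ < 1) (hz : ‖z‖ ≤ 1) :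
    blaschke w z = 0 ↔ z = w := by
  rw [blaschke, div_eq_zero_iff, or_iff_left (one_sub_conj_mul_ne_zero hw hz), sub_eq_zero]

/-! ### Deforming proper self-maps of the disk -/

/-- The proper maps of the disk to itself that have exactly one zero and map `1` to `u`. -/
def diskSelfMaps (u : ℂ) : Set C(D2, ℂ) :=
  {g | (∀ z, ‖g z‖ ≤ 1) ∧ (∀ z, ‖g z‖ = 1 ↔ ‖(z : ℂ)‖ = 1) ∧ (∃! z, g z = 0) ∧
    g (circlePt 0) = u}

theorem joinedIn_of_homotopy {A B : Type*} [TopologicalSpace A] [TopologicalSpace B]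
    {S : Set C(A, B)} {f g : C(A, B)} (H : I × A → B) (hH : Continuous H)
    (h0 : ∀ a, H (0, a) = f a) (h1 : ∀ a, H (1, a) = g a)
    (hS : ∀ t, (⟨fun a => H (t, a), by fun_prop⟩ : C(A, B)) ∈ S) : JoinedIn S f g :=
  ⟨⟨ContinuousMap.curry ⟨H, hH⟩, ContinuousMap.ext h0, ContinuousMap.ext h1⟩, hS⟩

theorem coe_circlePt_zero : (circlePt 0 : ℂ) = 1 := by simp [circlePt]

theorem norm_le_one (z : D2) : ‖(z : ℂ)‖ ≤ 1 := mem_closedBall_zero_iff.1 z.2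

/-- The rotation of the disk that maps `1` to `u`. -/
def diskRotation (u : ℂ) : C(D2, ℂ) := ⟨fun z => u * z, by fun_prop⟩

/-- The half plane condition at the zero gives g/(z - w) a logarithm away from `w`, so g is the
Blaschke factor of `w` times exp h. The first homotopy deforms h linearly to its value at 1, the
second moves the zero from `w` to 0. -/
theorem joinedIn_diskRotation {u : ℂ} (g : C(D2, ℂ)) (hg : g ∈ diskSelfMaps u) {w a : ℂ}
    (hw : ‖w‖ < 1) (hgw : ∀ z, g z = 0 ↔ (z : ℂ) = w) (ha : a ≠ 0)
    (hre : ∀ᶠ z in 𝓝[≠] w, 0 < (g ⟨diskProj z, diskProj_mem z⟩ / (z - w) / a).re) :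
    JoinedIn (diskSelfMaps u) g (diskRotation u) := by
  obtain ⟨hg1, hg2, -, hgu⟩ := hg
  have hu : ‖u‖ = 1 := by rw [← hgu, hg2, norm_circlePt]
  have hwD : w ∈ Metric.closedBall (0 : ℂ) 1 := mem_closedBall_zero_iff.2 hw.le
  let q : ℂ → ℂ := fun z => g ⟨diskProj z, diskProj_mem z⟩ / (z - w)
  obtain ⟨h₀, hh₀, hq₀⟩ := exists_log_punctured_disk (q := q) (w := w) (a := a) (by
      refine ContinuousOn.div ?_ (by fun_prop) fun z hz => sub_ne_zero.2 hz.2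
      exact (g.continuous.comp (continuous_diskProj.subtype_mk _)).continuousOn) (fun z hz => by
      refine div_ne_zero ?_ (sub_ne_zero.2 hz.2)
      rw [Ne, hgw]
      simp only [diskProj_of_mem hz.1]
      exact hz.2) ha hre
  let h : D2 → ℂ := fun z => h₀ z + Complex.log (1 - (starRingEnd ℂ) w * z)
  have hgh : ∀ z : D2, g z = blaschke w z * Complex.exp (h z) := fun z => by
    by_cases hz : (z : ℂ) = w
    · rw [(hgw z).2 hz, (blaschke_eq_zero_iff hw (norm_le_one z)).2 hz, zero_mul]
    · have h1 := one_sub_conj_mul_ne_zero hw (norm_le_one z)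
      have h2 := sub_ne_zero.2 hz
      simp only [h, Complex.exp_add, Complex.exp_log h1, hq₀ z ⟨z.2, hz⟩, q, blaschke,
        diskProj_of_mem z.2]
      generalize 1 - (starRingEnd ℂ) w * (z : ℂ) = d at h1 ⊢
      field_simp
  have hhc : ContinuousOn h {z | (z : ℂ) ≠ w} := by
    refine ContinuousOn.add (hh₀.comp (by fun_prop) fun z hz => ⟨z.2, hz⟩) ?_
    refine ContinuousOn.clog (by fun_prop) fun z _ => ?_
    exact Or.inl (one_sub_conj_mul_re_pos hw (norm_le_one z))
  have hre1 : ∀ z : D2, ‖(z : ℂ)‖ = 1 → (h z).re = 0 := fun z hz => by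
    have := (hg2 z).2 hz
    rw [hgh, norm_mul, (norm_blaschke_eq_one_iff hw (norm_le_one z)).2 hz, one_mul,
      Complex.norm_exp, Real.exp_eq_one_iff] at this
    exact this
  have hBc (w' : I → ℂ) (hw' : ∀ t, ‖w' t‖ < 1) (hwc : Continuous w') :
      Continuous fun y : I × D2 => blaschke (w' y.1) y.2 := by
    unfold blaschke
    refine Continuous.div (by fun_prop) ?_ fun y =>
      one_sub_conj_mul_ne_zero (hw' y.1) (norm_le_one y.2)
    have := Complex.continuous_conj
    fun_prop
  have hB : Continuous fun z : D2 => blaschke w z :=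
    (hBc (fun _ => w) (fun _ => hw) continuous_const).comp (Continuous.prodMk_right 0)
  have hBu : blaschke w (circlePt 0) * Complex.exp (h (circlePt 0)) = u := by rw [← hgh, hgu]
  let H₁ : I × D2 → ℂ := fun y =>
    blaschke w y.2 * Complex.exp ((1 - y.1 : ℝ) * h y.2 + (y.1 : ℝ) * h (circlePt 0))
  have hH₁n : ∀ y, ‖H₁ y‖ = ‖blaschke w y.2‖ * Real.exp ((1 - y.1 : ℝ) * (h y.2).re) := fun y => by
    simp only [H₁, norm_mul, Complex.norm_exp, Complex.add_re, Complex.re_ofReal_mul,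
      hre1 _ (norm_circlePt 0), mul_zero, add_zero]
  -- Re h vanishes at 1, so the modulus is |B| exp((1 - t) Re h), between |B| and |g|. This bound
  -- gives continuity at the zero, where h need not be continuous, and keeps interior points off the
  -- circle.
  have hH₁le : ∀ y, ‖H₁ y‖ ≤ max ‖blaschke w y.2‖ ‖g y.2‖ := fun y => by
    rw [hH₁n, hgh, norm_mul, Complex.norm_exp]
    rcases le_total (h y.2).re 0 with h0 | h0
    · refine le_max_of_le_left (mul_le_of_le_one_right (norm_nonneg _) ?_)
      rw [Real.exp_le_one_iff]
      exact mul_nonpos_of_nonneg_of_nonpos (by linarith [y.1.2.2]) h0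
    · refine le_max_of_le_right (mul_le_mul_of_nonneg_left ?_ (norm_nonneg _))
      rw [Real.exp_le_exp]
      nlinarith [y.1.2.1]
  have hH₁c : Continuous H₁ := by
    rw [continuous_iff_continuousAt]
    rintro ⟨t, z⟩
    by_cases hz : (z : ℂ) = w
    · have hz0 : H₁ (t, z) = 0 := by
        simp [H₁, (blaschke_eq_zero_iff hw (norm_le_one z)).2 hz]
      rw [ContinuousAt, hz0]
      refine squeeze_zero_norm hH₁le ?_
      have hc : Continuous fun y : I × D2 => max ‖blaschke w y.2‖ ‖g y.2‖ :=
        (hB.comp continuous_snd).norm.max (by fun_prop)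
      have := hc.tendsto (t, z)
      simpa [(blaschke_eq_zero_iff hw (norm_le_one z)).2 hz, (hgw z).2 hz] using this
    · have ho : IsOpen {z : D2 | (z : ℂ) ≠ w} :=
        isOpen_compl_singleton.preimage continuous_subtype_val
      have hza : ContinuousAt h z := hhc.continuousAt (ho.mem_nhds hz)
      have hza' : ContinuousAt (fun y : I × D2 => h y.2) (t, z) :=
        ContinuousAt.comp (g := h) (f := Prod.snd) hza continuousAt_snd
      refine ((hB.comp continuous_snd).continuousAt).mul (ContinuousAt.cexp ?_)
      refine (ContinuousAt.mul ?_ hza').add ?_ <;> fun_prop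
  have hH₁S : ∀ t, (⟨fun z => H₁ (t, z), by fun_prop⟩ : C(D2, ℂ)) ∈ diskSelfMaps u := fun t => by
    have hlt : ∀ z : D2, ‖(z : ℂ)‖ ≠ 1 → ‖H₁ (t, z)‖ < 1 := fun z hz => by
      refine (hH₁le _).trans_lt (max_lt ?_ ?_)
      · exact lt_of_le_of_ne (norm_blaschke_le hw (norm_le_one z))
          fun h => hz ((norm_blaschke_eq_one_iff hw (norm_le_one z)).1 h)
      · exact lt_of_le_of_ne (hg1 z) fun h => hz ((hg2 z).1 h)
    have heq : ∀ z : D2, ‖(z : ℂ)‖ = 1 → ‖H₁ (t, z)‖ = 1 := fun z hz => by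
      rw [hH₁n, hre1 z hz, (norm_blaschke_eq_one_iff hw (norm_le_one z)).2 hz]; simp
    refine ⟨fun z => ?_, fun z => ⟨fun h => ?_, heq z⟩, ⟨⟨w, hwD⟩, ?_, fun z hz => ?_⟩, ?_⟩
    · by_cases hz : ‖(z : ℂ)‖ = 1
      · exact (heq z hz).le
      · exact (hlt z hz).le
    · by_contra hz
      exact (hlt z hz).ne h
    · have : blaschke w w = 0 := (blaschke_eq_zero_iff hw hw.le).2 rfl
      simp [H₁, this]
    · refine Subtype.ext ?_
      have hz : H₁ (t, z) = 0 := hz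
      simp only [H₁, mul_eq_zero, Complex.exp_ne_zero, or_false] at hz
      exact (blaschke_eq_zero_iff hw (norm_le_one z)).1 hz
    · simp only [ContinuousMap.coe_mk, H₁]
      rw [← hBu, ← add_mul]; simp
  let g₁ : C(D2, ℂ) := ⟨fun z => H₁ (1, z), by fun_prop⟩
  have J₁ : JoinedIn (diskSelfMaps u) g g₁ :=
    joinedIn_of_homotopy H₁ hH₁c (fun z => by rw [hgh]; simp [H₁]) (fun z => rfl) hH₁S
  let v : I → ℂ := fun t => (1 - t : ℝ) * w
  have hv : ∀ t, ‖v t‖ < 1 := fun t => by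
    simp only [v, norm_mul, Complex.norm_real]
    rw [Real.norm_of_nonneg (by linarith [t.2.2])]
    nlinarith [t.2.1, norm_nonneg w]
  have hvB : ∀ t, ‖blaschke (v t) (circlePt 0)‖ = 1 := fun t =>
    (norm_blaschke_eq_one_iff (hv t) (norm_le_one _)).2 (norm_circlePt 0)
  have hvB0 : ∀ t, blaschke (v t) (circlePt 0) ≠ 0 := fun t h => by
    have := hvB t
    simp [h] at this
  -- The unimodular factor in front holds the value at 1 equal to `u` while the zero `v t` moves to
  -- 0.
  let H₂ : I × D2 → ℂ := fun y => u / blaschke (v y.1) (circlePt 0) * blaschke (v y.1) y.2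
  have hBv := hBc v hv (by fun_prop)
  have hH₂c : Continuous H₂ := by
    refine Continuous.mul (continuous_const.div ?_ fun y => hvB0 _) hBv
    exact hBv.comp (continuous_fst.prodMk continuous_const)
  have hH₂n : ∀ t z, ‖H₂ (t, z)‖ = ‖blaschke (v t) z‖ := fun t z => by
    simp [H₂, hvB, hu]
  have J₂ : JoinedIn (diskSelfMaps u) g₁ (diskRotation u) := by
    refine joinedIn_of_homotopy H₂ hH₂c (fun z => ?_) (fun z => ?_) fun t => ⟨?_, ?_, ?_, ?_⟩
    · have := hvB0 0
      simp only [g₁, H₁, ContinuousMap.coe_mk, ← hBu, H₂] at this ⊢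
      simp only [v, Icc.coe_zero, sub_zero, Complex.ofReal_one, one_mul] at this ⊢
      field_simp
      simp [mul_comm]
    · simp [H₂, v, blaschke, diskRotation, coe_circlePt_zero]
    · exact fun z => by
        rw [ContinuousMap.coe_mk, hH₂n]; exact norm_blaschke_le (hv t) (norm_le_one z)
    · exact fun z => by
        rw [ContinuousMap.coe_mk, hH₂n]; exact norm_blaschke_eq_one_iff (hv t) (norm_le_one z)
    · have hu0 : u ≠ 0 := fun h => by simp [h] at hu
      have : ∀ z, H₂ (t, z) = 0 ↔ (z : ℂ) = v t := fun z => by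
        simp only [H₂, mul_eq_zero, div_eq_zero_iff, hu0, hvB0, or_self, false_or]
        exact blaschke_eq_zero_iff (hv t) (norm_le_one z)
      refine ⟨⟨v t, mem_closedBall_zero_iff.2 (hv t).le⟩, (this _).2 rfl, fun z hz => ?_⟩
      exact Subtype.ext ((this z).1 hz)
    · have := hvB0 t
      simp only [ContinuousMap.coe_mk, H₂]
      field_simp
  exact J₁.trans J₂

/-! ### Intersection numbers in tubular coordinates -/

section Det

variable {n : ℕ} {E : Type*} [AddCommGroup E]

/-- The rows of the determinant that defines the intersection number. -/
def normalFrame (y : E) (d : Fin n → E) (a b : E) : Fin (n + 2 + 1) → E :=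
  Fin.cons y (Fin.append d ![a, b])

/-- Exhibits the dependence on `a` as a change of one row, so that multilinearity of a determinant
applies. -/
theorem normalFrame_eq_update_left (y : E) (d : Fin n → E) (a b : E) :
    normalFrame y d a b =
      Function.update (normalFrame y d 0 b) (Fin.succ (Fin.natAdd n 0)) a := by
  funext i
  refine Fin.cases ?_ (fun i => ?_) i
  · rw [Function.update_of_ne (Fin.succ_ne_zero _).symm]; rfl
  · refine Fin.addCases (fun i => ?_) (fun i => ?_) i
    · rw [Function.update_of_ne]
      · simp [normalFrame]
      · intro h
        have := congrArg Fin.val (Fin.succ_injective _ h)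
        simp at this
        omega
    · fin_cases i
      · simp [normalFrame]
      · rw [Function.update_of_ne]
        · simp [normalFrame]
        · intro h
          have := congrArg Fin.val (Fin.succ_injective _ h)
          simp at this

theorem normalFrame_eq_update_right (y : E) (d : Fin n → E) (a b : E) :
    normalFrame y d a b =
      Function.update (normalFrame y d a 0) (Fin.succ (Fin.natAdd n 1)) b := by
  funext i
  refine Fin.cases ?_ (fun i => ?_) i
  · rw [Function.update_of_ne (Fin.succ_ne_zero _).symm]; rfl
  · refine Fin.addCases (fun i => ?_) (fun i => ?_) i
    · rw [Function.update_of_ne]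
      · simp [normalFrame]
      · intro h
        have := congrArg Fin.val (Fin.succ_injective _ h)
        simp at this
        omega
    · fin_cases i
      · rw [Function.update_of_ne]
        · simp [normalFrame]
        · intro h
          have := congrArg Fin.val (Fin.succ_injective _ h)
          simp at this
      · simp [normalFrame]

variable [Module ℝ E]

/-- The value of an alternating map on a normal frame, as a bilinear map in the last vectors. -/
def normalForm (Φ : E [⋀^Fin (n + 2 + 1)]→ₗ[ℝ] ℝ) (y : E) (d : Fin n → E) : E →ₗ[ℝ] E →ₗ[ℝ] ℝ :=
  LinearMap.mk₂ ℝ (fun a b => Φ (normalFrame y d a b))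
    (fun a a' b => by
      rw [normalFrame_eq_update_left, normalFrame_eq_update_left y d a,
        normalFrame_eq_update_left y d a', Φ.map_update_add])
    (fun c a b => by
      rw [normalFrame_eq_update_left, normalFrame_eq_update_left y d a, Φ.map_update_smul])
    (fun a b b' => by
      rw [normalFrame_eq_update_right, normalFrame_eq_update_right y d a b,
        normalFrame_eq_update_right y d a b', Φ.map_update_add])
    (fun c a b => by
      rw [normalFrame_eq_update_right, normalFrame_eq_update_right y d a b, Φ.map_update_smul])

variable (Φ : E [⋀^Fin (n + 2 + 1)]→ₗ[ℝ] ℝ) (y : E) (d : Fin n → E)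

theorem normalForm_apply (a b : E) : normalForm Φ y d a b = Φ (normalFrame y d a b) := rfl

theorem normalForm_self (a : E) : normalForm Φ y d a a = 0 := by
  rw [normalForm_apply]
  refine Φ.map_eq_zero_of_eq _ (i := Fin.succ (Fin.natAdd n 0)) (j := Fin.succ (Fin.natAdd n 1))
    (by simp [normalFrame]) fun h => ?_
  have := congrArg Fin.val (Fin.succ_injective _ h)
  simp at this

theorem normalForm_swap (a b : E) : normalForm Φ y d b a = -normalForm Φ y d a b := by
  have := normalForm_self Φ y d (a + b)
  simp only [map_add, LinearMap.add_apply, normalForm_self] at this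
  linarith

theorem normalForm_of_mem_span {a : E} (ha : a ∈ Submodule.span ℝ (range d)) (b : E) :
    normalForm Φ y d a b = 0 := by
  have : Submodule.span ℝ (range d) ≤ LinearMap.ker ((normalForm Φ y d).flip b) := by
    rw [Submodule.span_le]
    rintro _ ⟨k, rfl⟩
    change Φ (normalFrame y d (d k) b) = 0
    refine Φ.map_eq_zero_of_eq _ (i := Fin.succ (Fin.castAdd 2 k)) (j := Fin.succ (Fin.natAdd n 0))
      (by simp [normalFrame]) fun h => ?_
    have := congrArg Fin.val (Fin.succ_injective _ h)
    simp at this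
    omega
  exact this ha

/-- Vectors tangent to K drop out of the form, and an alternating form on the plane of `s` and `t`
scales by the 2 × 2 determinant. The sign of an intersection number is therefore the sign of the
determinant of normal coordinates. -/
theorem normalForm_change_of_frame {v₁ v₂ : E} (h₁ : v₁ ∈ Submodule.span ℝ (range d))
    (h₂ : v₂ ∈ Submodule.span ℝ (range d)) (s t : E) (p q r u : ℝ) :
    normalForm Φ y d (v₁ + (p • s + q • t)) (v₂ + (r • s + u • t)) =
      (p * u - q * r) * normalForm Φ y d s t := by
  have h₂' : ∀ a, normalForm Φ y d a v₂ = 0 := fun a => by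
    rw [normalForm_swap, normalForm_of_mem_span Φ y d h₂, neg_zero]
  simp only [map_add, map_smul, LinearMap.add_apply, LinearMap.smul_apply, normalForm_self,
    normalForm_of_mem_span Φ y d h₁, h₂', normalForm_swap Φ y d s t, smul_eq_mul]
  ring

end Det

section Coordinates

variable {n : ℕ} {M : Type*} [TopologicalSpace M] [ChartedSpace (EuclideanSpace ℝ (Fin n)) M]
  [IsManifold (𝓡 n) ∞ M] {K : NKnot n M}

/-- The determinant of a family of vectors of the ambient space. -/
def ambDet (n : ℕ) : Amb n [⋀^Fin (n + 2 + 1)]→ₗ[ℝ] ℝ :=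
  Matrix.detRowAlternating.compLinearMap (WithLp.linearEquiv 2 ℝ (Fin (n + 2 + 1) → ℝ)).toLinearMap

/-- The derivative of the knot, as a map to the ambient space. -/
def NKnot.ambDeriv (K : NKnot n M) (x : M) : EuclideanSpace ℝ (Fin n) →L[ℝ] Amb n :=
  mfderiv (𝓡 n) 𝓘(ℝ, Amb n) (fun y => (K.emb y : Amb n)) x

theorem NKnot.isPositiveNormalPair_iff {x : M} {a b : Amb n} : K.IsPositiveNormalPair x a b ↔
    ∀ e : Module.Basis (Fin n) ℝ (EuclideanSpace ℝ (Fin n)), e.orientation = K.orient x →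
      0 < normalForm (ambDet n) (K.emb x : Amb n) (fun i => K.ambDeriv x (e i)) a b :=
  Iff.rfl

/-- In positive dimension both orientations come from bases; in dimension zero only one does. With
such a basis, the positivity conditions quantified over bases give actual inequalities. -/
theorem NKnot.exists_positive_basis (hn : 1 ≤ n) (K : NKnot n M) (x : M) :
    ∃ e : Module.Basis (Fin n) ℝ (EuclideanSpace ℝ (Fin n)), e.orientation = K.orient x := by
  have : Nonempty (Fin n) := ⟨⟨0, hn⟩⟩
  exact ⟨(K.orient x).someBasis (by simp), (K.orient x).someBasis_orientation _⟩

theorem Tube.mdifferentiable_coe (T : Tube K) :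
    MDifferentiable ((𝓡 n).prod 𝓘(ℝ, ℂ)) 𝓘(ℝ, Amb n) fun q => (T.toFun q : Amb n) :=
  have : Fact (Module.finrank ℝ (Amb n) = n + 2 + 1) := ⟨finrank_euclideanSpace_fin⟩
  ((contMDiff_coe_sphere (m := ∞)).comp T.localDiffeo.contMDiff).mdifferentiable (by simp)

/-- The derivative of the tube at a point of the zero section, as a map to the ambient space. -/
def Tube.ambDeriv (T : Tube K) (x : M) : EuclideanSpace ℝ (Fin n) × ℂ →L[ℝ] Amb n :=
  mfderiv ((𝓡 n).prod 𝓘(ℝ, ℂ)) 𝓘(ℝ, Amb n) (fun q => (T.toFun q : Amb n)) (x, (0 : ℂ))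

/-- The sum of the two partial derivatives; the one along M is that of the knot because the tube
restricts to it on the zero section. -/
theorem Tube.mfderiv_coe_apply (T : Tube K) (x : M) (v : EuclideanSpace ℝ (Fin n)) (ζ : ℂ) :
    T.ambDeriv x (v, ζ) = K.ambDeriv x v +
        (ζ.re • fderiv ℝ (fun z : ℂ => (T.toFun (x, z) : Amb n)) 0 1 +
          ζ.im • fderiv ℝ (fun z : ℂ => (T.toFun (x, z) : Amb n)) 0 Complex.I) := by
  have h := mfderiv_prod_eq_add_apply (v := ((v, ζ) : EuclideanSpace ℝ (Fin n) × ℂ))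
    (T.mdifferentiable_coe (x, (0 : ℂ)))
  refine Eq.trans h ?_
  have h1 : (fun z : M => (T.toFun (z, (0 : ℂ)) : Amb n)) = fun y => (K.emb y : Amb n) := by
    funext z; rw [T.zero_section]
  have h2 : (fderiv ℝ (fun z : ℂ => (T.toFun (x, z) : Amb n)) 0) ζ =
      ζ.re • fderiv ℝ (fun z : ℂ => (T.toFun (x, z) : Amb n)) 0 1 +
          ζ.im • fderiv ℝ (fun z : ℂ => (T.toFun (x, z) : Amb n)) 0 Complex.I := by
    conv_lhs => rw [show ζ = ζ.re • (1 : ℂ) + ζ.im • Complex.I by simp [Complex.re_add_im]]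
    rw [map_add, map_smul, map_smul]
  rw [← h2, ← mfderiv_eq_fderiv, NKnot.ambDeriv, ← h1]
  rfl

/-- Near its intersection point with `K`, the normal coordinate of a meridional disk is an
orientation preserving local diffeomorphism. -/
theorem MeridionalDisk.exists_coords (hn : 1 ≤ n) {T : Tube K} (D : MeridionalDisk T) :
    ∃ (x : M) (w : ℂ) (c : ℂ → M × ℂ) (A : ℂ →L[ℝ] ℂ), ‖w‖ < 1 ∧
      (∀ z ∈ Metric.closedBall (0 : ℂ) 1, D.toFun z ∈ K.carrier ↔ z = w) ∧
      (∀ᶠ z in 𝓝 w, T.toFun (c z) = D.toFun z) ∧ c w = (x, 0) ∧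
      HasFDerivAt (fun z => (c z).2) A w ∧
      0 < (A 1).re * (A Complex.I).im - (A 1).im * (A Complex.I).re := by
  obtain ⟨x, w, hw, hwx, huniq, hpos⟩ := D.meets
  have hwK : D.toFun w ∈ K.carrier := ⟨x, hwx.symm⟩
  have hw1 : ‖w‖ < 1 := lt_of_le_of_ne (mem_closedBall_zero_iff.1 hw) fun h =>
    T.bdry_disjoint ((D.mem_bdry w hw).2 h) hwK
  have hnhds : Metric.closedBall (0 : ℂ) 1 ∈ 𝓝 w :=
    Filter.mem_of_superset (Metric.isOpen_ball.mem_nhds (mem_ball_zero_iff.2 hw1))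
      Metric.ball_subset_closedBall
  have hDw : MDifferentiableAt 𝓘(ℝ, ℂ) (𝓡 (n + 2)) D.toFun w :=
    (D.smooth.contMDiffAt hnhds).mdifferentiableAt (by simp)
  have hT := T.localDiffeo (x, 0)
  have hTx : T.toFun (x, 0) = D.toFun w := by rw [T.zero_section, hwx]
  have hinv : MDifferentiableAt (𝓡 (n + 2)) ((𝓡 n).prod 𝓘(ℝ, ℂ)) hT.localInverse (D.toFun w) := by
    rw [← hTx]; exact hT.localInverse_mdifferentiableAt (by simp)
  -- The disk in tubular coordinates near its intersection with K.
  let c : ℂ → M × ℂ := fun z => hT.localInverse (D.toFun z)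
  have hc : MDifferentiableAt 𝓘(ℝ, ℂ) ((𝓡 n).prod 𝓘(ℝ, ℂ)) c w := hinv.comp w hDw
  have hcw : c w = (x, 0) := by
    change hT.localInverse (D.toFun w) = _
    rw [← hTx]
    exact hT.localInverse_left_inv hT.localInverse_mem_target
  have hTc : ∀ᶠ z in 𝓝 w, T.toFun (c z) = D.toFun z := by
    have : ∀ᶠ y in 𝓝 (D.toFun w), T.toFun (hT.localInverse y) = y := by
      rw [← hTx]; exact hT.localInverse_eventuallyEq_right
    exact hDw.continuousAt.eventually this
  let L : ℂ →L[ℝ] (EuclideanSpace ℝ (Fin n) × ℂ) := mfderiv 𝓘(ℝ, ℂ) ((𝓡 n).prod 𝓘(ℝ, ℂ)) c w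
  have hsnd : HasFDerivAt (fun z => (c z).2) ((ContinuousLinearMap.snd ℝ _ ℂ).comp L) w := by
    have h1 : HasMFDerivAt 𝓘(ℝ, ℂ) 𝓘(ℝ, ℂ) (fun z => (c z).2) w
        ((ContinuousLinearMap.snd ℝ _ ℂ).comp L) := (hasMFDerivAt_snd (c w)).comp w hc.hasMFDerivAt
    exact h1.hasFDerivAt
  refine ⟨x, w, c, _, hw1, fun z hz => ⟨huniq z hz, fun h => h ▸ hwK⟩, hTc, hcw, hsnd, ?_⟩
  have hder : ∀ ζ : ℂ, fderiv ℝ (fun z : ℂ => (D.toFun z : Amb n)) w ζ =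
      K.ambDeriv x (L ζ).1 +
        ((L ζ).2.re • fderiv ℝ (fun z : ℂ => (T.toFun (x, z) : Amb n)) 0 1 +
          (L ζ).2.im • fderiv ℝ (fun z : ℂ => (T.toFun (x, z) : Amb n)) 0 Complex.I) := fun ζ => by
    rw [← T.mfderiv_coe_apply]
    have h1 : (fun z : ℂ => (D.toFun z : Amb n)) =ᶠ[𝓝 w]
        (fun q => (T.toFun q : Amb n)) ∘ c := by
      filter_upwards [hTc] with z hz
      simp [hz]
    rw [h1.fderiv_eq, ← mfderiv_eq_fderiv, mfderiv_comp w (T.mdifferentiable_coe _) hc, hcw]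
    rfl
  obtain ⟨e, he⟩ := K.exists_positive_basis hn x
  have hT0 := NKnot.isPositiveNormalPair_iff.1 (T.oriented x) e he
  have hD0 := NKnot.isPositiveNormalPair_iff.1 hpos e he
  have hspan : ∀ v, K.ambDeriv x v ∈ Submodule.span ℝ (range fun i => K.ambDeriv x (e i)) :=
      fun v => by
    rw [← e.sum_repr v, map_sum]
    refine Submodule.sum_mem _ fun i _ => ?_
    rw [map_smul]
    exact Submodule.smul_mem _ _ (Submodule.subset_span ⟨i, rfl⟩)
  -- The form on the disk is the wanted determinant times the form on the fiber of the tube, and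
  -- both forms are positive.
  rw [hder, hder, normalForm_change_of_frame _ _ _ (hspan _) (hspan _)] at hD0
  exact pos_of_mul_pos_left hD0 hT0.le

end Coordinates

/-! ### Quandles of cosets -/

section Algebra

variable {G : Type*} [Group G]

/-- Right translation by a coset is inverted by the same formula with φ⁻¹, which also fixes `H`; the
other axioms are identities in the group. -/
theorem isQuandle_quotientAlexanderOp (φ : G ≃* G) (H : Subgroup G) (hφ : ∀ h ∈ H, φ h = h) :
    IsQuandle (quotientAlexanderOp φ H hφ) where
  nonempty := ⟨Quotient.mk _ 1⟩
  idem := by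
    rintro ⟨x⟩
    change Quotient.mk _ (φ (x * x⁻¹) * x) = Quotient.mk _ x
    simp
  bijective := by
    rintro ⟨y⟩
    have hφ' : ∀ h ∈ H, φ.symm h = h := fun h hh => by rw [MulEquiv.symm_apply_eq, hφ h hh]
    refine Function.bijective_iff_has_inverse.2
      ⟨fun w => quotientAlexanderOp φ.symm H hφ' w (Quotient.mk _ y), ?_, ?_⟩ <;> rintro ⟨x⟩
    · change Quotient.mk _ (φ.symm (φ (x * y⁻¹) * y * y⁻¹) * y) = Quotient.mk _ x
      simp
    · change Quotient.mk _ (φ (φ.symm (x * y⁻¹) * y * y⁻¹) * y) = Quotient.mk _ x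
      simp
  distrib := by
    rintro ⟨x⟩ ⟨y⟩ ⟨z⟩
    change Quotient.mk _ (φ (φ (x * y⁻¹) * y * z⁻¹) * z) =
      Quotient.mk _ (φ (φ (x * z⁻¹) * z * (φ (y * z⁻¹) * z)⁻¹) * (φ (y * z⁻¹) * z))
    congr 1
    simp only [map_mul, map_inv]
    group

/-- Spares a geometric check of the axioms for Q(K): they are transported from the cosets. -/
theorem IsQuandle.of_equiv {X Y : Type*} {op : X → X → X} {op' : Y → Y → Y} (h : IsQuandle op')
    (e : X ≃ Y) (he : ∀ a b, e (op a b) = op' (e a) (e b)) : IsQuandle op where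
  nonempty := e.nonempty_congr.2 h.nonempty
  idem x := e.injective (by rw [he, h.idem])
  bijective x := by
    have : (fun w => op w x) = e.symm ∘ (fun w => op' w (e x)) ∘ e := by
      funext w
      simp [← he]
    rw [this]
    exact e.symm.bijective.comp ((h.bijective _).comp e.bijective)
  distrib x y z := e.injective (by simp only [he]; exact h.distrib _ _ _)

/-- The automorphism induced on a subgroup (given by an injective homomorphism) that is stable under
conjugation by `m`. -/
theorem exists_mulEquiv_of_conj {Γ : Type*} [Group Γ] {ι : G →* Γ} (hι : Function.Injective ι)
    {m : Γ} (h : ∀ g, m⁻¹ * ι g * m ∈ ι.range) (h' : ∀ g, m * ι g * m⁻¹ ∈ ι.range) :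
    ∃ φ : G ≃* G, ∀ g, ι (φ g) = m⁻¹ * ι g * m := by
  choose f hf using h
  choose f' hf' using h'
  refine ⟨⟨⟨f, f', fun g => hι ?_, fun g => hι ?_⟩, fun a b => hι ?_⟩, hf⟩
  · rw [hf', hf]; group
  · rw [hf, hf']; group
  · rw [map_mul, hf, hf, hf, map_mul]; group

/-- A quandle of classes whose elements are represented by the elements of a group is a quandle of
right cosets. -/
theorem exists_equiv_rightCosets {N : Type*} {R : N → N → Prop} {op : N → N → N}
    {opR : Quot R → Quot R → Quot R}
    (hop : ∀ a b, opR (Quot.mk _ a) (Quot.mk _ b) = Quot.mk _ (op a b)) (hR : ∀ a, R a a)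
    (φ : G ≃* G) (H : Subgroup G) (hφ : ∀ h ∈ H, φ h = h) (Rep : N → G → Prop)
    (hex : ∀ a, ∃ g, Rep a g) (hsurj : ∀ g, ∃ a, Rep a g)
    (hwd : ∀ a b g g', Rep a g → Rep b g' → R a b → g * g'⁻¹ ∈ H)
    (hinj : ∀ a b g g', Rep a g → Rep b g' → g * g'⁻¹ ∈ H → R a b)
    (hmul : ∀ a b g g', Rep a g → Rep b g' → Rep (op a b) (φ (g * g'⁻¹) * g')) :
    ∃ e : Quot R ≃ RightCosets H,
      ∀ a b, e (opR a b) = quotientAlexanderOp φ H hφ (e a) (e b) := by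
  choose r hr using hex
  have hmk : ∀ g g' : G, (Quotient.mk (QuotientGroup.rightRel H) g = Quotient.mk _ g') ↔
      g' * g⁻¹ ∈ H := fun g g' => Quotient.eq.trans QuotientGroup.rightRel_apply
  let f : Quot R → RightCosets H := Quot.lift (fun a => Quotient.mk _ (r a)) fun a b hab =>
    ((hmk _ _).2 (hwd _ _ _ _ (hr a) (hr b) hab)).symm
  -- The coset does not depend on the chosen representative: `hwd` is applied to `a` and itself,
  -- which needs only reflexivity. Since `hinj` returns `R` itself, `R` need not be an equivalence
  -- relation.
  have hf : ∀ a g, Rep a g → f (Quot.mk _ a) = Quotient.mk _ g := fun a g hg =>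
    (hmk _ _).2 (hwd _ _ _ _ hg (hr a) (hR a))
  refine ⟨Equiv.ofBijective f ⟨?_, ?_⟩, ?_⟩
  · rintro ⟨a⟩ ⟨b⟩ hab
    exact Quot.sound (hinj _ _ _ _ (hr a) (hr b) ((hmk _ _).1 hab.symm))
  · rintro ⟨g⟩
    obtain ⟨a, ha⟩ := hsurj g
    exact ⟨Quot.mk _ a, hf a g ha⟩
  · rintro ⟨a⟩ ⟨b⟩
    change f (opR (Quot.mk _ a) (Quot.mk _ b)) = _
    rw [hop, hf _ _ (hmul _ _ _ _ (hr a) (hr b))]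
    rfl

end Algebra

/-! ### Loop classes -/

section Loops

variable {X : Type*} [TopologicalSpace X] {x y z w : X}

theorem loopClass_eq_iff {γ δ : Path x x} : loopClass γ = loopClass δ ↔ γ.Homotopic δ :=
  MulOpposite.op_injective.eq_iff.trans Path.Homotopic.Quotient.eq

theorem exists_loopClass (g : PiOne X x) : ∃ γ : Path x x, loopClass γ = g := by
  obtain ⟨γ, hγ⟩ := Path.Homotopic.Quotient.mk_surjective g.unop
  exact ⟨γ, congrArg MulOpposite.op hγ⟩

/-- A homotopy invariant of loops that is multiplicative defines a homomorphism. -/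
def PiOne.lift {A : Type*} [Group A] (f : Path x x → A) (hf : ∀ γ δ, γ.Homotopic δ → f γ = f δ)
    (hmul : ∀ γ δ, f (γ.trans δ) = f γ * f δ) : PiOne X x →* A :=
  MonoidHom.mk' (fun g => Quotient.lift f hf g.unop) fun a b => by
    obtain ⟨γ, rfl⟩ := exists_loopClass a
    obtain ⟨δ, rfl⟩ := exists_loopClass b
    exact hmul γ δ

/-- The homomorphism of fundamental groups induced by the inclusion of a subspace. -/
def inclHom {p : X → Prop} (a : {y // p y}) : PiOne {y // p y} a →* PiOne X a.1 :=
  PiOne.lift (fun γ => loopClass (γ.map continuous_subtype_val))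
    (fun γ δ h => loopClass_eq_iff.2 (h.map ⟨_, continuous_subtype_val⟩))
    (fun γ δ => by rw [Path.map_trans, loopClass_trans])

theorem inclHom_loopClass {p : X → Prop} (a : {y // p y}) (γ : Path a a) :
    inclHom a (loopClass γ) = loopClass (γ.map continuous_subtype_val) := rfl

open Path.Homotopic.Quotient in
theorem homotopic_cancel_left {c : Path x y} {α β : Path y z} (h : (c.trans α).Homotopic (c.trans β)) :
    α.Homotopic β := by
  rw [← Path.Homotopic.Quotient.eq] at h ⊢
  have := congrArg (fun q => (mk c).symm.trans q) h
  simp only [mk_trans] at this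
  rwa [← trans_assoc, ← trans_assoc, symm_trans, refl_trans, refl_trans] at this

end Loops

/-! ### Topology of the tubular neighbourhood -/

section Tubes

variable {n : ℕ} {M : Type*} [TopologicalSpace M] [ChartedSpace (EuclideanSpace ℝ (Fin n)) M]
  [IsManifold (𝓡 n) ∞ M] {K : NKnot n M}

theorem NKnot.compactSpace (K : NKnot n M) : CompactSpace M := by
  obtain ⟨e⟩ := K.homeo
  exact e.symm.compactSpace

theorem NKnot.pathConnectedSpace (K : NKnot n M) (hn : 1 ≤ n) : PathConnectedSpace M := by
  obtain ⟨e⟩ := K.homeo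
  have h : IsPathConnected (Metric.sphere (0 : EuclideanSpace ℝ (Fin (n + 1))) 1) :=
    isPathConnected_sphere (by
      rw [← Module.finrank_eq_rank, finrank_euclideanSpace_fin]
      exact_mod_cast Nat.lt_succ_of_le hn) 0 zero_le_one
  have := isPathConnected_iff_pathConnectedSpace.1 h
  exact e.symm.surjective.pathConnectedSpace e.symm.continuous

namespace Tube

variable (T : Tube K)

theorem isOpenEmbedding : Topology.IsOpenEmbedding T.toFun :=
  T.localDiffeo.isLocalHomeomorph.isOpenEmbedding_of_injective T.injective

theorem continuous_toFun : Continuous T.toFun := T.isOpenEmbedding.continuous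

theorem exists_lift {A : Type*} [TopologicalSpace A] {f : A → Sph n} (hf : Continuous f)
    (h : ∀ a, f a ∈ range T.toFun) : ∃ g : A → M × ℂ, Continuous g ∧ ∀ a, T.toFun (g a) = f a := by
  choose g hg using h
  refine ⟨g, ?_, hg⟩
  rw [T.isOpenEmbedding.isInducing.continuous_iff]
  exact hf.congr fun a => (hg a).symm

theorem mem_image_iff {s : Set (M × ℂ)} {q : M × ℂ} : T.toFun q ∈ T.toFun '' s ↔ q ∈ s :=
  T.injective.mem_set_image

theorem mem_nbhd_iff {q : M × ℂ} : T.toFun q ∈ T.nbhd ↔ ‖q.2‖ ≤ 1 := T.mem_image_iff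

theorem mem_bdry_iff {q : M × ℂ} : T.toFun q ∈ T.bdry ↔ ‖q.2‖ = 1 := T.mem_image_iff

theorem mem_exterior_iff {q : M × ℂ} : T.toFun q ∈ T.exterior ↔ 1 ≤ ‖q.2‖ :=
  (not_congr T.mem_image_iff).trans (not_lt (a := ‖q.2‖))

theorem mem_carrier_iff {q : M × ℂ} : T.toFun q ∈ K.carrier ↔ q.2 = 0 := by
  constructor
  · rintro ⟨x, hx⟩
    rw [← T.zero_section] at hx
    rw [← T.injective hx]
  · intro h
    exact ⟨q.1, by rw [← T.zero_section, ← h]⟩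

theorem nbhd_subset_range : T.nbhd ⊆ range T.toFun := image_subset_range _ _

theorem isClosed_nbhd : IsClosed T.nbhd := by
  have := K.compactSpace
  have h : {q : M × ℂ | ‖q.2‖ ≤ 1} = univ ×ˢ Metric.closedBall 0 1 := by
    ext q; simp
  refine IsCompact.isClosed ?_
  rw [nbhd, h]
  exact (isCompact_univ.prod (isCompact_closedBall _ _)).image T.continuous_toFun

theorem isClosed_exterior : IsClosed T.exterior := by
  refine IsOpen.isClosed_compl (T.isOpenEmbedding.isOpenMap _ ?_)
  exact isOpen_lt (by fun_prop) continuous_const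

theorem exterior_disjoint {y : Sph n} (hy : y ∈ T.exterior) : y ∉ K.carrier := by
  rintro ⟨x, rfl⟩
  rw [← T.zero_section, T.mem_exterior_iff] at hy
  simp at hy
  linarith

theorem nbhd_union_exterior (y : Sph n) : y ∈ T.nbhd ∨ y ∈ T.exterior := by
  by_cases h : y ∈ T.toFun '' {q | ‖q.2‖ < 1}
  · obtain ⟨q, hq, rfl⟩ := h
    exact Or.inl (T.mem_nbhd_iff.2 (le_of_lt hq))
  · exact Or.inr h

/-- The exterior is a strong deformation retract of the complement of the knot. -/
theorem exists_retraction : ∃ R : I × K.Compl → K.Compl, Continuous R ∧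
    (∀ y, R (0, y) = y) ∧ (∀ y, (R (1, y)).1 ∈ T.exterior) ∧
    ∀ t y, y.1 ∈ T.exterior → R (t, y) = y := by
  classical
  have hex : ∀ y : Sph n, ∃ q, y ∈ T.nbhd → T.toFun q = y := fun y => by
    by_cases h : y ∈ T.nbhd
    · obtain ⟨q, hq⟩ := T.nbhd_subset_range h
      exact ⟨q, fun _ => hq⟩
    · obtain ⟨e⟩ := K.homeo
      obtain ⟨v, hv⟩ := NormedSpace.sphere_nonempty (E := EuclideanSpace ℝ (Fin (n + 1)))
        (x := 0) (r := 1) |>.2 zero_le_one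
      exact ⟨(e.symm ⟨v, hv⟩, 0), fun h' => absurd h' h⟩
  choose g hg using hex
  have hgc : ContinuousOn g T.nbhd := by
    rw [T.isOpenEmbedding.isInducing.continuousOn_iff]
    exact continuousOn_id.congr fun y hy => hg y hy
  -- Radial expansion: the identity at t = 0 and on the unit circle, z/‖z‖ at t = 1. It thus agrees
  -- on ∂N with the identity of the exterior, and the two closed pieces can be glued.
  let r : I → ℂ → ℂ := fun t z => ((1 - t : ℝ) + (t : ℝ) / ‖z‖ : ℝ) * z
  have hr0 : ∀ (t : I) (z : ℂ), z ≠ 0 → ‖z‖ ≤ 1 → 0 < (1 - t : ℝ) + (t : ℝ) / ‖z‖ :=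
      fun t z hz hz1 => by
    have hz := norm_pos_iff.2 hz
    rcases eq_or_lt_of_le t.2.1 with h | h
    · rw [← h]; simp
    · have : 0 < (t : ℝ) / ‖z‖ := div_pos h hz
      linarith [t.2.2]
  have hr1 : ∀ (t : I) (z : ℂ), ‖z‖ = 1 → r t z = z := fun t z hz => by simp [r, hz]
  let R : I × K.Compl → Sph n := fun y =>
    if y.2.1 ∈ T.exterior then y.2.1 else T.toFun ((g y.2.1).1, r y.1 (g y.2.1).2)
  have hRe : ∀ t (y : K.Compl), y.1 ∈ T.exterior → R (t, y) = y.1 := fun t y hy => if_pos hy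
  have hRn : ∀ t (y : K.Compl), y.1 ∈ T.nbhd →
      R (t, y) = T.toFun ((g y.1).1, r t (g y.1).2) := fun t y hy => by
    by_cases h : y.1 ∈ T.exterior
    · have h1 := h
      have h2 := hy
      rw [← hg _ hy, T.mem_exterior_iff] at h1
      rw [← hg _ hy, T.mem_nbhd_iff] at h2
      rw [hRe t y h, hr1 _ _ (le_antisymm h2 h1), hg _ hy]
    · exact if_neg h
  have hgne : ∀ y : K.Compl, y.1 ∈ T.nbhd → (g y.1).2 ≠ 0 := fun y hy h => y.2 (by
    rw [← hg _ hy]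
    exact T.mem_carrier_iff.2 h)
  have hgle : ∀ y : K.Compl, y.1 ∈ T.nbhd → ‖(g y.1).2‖ ≤ 1 := fun y hy => by
    rw [← T.mem_nbhd_iff, hg _ hy]; exact hy
  have hRc : Continuous R := by
    rw [← continuousOn_univ]
    have hcov : (univ : Set (I × K.Compl)) = {y | y.2.1 ∈ T.nbhd} ∪ {y | y.2.1 ∈ T.exterior} := by
      ext y; simpa using T.nbhd_union_exterior y.2.1
    rw [hcov]
    refine ContinuousOn.union_of_isClosed ?_ ?_ (T.isClosed_nbhd.preimage (by fun_prop))
      (T.isClosed_exterior.preimage (by fun_prop))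
    · have hgc' : ContinuousOn (fun y : I × K.Compl => g y.2.1) {y | y.2.1 ∈ T.nbhd} :=
        hgc.comp (by fun_prop) fun y hy => hy
      have h2 : ContinuousOn (fun y : I × K.Compl => (g y.2.1).2) {y | y.2.1 ∈ T.nbhd} :=
        continuous_snd.comp_continuousOn hgc'
      refine ContinuousOn.congr (f := fun y => T.toFun ((g y.2.1).1, r y.1 (g y.2.1).2)) ?_
        fun y hy => hRn _ _ hy
      refine T.continuous_toFun.comp_continuousOn
        ((continuous_fst.comp_continuousOn hgc').prodMk ?_)
      refine ContinuousOn.mul (Complex.continuous_ofReal.comp_continuousOn ?_) h2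
      refine ContinuousOn.add (by fun_prop) (ContinuousOn.div (by fun_prop) h2.norm fun y hy => ?_)
      exact norm_ne_zero_iff.2 (hgne _ hy)
    · exact ContinuousOn.congr (f := fun y => y.2.1) (by fun_prop) fun y hy => hRe _ _ hy
  have hRK : ∀ y, R y ∉ K.carrier := by
    rintro ⟨t, y⟩
    rcases T.nbhd_union_exterior y.1 with h | h
    · rw [hRn _ _ h, T.mem_carrier_iff]
      exact mul_ne_zero (Complex.ofReal_ne_zero.2 (hr0 t _ (hgne _ h) (hgle _ h)).ne') (hgne _ h)
    · rw [hRe _ _ h]; exact y.2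
  refine ⟨fun y => ⟨R y, hRK y⟩, hRc.subtype_mk _, fun y => Subtype.ext ?_, fun y => ?_,
    fun t y hy => Subtype.ext (hRe t y hy)⟩
  · change R (0, y) = _
    rcases T.nbhd_union_exterior y.1 with h | h
    · rw [hRn _ _ h]
      simp [r, hg _ h]
    · exact hRe _ _ h
  · change R (1, y) ∈ _
    rcases T.nbhd_union_exterior y.1 with h | h
    · rw [hRn _ _ h, T.mem_exterior_iff]
      have := norm_pos_iff.2 (hgne _ h)
      simp only [r, norm_mul, Complex.norm_real]
      simp [this.ne']
    · rw [hRe _ _ h]; exact h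

/-! ### Polar coordinates -/

/-- Logarithmic polar coordinates on the complement of `K` in the tubular neighbourhood. -/
def polar (q : M × ℂ) : K.Compl :=
  ⟨T.toFun (q.1, Complex.exp q.2), by rw [T.mem_carrier_iff]; exact Complex.exp_ne_zero _⟩

theorem coe_polar (q : M × ℂ) : (T.polar q).1 = T.toFun (q.1, Complex.exp q.2) := rfl

theorem continuous_polar : Continuous T.polar :=
  (T.continuous_toFun.comp (by fun_prop)).subtype_mk _

theorem polar_add_int (x : M) (z : ℂ) (k : ℤ) :
    T.polar (x, z + k * (2 * Real.pi * Complex.I)) = T.polar (x, z) := by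
  refine Subtype.ext ?_
  simp only [coe_polar, Complex.exp_add, Complex.exp_int_mul_two_pi_mul_I, mul_one]

theorem polar_eq_iff {q q' : M × ℂ} : T.polar q = T.polar q' ↔
    ∃ k : ℤ, q = (q'.1, q'.2 + k * (2 * Real.pi * Complex.I)) := by
  constructor
  · intro h
    have := T.injective (Subtype.ext_iff.1 h)
    obtain ⟨k, hk⟩ := Complex.exp_eq_exp_iff_exists_int.1 (Prod.ext_iff.1 this).2
    exact ⟨k, Prod.ext (Prod.ext_iff.1 this).1 hk⟩
  · rintro ⟨k, rfl⟩
    exact T.polar_add_int _ _ _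

theorem polar_mem_bdry_iff {q : M × ℂ} : (T.polar q).1 ∈ T.bdry ↔ q.2.re = 0 := by
  rw [coe_polar, T.mem_bdry_iff, Complex.norm_exp, Real.exp_eq_one_iff]

theorem exists_polar_of_mem_nbhd {y : K.Compl} (hy : y.1 ∈ T.nbhd) : ∃ q, T.polar q = y := by
  obtain ⟨q, hq⟩ := T.nbhd_subset_range hy
  have : q.2 ≠ 0 := fun h => y.2 (by rw [← hq]; exact T.mem_carrier_iff.2 h)
  refine ⟨(q.1, Complex.log q.2), Subtype.ext ?_⟩
  rw [coe_polar, Complex.exp_log this, ← hq]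

/-- A path in the image of the polar coordinates lifts. -/
theorem exists_polar_lift {γ : I → K.Compl} (hγ : Continuous γ)
    (h : ∀ s, γ s ∈ range T.polar) {q : M × ℂ} (hq : T.polar q = γ 0) :
    ∃ κ : I → M × ℂ, Continuous κ ∧ (∀ s, T.polar (κ s) = γ s) ∧ κ 0 = q := by
  obtain ⟨g, hg, hgγ⟩ := T.exists_lift (f := fun s => (γ s).1) (by fun_prop) fun s => by
    obtain ⟨q, hq⟩ := h s
    exact ⟨_, congrArg Subtype.val hq⟩
  have hne : ∀ s, (g s).2 ≠ 0 := fun s h0 => (γ s).2 (by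
    rw [← hgγ s]; exact T.mem_carrier_iff.2 h0)
  have hg0 : g 0 = (q.1, Complex.exp q.2) := T.injective ((hgγ 0).trans
    (congrArg Subtype.val hq).symm)
  obtain ⟨l, ⟨hl0, hl⟩, -⟩ := Complex.isCoveringMapOn_exp.existsUnique_continuousMap_lifts
    (⟨fun t : ℝ => (g (projIcc 0 1 zero_le_one t)).2,
      (continuous_snd.comp hg).comp continuous_projIcc⟩ : C(ℝ, ℂ)) (a₀ := 0) (e₀ := q.2)
    (by simp [hg0]) fun t => by simpa using hne _
  refine ⟨fun s => ((g s).1, l s), by fun_prop, fun s => Subtype.ext ?_, ?_⟩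
  · have := congrFun hl s
    simp only [Function.comp_apply, ContinuousMap.coe_mk, projIcc_val] at this
    rw [coe_polar]
    simp only [this]
    exact hgγ s
  · exact Prod.ext (by simp [hg0]) (by simpa using hl0)

variable {q q' q'' : M × ℂ} {y y' y'' : K.Compl}

/-- The image of a path under the polar coordinates. -/
def polarPath (κ : Path q q') (h : T.polar q = y) (h' : T.polar q' = y') : Path y y' where
  toFun s := T.polar (κ s)
  continuous_toFun := T.continuous_polar.comp κ.continuous
  source' := by rw [κ.source, h]
  target' := by rw [κ.target, h']

theorem polarPath_apply (κ : Path q q') (h : T.polar q = y) (h' : T.polar q' = y') (s : I) :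
    T.polarPath κ h h' s = T.polar (κ s) := rfl

theorem polarPath_trans (κ : Path q q') (κ' : Path q' q'') (h : T.polar q = y)
    (h' : T.polar q' = y') (h'' : T.polar q'' = y'') :
    T.polarPath (κ.trans κ') h h'' = (T.polarPath κ h h').trans (T.polarPath κ' h' h'') := by
  ext s
  simp only [polarPath_apply, Path.trans_apply]
  split_ifs <;> rfl

theorem polarPath_symm (κ : Path q q') (h : T.polar q = y) (h' : T.polar q' = y') :
    T.polarPath κ.symm h' h = (T.polarPath κ h h').symm := rfl

/-- Paths with the same projection to `M` and the same endpoints are homotopic. -/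
theorem polarPath_homotopic (κ κ' : Path q q') (h : T.polar q = y) (h' : T.polar q' = y')
    (hκ : ∀ s, (κ s).1 = (κ' s).1) :
    (T.polarPath κ h h').Homotopic (T.polarPath κ' h h') := by
  refine ⟨⟨⟨⟨fun p => T.polar ((κ p.2).1, (1 - p.1 : ℝ) * (κ p.2).2 + (p.1 : ℝ) * (κ' p.2).2),
    T.continuous_polar.comp (by fun_prop)⟩, fun s => ?_, fun s => ?_⟩, ?_⟩⟩
  · simp [polarPath_apply]
  · simp [polarPath_apply, hκ]
  · rintro t s (rfl | rfl)
    · simp only [ContinuousMap.coe_mk, Path.source, Path.coe_toContinuousMap]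
      rw [← add_mul, ← h]
      simp
    · simp only [ContinuousMap.coe_mk, Path.target, Path.coe_toContinuousMap]
      rw [← add_mul, ← h']
      simp

/-- The path that goes `k` times around the knot. -/
def meridianPath (x : M) (z : ℂ) (k : ℤ) : Path (x, z) (x, z + k * (2 * Real.pi * Complex.I)) where
  toFun s := (x, z + (s : ℝ) * (k * (2 * Real.pi * Complex.I)))
  source' := by simp
  target' := by simp

/-- The loop that goes `k` times around the knot. -/
def meridianLoop (q : M × ℂ) (k : ℤ) : Path (T.polar q) (T.polar q) :=
  T.polarPath (meridianPath q.1 q.2 k) rfl (T.polar_add_int _ _ _)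

theorem meridianLoop_apply (q : M × ℂ) (k : ℤ) (s : I) : T.meridianLoop q k s =
    T.polar (q.1, q.2 + (s : ℝ) * (k * (2 * Real.pi * Complex.I))) := rfl

/-- Meridian loops can be transported along paths. -/
theorem meridianLoop_homotopic (κ : Path q q') (k : ℤ) :
    ((T.polarPath κ rfl rfl).trans (T.meridianLoop q' k)).Homotopic
      ((T.meridianLoop q k).trans (T.polarPath κ rfl rfl)) := by
  refine homotopic_of_square _ _ _ _
    -- The path is swept around the knot; after k full turns, periodicity brings it back to itself.
    (fun p => T.polar ((κ p.1).1, (κ p.1).2 + (p.2 : ℝ) * (k * (2 * Real.pi * Complex.I))))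
    (T.continuous_polar.comp (by fun_prop)) (fun t => ?_) (fun t => ?_) (fun t => ?_) fun t => ?_
  · simp [polarPath_apply]
  · simp [meridianLoop_apply]
  · simp [meridianLoop_apply]
  · simpa [polarPath_apply] using T.polar_add_int (κ t).1 (κ t).2 k

/-- Translating the l-fold loop by k periods makes it continue the k-fold one in M × ℂ, so the class
is additive in the number of turns and defines a homomorphism on ℤ. -/
theorem loopClass_meridianLoop (q : M × ℂ) (k : ℤ) :
    loopClass (T.meridianLoop q k) = loopClass (T.meridianLoop q 1) ^ k := by
  have hmul : ∀ k l : ℤ, loopClass (T.meridianLoop q (k + l)) =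
      loopClass (T.meridianLoop q k) * loopClass (T.meridianLoop q l) := fun k l => by
    rw [← loopClass_trans, loopClass_eq_iff]
    refine Path.Homotopic.symm ?_
    let κ' : Path (q.1, q.2 + k * (2 * Real.pi * Complex.I))
        (q.1, q.2 + (k + l : ℤ) * (2 * Real.pi * Complex.I)) :=
      (meridianPath q.1 (q.2 + k * (2 * Real.pi * Complex.I)) l).cast rfl (by push_cast; ring_nf)
    have h : T.meridianLoop q l = T.polarPath κ' (T.polar_add_int _ _ _) (T.polar_add_int _ _ _) := by
      ext1; funext s
      rw [meridianLoop_apply, polarPath_apply, ← T.polar_add_int _ _ k]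
      congr 1
      refine Prod.ext rfl ?_
      simp only [κ', Path.cast_coe, meridianPath, Path.coe_mk_mk]
      ring
    rw [h, meridianLoop, ← polarPath_trans]
    refine T.polarPath_homotopic _ _ _ _ fun s => ?_
    rw [Path.trans_apply]
    split_ifs <;> rfl
  let ν : Multiplicative ℤ →* PiOne K.Compl (T.polar q) :=
    MonoidHom.mk' (fun k => loopClass (T.meridianLoop q k.toAdd)) fun a b => hmul _ _
  have := map_zpow ν (Multiplicative.ofAdd 1) k
  rw [← ofAdd_zsmul] at this
  simpa [ν] using this

end Tube

end Tubes

section Nooses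

variable {n : ℕ} {M : Type*} [TopologicalSpace M] [ChartedSpace (EuclideanSpace ℝ (Fin n)) M]
  [IsManifold (𝓡 n) ∞ M] {K : NKnot n M} {T : Tube K}

/-! ### Deforming meridional disks -/

theorem Tube.isProperDiskMap (T : Tube K) {u : ℂ} {g : C(D2, ℂ)} (hg : g ∈ diskSelfMaps u)
    (a : D2 → M) : IsProperDiskMap T fun z => T.toFun (a z, g z) := by
  obtain ⟨h1, h2, h3, -⟩ := hg
  refine ⟨fun z => T.mem_nbhd_iff.2 (h1 z), fun z => T.mem_bdry_iff.trans (h2 z), ?_⟩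
  simpa only [T.mem_carrier_iff] using h3

/-- The fiber of the tubular neighbourhood over `q.1`, rotated. -/
def Tube.stdDisk (T : Tube K) (q : M × ℂ) : C(D2, Sph n) :=
  ⟨fun z => T.toFun (q.1, Complex.exp q.2 * z), T.continuous_toFun.comp (by fun_prop)⟩

theorem Tube.stdDisk_apply (T : Tube K) (q : M × ℂ) (z : D2) :
    T.stdDisk q z = T.toFun (q.1, Complex.exp q.2 * z) := rfl

theorem Tube.stdDisk_circlePt_zero (T : Tube K) (q : M × ℂ) :
    T.stdDisk q (circlePt 0) = (T.polar q).1 := by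
  simp [Tube.stdDisk_apply, coe_circlePt_zero, T.coe_polar]

theorem diskRotation_mem {u : ℂ} (hu : ‖u‖ = 1) : diskRotation u ∈ diskSelfMaps u := by
  have hu0 : u ≠ 0 := fun h => by simp [h] at hu
  refine ⟨fun z => ?_, fun z => ?_, ⟨⟨0, by simp⟩, ?_, fun z hz => ?_⟩, ?_⟩
  · simpa [diskRotation, hu] using norm_le_one z
  · simp [diskRotation, hu]
  · simp [diskRotation]
  · have hz : u * (z : ℂ) = 0 := hz
    exact Subtype.ext ((mul_eq_zero.1 hz).resolve_left hu0)
  · simp [diskRotation, coe_circlePt_zero]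

theorem Tube.isProperDiskMap_stdDisk (T : Tube K) {q : M × ℂ} (hq : q.2.re = 0) :
    IsProperDiskMap T (T.stdDisk q) :=
  T.isProperDiskMap (diskRotation_mem (u := Complex.exp q.2) (by simp [Complex.norm_exp, hq]))
    fun _ => q.1

/-- The maps of the disk that are proper, meet `K` in one point and have a given value at `1`. -/
def properDisks (T : Tube K) (y : Sph n) : Set C(D2, Sph n) :=
  {f | IsProperDiskMap T f ∧ f (circlePt 0) = y}

/-- A meridional disk as a continuous map. -/
def MeridionalDisk.toContinuousMap (D : MeridionalDisk T) : C(D2, Sph n) :=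
  ⟨fun z => D.toFun z, D.continuous_restrict⟩

theorem MeridionalDisk.circlePt_mem_bdry (D : MeridionalDisk T) (s : ℝ) :
    D.toFun (circlePt s) ∈ T.bdry :=
  (D.mem_bdry _ (circlePt s).2).2 (norm_circlePt s)

theorem MeridionalDisk.re_eq_zero (D : MeridionalDisk T) {q : M × ℂ}
    (hq : (T.polar q).1 = D.toFun (circlePt 0)) : q.2.re = 0 := by
  rw [← T.polar_mem_bdry_iff, hq]
  exact D.circlePt_mem_bdry 0

/-- A meridional disk can be deformed to a fiber of the tubular neighbourhood. -/
theorem MeridionalDisk.joinedIn_stdDisk (hn : 1 ≤ n) (D : MeridionalDisk T) {q : M × ℂ}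
    (hq : (T.polar q).1 = D.toFun (circlePt 0)) :
    JoinedIn (properDisks T (T.polar q).1) D.toContinuousMap (T.stdDisk q) := by
  obtain ⟨f, hf, hfD⟩ := T.exists_lift D.continuous_restrict fun z =>
    T.nbhd_subset_range (D.mem_nbhd z z.2)
  obtain ⟨x, w, c, A, hw, hwK, hc, hcw, hA, hdet⟩ := D.exists_coords hn
  have hf1 : f (circlePt 0) = (q.1, Complex.exp q.2) := T.injective ((hfD _).trans hq.symm)
  let g : C(D2, ℂ) := ⟨fun z => (f z).2, by fun_prop⟩
  have hgw : ∀ z : D2, g z = 0 ↔ (z : ℂ) = w := fun z => by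
    rw [← hwK z z.2, ← hfD, T.mem_carrier_iff]; rfl
  have hg : g ∈ diskSelfMaps (Complex.exp q.2) := by
    refine ⟨fun z => ?_, fun z => ?_, ⟨⟨w, mem_closedBall_zero_iff.2 hw.le⟩, (hgw _).2 rfl,
      fun z hz => Subtype.ext ((hgw z).1 hz)⟩, ?_⟩
    · change ‖(f z).2‖ ≤ 1
      rw [← T.mem_nbhd_iff, hfD]; exact D.mem_nbhd z z.2
    · rw [← D.mem_bdry z z.2, ← hfD, T.mem_bdry_iff]; rfl
    · change (f (circlePt 0)).2 = _
      rw [hf1]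
  obtain ⟨a, ha, hre⟩ := re_div_pos_of_hasFDerivAt hA (by rw [hcw]) hdet
  have hball : ∀ᶠ z in 𝓝 w, z ∈ Metric.closedBall (0 : ℂ) 1 :=
    Filter.mem_of_superset (Metric.isOpen_ball.mem_nhds (mem_ball_zero_iff.2 hw))
      Metric.ball_subset_closedBall
  have J₂ := joinedIn_diskRotation g hg hw hgw ha (by
    filter_upwards [hre, mem_nhdsWithin_of_mem_nhds hc, mem_nhdsWithin_of_mem_nhds hball]
      with z hz hcz hzb
    have : c z = f ⟨z, hzb⟩ := T.injective (hcz.trans (hfD ⟨z, hzb⟩).symm)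
    simp only [diskProj_of_mem hzb]
    rw [this] at hz
    exact hz)
  let one : D2 := circlePt 0
  have hmem : ∀ (t : I) (z : D2),
      (1 - t : ℝ) • (z : ℂ) + (t : ℝ) • (one : ℂ) ∈ Metric.closedBall (0 : ℂ) 1 := fun t z =>
    convex_closedBall 0 1 z.2 one.2 (by linarith [t.2.2]) t.2.1 (by ring)
  -- Contracting the disk to its boundary point 1 makes the M-coordinate constant. The normal
  -- coordinate is untouched, so the map stays proper with one intersection, and the value at 1 does
  -- not move.
  let r : I × D2 → D2 := fun y => ⟨_, hmem y.1 y.2⟩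
  have hr : Continuous r := by fun_prop
  let g₁ : C(D2, Sph n) := ⟨fun z => T.toFun (q.1, g z), T.continuous_toFun.comp (by fun_prop)⟩
  have J₁ : JoinedIn (properDisks T (T.polar q).1) D.toContinuousMap g₁ := by
    refine joinedIn_of_homotopy (fun y => T.toFun ((f (r y)).1, g y.2))
      (T.continuous_toFun.comp (by fun_prop)) (fun z => ?_) (fun z => ?_)
      fun t => ⟨T.isProperDiskMap hg _, ?_⟩
    · have : r (0, z) = z := Subtype.ext (by simp [r])
      simp only [this]
      exact hfD z
    · have : r (1, z) = circlePt 0 := Subtype.ext (by simp [r, one])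
      simp only [this, hf1]
      rfl
    · have : r (t, circlePt 0) = circlePt 0 := Subtype.ext (by simp [r, one, ← add_mul])
      simp only [ContinuousMap.coe_mk, this, hf1, hg.2.2.2]
      rfl
  refine J₁.trans ?_
  obtain ⟨γ, hγ⟩ := J₂
  have hΨ : Continuous fun y : I × D2 => T.toFun (q.1, γ y.1 y.2) :=
    T.continuous_toFun.comp (by fun_prop)
  refine joinedIn_of_homotopy _ hΨ (fun z => by simp [g₁])
    (fun z => by rw [γ.target]; rfl)
    fun t => ⟨T.isProperDiskMap (hγ t) _, ?_⟩
  simp only [ContinuousMap.coe_mk, (hγ t).2.2.2]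
  rfl

/-- The boundary of a meridional disk, as a loop in the complement of the knot. -/
def MeridionalDisk.boundaryPath (D : MeridionalDisk T) {y : K.Compl}
    (hy : D.toFun (circlePt 0) = y.1) : Path y y where
  toFun s := ⟨D.toFun (circlePt s), T.bdry_disjoint (D.circlePt_mem_bdry s)⟩
  continuous_toFun := (D.continuous_restrict.comp
    (continuous_circlePt.comp continuous_subtype_val)).subtype_mk _
  source' := Subtype.ext hy
  target' := Subtype.ext (by
    change D.toFun (circlePt 1) = _
    rw [← circlePt_zero_eq_one]; exact hy)

/-- The boundary circle of the deformation to a standard disk. All boundaries lie on ∂N, and the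
point over 1 is fixed, so this is a homotopy of based loops in the complement. -/
theorem MeridionalDisk.boundaryPath_homotopic (hn : 1 ≤ n) (D : MeridionalDisk T) {q : M × ℂ}
    (hq : D.toFun (circlePt 0) = (T.polar q).1) :
    (D.boundaryPath hq).Homotopic (T.meridianLoop q 1) := by
  obtain ⟨γ, hγ⟩ := D.joinedIn_stdDisk hn hq.symm
  have hc := continuous_circlePt
  refine ⟨⟨⟨⟨fun y => ⟨γ y.1 (circlePt y.2), T.bdry_disjoint
    (((hγ y.1).1.2.1 _).2 (norm_circlePt _))⟩, by fun_prop⟩, fun s => Subtype.ext ?_,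
    fun s => Subtype.ext ?_⟩, ?_⟩⟩
  · simp only [Path.source]; rfl
  · simp only [Path.target, Tube.stdDisk_apply]
    change _ = T.toFun (q.1, Complex.exp (q.2 + _))
    rw [Complex.exp_add]
    congr 3
    simp only [circlePt]
    congr 1
    push_cast; ring
  · rintro t s (rfl | rfl) <;> refine Subtype.ext ?_
    · simp only [Path.coe_toContinuousMap, Path.source]
      exact (hγ t).2
    · simp only [Path.coe_toContinuousMap, Path.target]
      refine Eq.trans ?_ (hγ t).2
      exact congrArg (γ t) circlePt_zero_eq_one.symm

/-! ### The space of topological nooses -/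

/-- Pairs of a proper disk and a path in the exterior from the boundary of the disk to `p`. -/
def nooseSpace (T : Tube K) (p : Sph n) : Set (C(D2, Sph n) × C(I, Sph n)) :=
  {a | IsProperDiskMap T a.1 ∧ a.1 (circlePt 0) = a.2 0 ∧ a.2 1 = p ∧ ∀ s, a.2 s ∈ T.exterior}

/-- The intermediate stages of the deformations are merely continuous disks, so they are composed as
paths in `nooseSpace` and converted to a homotopy of nooses only at the end. -/
theorem Noose.homotopic_of_joinedIn {p : Sph n} {a b : Noose T p}
    (h : JoinedIn (nooseSpace T p) (a.disk.toContinuousMap, ⟨a.path, a.path.continuous⟩)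
      (b.disk.toContinuousMap, ⟨b.path, b.path.continuous⟩)) : Noose.Homotopic a b := by
  obtain ⟨γ, hγ⟩ := h
  refine ⟨⟨fun y => (γ y.2).1 y.1, by fun_prop⟩, fun t => ⟨(γ t).2, (hγ t).2.1.symm, (hγ t).2.2.1⟩,
    ?_, fun t => (hγ t).1, fun t s => (hγ t).2.2.2 s, fun z => ?_, fun s => ?_, fun z => ?_,
    fun s => ?_⟩
  · change Continuous fun q : I × I => (γ q.1).2 q.2
    fun_prop
  · simp only [ContinuousMap.coe_mk, Path.source]; rfl
  · change (γ 0).2 s = _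
    rw [Path.source]; rfl
  · simp only [ContinuousMap.coe_mk, Path.target]; rfl
  · change (γ 1).2 s = _
    rw [Path.target]; rfl

/-- The underlying map to the sphere of a path in the complement. -/
def pathVal {y y' : K.Compl} (γ : Path y y') : C(I, Sph n) := ⟨fun s => (γ s).1, by fun_prop⟩

theorem pathVal_apply {y y' : K.Compl} (γ : Path y y') (s : I) : pathVal γ s = (γ s).1 := rfl

theorem joinedIn_nooseSpace_of_disk {y b : K.Compl} {f g : C(D2, Sph n)}
    (h : JoinedIn (properDisks T y.1) f g) (γ : Path y b) (hγ : ∀ s, (γ s).1 ∈ T.exterior) :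
    JoinedIn (nooseSpace T b.1) (f, pathVal γ) (g, pathVal γ) := by
  obtain ⟨δ, hδ⟩ := h
  refine ⟨δ.prod (Path.refl _), fun t => ⟨(hδ t).1, (hδ t).2.trans ?_, ?_, hγ⟩⟩
  · simp [pathVal_apply]
  · simp [pathVal_apply]

/-- A homotopy in the complement is pushed into the exterior by the retraction, which leaves its two
end paths and its endpoints in place. -/
theorem joinedIn_nooseSpace_of_homotopic {y b : K.Compl} {f : C(D2, Sph n)}
    (hf : f ∈ properDisks T y.1) {γ δ : Path y b} (hγ : ∀ s, (γ s).1 ∈ T.exterior)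
    (hδ : ∀ s, (δ s).1 ∈ T.exterior) (h : γ.Homotopic δ) :
    JoinedIn (nooseSpace T b.1) (f, pathVal γ) (f, pathVal δ) := by
  obtain ⟨R, hR, -, hRE, hRe⟩ := T.exists_retraction
  obtain ⟨H⟩ := h
  have hy : y.1 ∈ T.exterior := by simpa using hγ 0
  have hb : b.1 ∈ T.exterior := by simpa using hγ 1
  let F : C(I × I, Sph n) := ⟨fun p => (R (1, H p)).1, by fun_prop⟩
  refine ⟨⟨⟨fun t => (f, F.curry t), by fun_prop⟩, ?_, ?_⟩, fun t => ⟨hf.1, ?_, ?_, fun s => hRE _⟩⟩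
  · refine Prod.ext rfl (ContinuousMap.ext fun s => ?_)
    change (R (1, H (0, s))).1 = _
    rw [H.apply_zero]
    exact congrArg Subtype.val (hRe _ _ (hγ s))
  · refine Prod.ext rfl (ContinuousMap.ext fun s => ?_)
    change (R (1, H (1, s))).1 = _
    rw [H.apply_one]
    exact congrArg Subtype.val (hRe _ _ (hδ s))
  · change f (circlePt 0) = (R (1, H (t, 0))).1
    rw [H.source, hRe _ _ hy, hf.2]
  · change (R (1, H (t, 1))).1 = b.1
    rw [H.target, hRe _ _ hb]

theorem trans_mem_exterior {y y' b : K.Compl} {γ : Path y y'} {δ : Path y' b}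
    (hγ : ∀ s, (γ s).1 ∈ T.exterior) (hδ : ∀ s, (δ s).1 ∈ T.exterior) (s : I) :
    (γ.trans δ s).1 ∈ T.exterior := by
  rw [Path.trans_apply]
  split_ifs
  · exact hγ _
  · exact hδ _

/-- Sliding a standard disk along a path in the boundary of the tubular neighbourhood. -/
theorem joinedIn_nooseSpace_slide {q q' : M × ℂ} {b : K.Compl} (κ : Path q q')
    (hκ : ∀ s, (κ s).2.re = 0) (β : Path (T.polar q') b) (hβ : ∀ s, (β s).1 ∈ T.exterior) :
    JoinedIn (nooseSpace T b.1)
      (T.stdDisk q, pathVal ((T.polarPath κ rfl rfl).trans β))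
      (T.stdDisk q', pathVal ((Path.refl _).trans β)) := by
  -- At time t the disk sits at `κ t` and its path runs through the rest of `κ`, from t to 1. At the
  -- end this rest is a constant path.
  have hmem : ∀ t s : I, (t + (1 - t) * s : ℝ) ∈ Icc (0 : ℝ) 1 := fun t s =>
    ⟨by nlinarith [t.2.1, t.2.2, s.2.1], by nlinarith [t.2.1, t.2.2, s.2.2]⟩
  let c : ∀ t : I, Path (T.polar (κ t)) (T.polar q') := fun t =>
    { toFun := fun s => T.polar (κ ⟨_, hmem t s⟩)
      continuous_toFun := T.continuous_polar.comp (by fun_prop)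
      source' := by simp
      target' := by simp }
  have hc : Continuous fun p : I × I => c p.1 p.2 := T.continuous_polar.comp (by fun_prop)
  have hcE : ∀ t s, (c t s).1 ∈ T.exterior := fun t s =>
    T.bdry_subset_exterior (T.polar_mem_bdry_iff.2 (hκ _))
  have hF : Continuous fun p : I × I => (c p.1).trans β p.2 :=
    Path.trans_continuous_family _ hc (fun _ => β) (β.continuous.comp continuous_snd)
  let F : C(I × I, Sph n) := ⟨fun p => ((c p.1).trans β p.2).1, by fun_prop⟩
  let D : C(I × D2, Sph n) := ⟨fun p => T.stdDisk (κ p.1) p.2,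
    T.continuous_toFun.comp (by fun_prop)⟩
  refine ⟨⟨⟨fun t => (D.curry t, F.curry t), by fun_prop⟩, ?_, ?_⟩, fun t => ⟨?_, ?_, ?_, ?_⟩⟩
  · refine Prod.ext (ContinuousMap.ext fun z => ?_) (ContinuousMap.ext fun s => ?_)
    · change T.stdDisk (κ 0) z = _
      rw [κ.source]
    · refine congrArg Subtype.val (Noose.path_trans_congr (fun s => ?_) (fun s => rfl) s)
      simp [c, T.polarPath_apply]
  · refine Prod.ext (ContinuousMap.ext fun z => ?_) (ContinuousMap.ext fun s => ?_)
    · change T.stdDisk (κ 1) z = _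
      rw [κ.target]
    · refine congrArg Subtype.val (Noose.path_trans_congr (fun s => ?_) (fun s => rfl) s)
      simp [c]
  · exact T.isProperDiskMap_stdDisk (hκ t)
  · change T.stdDisk (κ t) (circlePt 0) = ((c t).trans β 0).1
    rw [T.stdDisk_circlePt_zero, Path.source]
  · change ((c t).trans β 1).1 = b.1
    rw [Path.target]
  · exact fun s => trans_mem_exterior (hcE t) hβ s

/-! ### Nooses and paths in polar coordinates -/

namespace Noose

variable {b₀ : K.Compl}

/-- The path of a noose, as a path in the complement of the knot. -/
def pathIn (a : Noose T b₀.1) {q : M × ℂ} (hq : (T.polar q).1 = a.disk.toFun (circlePt 0)) :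
    Path (T.polar q) b₀ where
  toFun s := ⟨a.path s, T.exterior_disjoint (a.path_mem s)⟩
  continuous_toFun := a.path.continuous.subtype_mk _
  source' := Subtype.ext (by simp [hq])
  target' := Subtype.ext (by simp)

theorem exists_polar (a : Noose T b₀.1) : ∃ q, (T.polar q).1 = a.disk.toFun (circlePt 0) := by
  have h := a.disk.circlePt_mem_bdry 0
  obtain ⟨q, hq⟩ := T.exists_polar_of_mem_nbhd (y := ⟨_, T.bdry_disjoint h⟩) (T.bdry_subset_nbhd h)
  exact ⟨q, congrArg Subtype.val hq⟩

/-- Five moves: standardize the disk of `a`, replace its path by the homotopic one, slide the disk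
along `κ`, drop the constant path left over, and undo the standardization for `b`. -/
theorem homotopic_of_polarPath (hn : 1 ≤ n) (a b : Noose T b₀.1) {q q' : M × ℂ}
    (hq : (T.polar q).1 = a.disk.toFun (circlePt 0))
    (hq' : (T.polar q').1 = b.disk.toFun (circlePt 0)) (κ : Path q q')
    (h : (a.pathIn hq).Homotopic ((T.polarPath κ rfl rfl).trans (b.pathIn hq'))) :
    Homotopic a b := by
  have hr := a.disk.re_eq_zero hq
  have hr' := b.disk.re_eq_zero hq'
  -- Sliding must take place in ∂N, so the radial part of `κ` is removed; its endpoints lie in ∂N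
  -- already.
  let κ' : Path q q' :=
    { toFun := fun s => ((κ s).1, ((κ s).2.im : ℂ) * Complex.I)
      source' := Prod.ext (by simp) (Complex.ext (by simp [hr]) (by simp))
      target' := Prod.ext (by simp) (Complex.ext (by simp [hr']) (by simp)) }
  have hκ' : ∀ s, (κ' s).2.re = 0 := fun s => by simp [κ']
  have hE : ∀ s, (T.polarPath κ' rfl rfl s).1 ∈ T.exterior := fun s =>
    T.bdry_subset_exterior (T.polar_mem_bdry_iff.2 (hκ' s))
  have hEr : ∀ s, (Path.refl (T.polar q') s).1 ∈ T.exterior := fun s =>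
    T.bdry_subset_exterior (T.polar_mem_bdry_iff.2 hr')
  have h' : (a.pathIn hq).Homotopic ((T.polarPath κ' rfl rfl).trans (b.pathIn hq')) :=
    h.trans ((T.polarPath_homotopic κ κ' rfl rfl fun s => rfl).hcomp (Path.Homotopic.refl _))
  have ha : ∀ s, (a.pathIn hq s).1 ∈ T.exterior := a.path_mem
  have hb : ∀ s, (b.pathIn hq' s).1 ∈ T.exterior := b.path_mem
  refine homotopic_of_joinedIn (p := b₀.1) ?_
  have J₁ := joinedIn_nooseSpace_of_disk (a.disk.joinedIn_stdDisk hn hq) (a.pathIn hq) ha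
  have J₂ := joinedIn_nooseSpace_of_homotopic
    ⟨T.isProperDiskMap_stdDisk hr, T.stdDisk_circlePt_zero q⟩ ha (trans_mem_exterior hE hb) h'
  have J₃ := joinedIn_nooseSpace_slide κ' hκ' (b.pathIn hq') hb
  have J₄ := joinedIn_nooseSpace_of_homotopic
    ⟨T.isProperDiskMap_stdDisk hr', T.stdDisk_circlePt_zero q'⟩ (trans_mem_exterior hEr hb) hb
    ⟨Path.Homotopy.reflTrans _⟩
  have J₅ := joinedIn_nooseSpace_of_disk (b.disk.joinedIn_stdDisk hn hq') (b.pathIn hq') hb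
  exact J₁.trans (J₂.trans (J₃.trans (J₄.trans J₅.symm)))

/-- During a homotopy the starting point of the path moves in ∂N, and its track lifts to polar
coordinates. The homotopy of paths is a square with this track as one side and a constant side
opposite. -/
theorem Homotopic.exists_polarPath {a b : Noose T b₀.1} (h : Homotopic a b) {q : M × ℂ}
    (hq : (T.polar q).1 = a.disk.toFun (circlePt 0)) :
    ∃ (q' : M × ℂ) (hq' : (T.polar q').1 = b.disk.toFun (circlePt 0)) (κ : Path q q'),
      (a.pathIn hq).Homotopic ((T.polarPath κ rfl rfl).trans (b.pathIn hq')) := by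
  obtain ⟨HD, HP, hc, hD, hE, hD0, hP0, hD1, hP1⟩ := h
  have hb : ∀ t, HD (circlePt 0, t) ∈ T.bdry := fun t => ((hD t).2.1 _).2 (norm_circlePt 0)
  obtain ⟨κ, hκ, hκp, hκ0⟩ := T.exists_polar_lift
    (γ := fun t => ⟨HD (circlePt 0, t), T.bdry_disjoint (hb t)⟩) (by fun_prop)
    (fun t => T.exists_polar_of_mem_nbhd (T.bdry_subset_nbhd (hb t))) (q := q)
    (Subtype.ext (hq.trans (hD0 _).symm))
  have hκp' : ∀ t, (T.polar (κ t)).1 = HD (circlePt 0, t) := fun t =>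
    congrArg Subtype.val (hκp t)
  refine ⟨κ 1, by rw [hκp', hD1], ⟨⟨κ, hκ⟩, hκ0, rfl⟩, ?_⟩
  have hsq := homotopic_of_square (T.polarPath ⟨⟨κ, hκ⟩, hκ0, rfl⟩ rfl rfl)
    (b.pathIn (q := κ 1) (by rw [hκp', hD1])) (a.pathIn hq) (Path.refl b₀)
    (fun p => ⟨HP p.1 p.2, T.exterior_disjoint (hE _ _)⟩) (hc.subtype_mk _)
    (fun t => Subtype.ext ?_) (fun t => Subtype.ext (hP1 t)) (fun t => Subtype.ext (hP0 t))
    (fun t => Subtype.ext ?_)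
  · exact (hsq.trans ⟨Path.Homotopy.transRefl _⟩).symm
  · simp only [Path.source]
    exact (hκp' t).symm
  · simp

end Noose

end Nooses

section Fibrations

variable {n : ℕ} {M : Type*} [TopologicalSpace M] [ChartedSpace (EuclideanSpace ℝ (Fin n)) M]
  [IsManifold (𝓡 n) ∞ M] {K : NKnot n M}

/-! ### The winding number of loops in the complement of a fibered knot -/

/-- Continuity is not part of the structure; it follows from local triviality. -/
theorem Fibration.continuous_proj (P : Fibration K) : Continuous P.proj := by
  rw [continuous_iff_continuousAt]
  intro y
  obtain ⟨e, he⟩ := P.locally_trivial (P.proj y)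
  exact e.continuousAt_proj (e.mem_source.2 he)

/-- The homomorphism that assigns to a loop the total angle of its projection to the circle. -/
def Fibration.angleHom (P : Fibration K) (b : K.Compl) : PiOne K.Compl b →* Multiplicative ℝ :=
  PiOne.lift (fun γ => Multiplicative.ofAdd
      (exists_hasAngle _ (P.continuous_proj.comp γ.continuous)).choose)
    (fun γ δ h => congrArg _
      (((exists_hasAngle _ (P.continuous_proj.comp γ.continuous)).choose_spec.of_homotopic
        P.continuous_proj h).unique
        (exists_hasAngle _ (P.continuous_proj.comp δ.continuous)).choose_spec))
    (fun γ δ => congrArg Multiplicative.ofAdd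
      ((exists_hasAngle _ (P.continuous_proj.comp (γ.trans δ).continuous)).choose_spec.unique
        (HasAngle.trans
          (exists_hasAngle _ (P.continuous_proj.comp γ.continuous)).choose_spec
          (exists_hasAngle _ (P.continuous_proj.comp δ.continuous)).choose_spec)))

theorem Fibration.angleHom_loopClass (P : Fibration K) {b : K.Compl} {γ : Path b b} {θ : ℝ}
    (h : HasAngle (fun s => P.proj (γ s)) θ) :
    P.angleHom b (loopClass γ) = Multiplicative.ofAdd θ :=
  congrArg Multiplicative.ofAdd
    ((exists_hasAngle _ (P.continuous_proj.comp γ.continuous)).choose_spec.unique h)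

theorem Fibration.hasAngle_angleHom (P : Fibration K) {b : K.Compl} (γ : Path b b) :
    HasAngle (fun s => P.proj (γ s)) (P.angleHom b (loopClass γ)).toAdd := by
  obtain ⟨θ, hθ⟩ := exists_hasAngle _ (P.continuous_proj.comp γ.continuous)
  rw [P.angleHom_loopClass hθ]
  exact hθ

theorem Fibration.angleHom_inclHom (P : Fibration K) (b : P.Fiber) (g : PiOne P.Fiber b) :
    P.angleHom b.1 (inclHom b g) = 1 := by
  obtain ⟨γ, rfl⟩ := exists_loopClass g
  rw [inclHom_loopClass]
  refine P.angleHom_loopClass (θ := 0) ?_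
  have : (fun s => P.proj (γ.map continuous_subtype_val s)) = fun _ => 1 :=
    funext fun s => (γ s).2
  rw [this]
  exact HasAngle.const 1

theorem Fibration.exists_inclHom_eq (P : Fibration K) (b : P.Fiber) {g : PiOne K.Compl b.1}
    (hg : P.angleHom b.1 g = 1) : ∃ g', inclHom b g' = g := by
  obtain ⟨γ, rfl⟩ := exists_loopClass g
  have h := P.hasAngle_angleHom γ
  rw [hg] at h
  obtain ⟨δ, hδ⟩ := exists_homotopic_loop_in_fiber P.locally_trivial (x := b) γ h
  exact ⟨loopClass δ, (inclHom_loopClass b δ).trans (loopClass_eq_iff.2 hδ.symm)⟩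

theorem Fibration.inclHom_injective (P : Fibration K) (b : P.Fiber) :
    Function.Injective (inclHom b : PiOne P.Fiber b →* PiOne K.Compl b.1) := by
  intro g g' h
  obtain ⟨γ, rfl⟩ := exists_loopClass g
  obtain ⟨δ, rfl⟩ := exists_loopClass g'
  rw [inclHom_loopClass, inclHom_loopClass, loopClass_eq_iff] at h
  exact loopClass_eq_iff.2 (homotopic_in_fiber P.locally_trivial P.continuous_proj _ _ h)

/-! ### Loops near the knot -/

namespace Tube

variable {P : Fibration K} {T : Tube K}

theorem exp_eq_ofReal_exp {z : ℂ} {k : ℤ} (h : z.im = k * (2 * Real.pi)) :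
    Complex.exp z = (Real.exp z.re : ℝ) := by
  have : z = z.re + k * (2 * Real.pi * Complex.I) := by
    apply Complex.ext <;> simp [h]
  rw [this, Complex.exp_add, Complex.exp_int_mul_two_pi_mul_I]
  simp

/-- The collar lies over the positive real ray, on which the imaginary part of the logarithm is a
multiple of 2π. The sign condition keeps the point inside N(K), where adaptedness says something. -/
theorem IsAdapted.proj_polar_eq_one_iff (hT : T.IsAdapted P) {q : M × ℂ} (hq : q.2.re ≤ 0) :
    P.proj (T.polar q) = 1 ↔ ∃ k : ℤ, q.2.im = k * (2 * Real.pi) := by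
  have hN : (T.polar q).1 ∈ T.nbhd := by
    rw [T.coe_polar, T.mem_nbhd_iff, Complex.norm_exp, Real.exp_le_one_iff]
    exact hq
  constructor
  · intro h
    have : (T.polar q).1 ∈ T.toFun '' {q | ∃ r : ℝ, 0 < r ∧ r ≤ 1 ∧ q.2 = (r : ℂ)} := by
      have hT : _ = _ := hT
      rw [← hT]
      exact ⟨⟨_, h, rfl⟩, hN⟩
    rw [T.coe_polar, T.mem_image_iff] at this
    obtain ⟨r, hr, -, he⟩ := this
    rw [← Real.exp_log hr, Complex.ofReal_exp] at he
    obtain ⟨k, hk⟩ := Complex.exp_eq_exp_iff_exists_int.1 he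
    exact ⟨k, by rw [hk]; simp⟩
  · rintro ⟨k, hk⟩
    have : (T.polar q).1 ∈ T.toFun '' {q | ∃ r : ℝ, 0 < r ∧ r ≤ 1 ∧ q.2 = (r : ℂ)} := by
      rw [T.coe_polar, T.mem_image_iff]
      exact ⟨Real.exp q.2.re, Real.exp_pos _, Real.exp_le_one_iff.2 hq, exp_eq_ofReal_exp hk⟩
    have hT : _ = _ := hT
    rw [← hT] at this
    obtain ⟨⟨y, hy, he⟩, -⟩ := this
    rw [← Subtype.ext he]
    exact hy

variable {x₀ : M} (hfib : P.proj (T.polar (x₀, 0)) = 1)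

theorem polar_zero_mem_nbhd (T : Tube K) (x : M) : (T.polar (x, 0)).1 ∈ T.nbhd :=
  T.bdry_subset_nbhd (T.polar_mem_bdry_iff.2 rfl)

/-- The subgroup of the classes of loops of the fiber that lie in the tubular neighbourhood. -/
abbrev collarLoops (P : Fibration K) (T : Tube K) (x₀ : M)
    (hfib : P.proj (T.polar (x₀, 0)) = 1) : Subgroup (PiOne P.Fiber ⟨T.polar (x₀, 0), hfib⟩) :=
  loopsIn {y : P.Fiber | y.1.1 ∈ T.nbhd} ⟨T.polar (x₀, 0), hfib⟩ (T.polar_zero_mem_nbhd x₀)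

/-- On a lift of a collar loop the imaginary part is continuous with values in 2πℤ, hence constantly
0; therefore the lift closes up. -/
theorem IsAdapted.exists_polarPath_eq (hT : T.IsAdapted P) {g}
    (hg : g ∈ collarLoops P T x₀ hfib) :
    ∃ κ : Path (x₀, (0 : ℂ)) (x₀, 0), inclHom _ g = loopClass (T.polarPath κ rfl rfl) := by
  obtain ⟨γ, hγ, rfl⟩ := hg
  obtain ⟨κ, hκ, hκγ, hκ0⟩ := T.exists_polar_lift (γ := fun s => (γ s).1) (by fun_prop)
    (fun s => T.exists_polar_of_mem_nbhd (hγ s)) (q := (x₀, 0)) (by simp)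
  have hre : ∀ s, (κ s).2.re ≤ 0 := fun s => by
    have : (T.polar (κ s)).1 ∈ T.nbhd := by rw [hκγ]; exact hγ s
    rwa [T.coe_polar, T.mem_nbhd_iff, Complex.norm_exp, Real.exp_le_one_iff] at this
  have him : ∀ s, (κ s).2.im = 0 := fun s => by
    have := lift_path_sub_eq (g := fun s => (κ s).2.im) (g' := fun _ => 0)
      (Complex.continuous_im.comp (continuous_snd.comp hκ)) continuous_const (fun s => by
        obtain ⟨k, hk⟩ := (hT.proj_polar_eq_one_iff (hre s)).1 (by rw [hκγ]; exact (γ s).2)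
        rw [Circle.exp_eq_exp]
        exact ⟨k, by rw [hk]; ring⟩) s
    simpa [hκ0] using this
  have hκ1 : κ 1 = (x₀, 0) := by
    have h : T.polar (κ 1) = T.polar (x₀, 0) := by rw [hκγ, γ.target]
    obtain ⟨k, hk⟩ := T.polar_eq_iff.1 h
    have h0 := him 1
    rw [hk] at h0 ⊢
    have : (k : ℝ) * (2 * Real.pi) = 0 := by simpa using h0
    have hk0 : k = 0 := by
      have := (mul_eq_zero.1 this).resolve_right (by positivity)
      exact_mod_cast this
    simp [hk0]
  refine ⟨⟨⟨κ, hκ⟩, hκ0, hκ1⟩, ?_⟩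
  rw [inclHom_loopClass]
  congr 1
  ext1; funext s
  exact (hκγ s).symm

/-- Scaling the ℂ-coordinate linearly down to 0 pushes the path into the collar, while its end
sweeps out k turns of the meridian. Hence every peripheral class lies in H⟨m⟩. -/
theorem IsAdapted.exists_eq_mul_zpow (hT : T.IsAdapted P) {k : ℤ}
    (κ : Path (x₀, (0 : ℂ)) (x₀, 0 + k * (2 * Real.pi * Complex.I))) :
    ∃ g ∈ collarLoops P T x₀ hfib,
      loopClass (T.polarPath κ rfl (T.polar_add_int x₀ 0 k)) =
        inclHom _ g * loopClass (T.meridianLoop (x₀, 0) 1) ^ k := by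
  let b : P.Fiber := ⟨T.polar (x₀, 0), hfib⟩
  let γ : Path b b :=
    { toFun := fun s => ⟨T.polar ((κ s).1, 0), (hT.proj_polar_eq_one_iff le_rfl).2 ⟨0, by simp⟩⟩
      continuous_toFun := (T.continuous_polar.comp (by fun_prop)).subtype_mk _
      source' := by simp [b]
      target' := by simp [b] }
  refine ⟨loopClass γ, ⟨γ, fun s => T.polar_zero_mem_nbhd _, rfl⟩, ?_⟩
  rw [← T.loopClass_meridianLoop, inclHom_loopClass, ← loopClass_trans, loopClass_eq_iff]
  have hsq := homotopic_of_square (γ.map continuous_subtype_val) (T.meridianLoop (x₀, 0) k)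
    (Path.refl _) (T.polarPath κ rfl (T.polar_add_int x₀ 0 k))
    (fun p => T.polar ((κ p.1).1, (p.2 : ℝ) * (κ p.1).2)) (T.continuous_polar.comp (by fun_prop))
    (fun t => by simp [γ]) (fun t => by simp [T.meridianLoop_apply])
    (fun t => by simp [b]) (fun t => by simp [T.polarPath_apply])
  exact (hsq.trans ⟨Path.Homotopy.reflTrans _⟩).symm

/-- The total angle of a loop near the knot. -/
theorem IsAdapted.hasAngle_polarPath (hT : T.IsAdapted P) (hn : 1 ≤ n) {θ : ℝ}
    (hθ : HasAngle (fun s => P.proj (T.meridianLoop (x₀, 0) 1 s)) θ)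
    {q : M × ℂ} {k : ℤ} (κ : Path q (q.1, q.2 + k * (2 * Real.pi * Complex.I))) :
    HasAngle (fun s => P.proj (T.polar (κ s))) (k * θ) := by
  have hfib : P.proj (T.polar (x₀, 0)) = 1 :=
    (hT.proj_polar_eq_one_iff le_rfl).2 ⟨0, by simp⟩
  have := K.pathConnectedSpace hn
  -- Conjugation by `τ`, with its translate `τ'` at the far end, moves the loop to the base point.
  -- The angles of `τ` and `τ'` cancel, and the collar factor has angle zero.
  let τ : Path (x₀, (0 : ℂ)) q := PathConnectedSpace.somePath _ _
  let τ' : Path (x₀, 0 + k * (2 * Real.pi * Complex.I))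
      (q.1, q.2 + k * (2 * Real.pi * Complex.I)) :=
    { toFun := fun s => ((τ s).1, (τ s).2 + k * (2 * Real.pi * Complex.I))
      source' := by simp
      target' := by simp }
  have hτ' : ∀ s, T.polar (τ' s) = T.polar (τ s) := fun s => T.polar_add_int _ _ _
  obtain ⟨g, -, hg⟩ := hT.exists_eq_mul_zpow hfib ((τ.trans κ).trans τ'.symm)
  obtain ⟨α, hα⟩ := exists_hasAngle _ (P.continuous_proj.comp
    (T.polarPath τ rfl rfl).continuous)
  obtain ⟨β, hβ⟩ := exists_hasAngle _ (P.continuous_proj.comp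
    (T.polarPath κ rfl (T.polar_add_int _ _ k)).continuous)
  have hα' : HasAngle (fun s => P.proj (T.polarPath τ'
      (T.polar_add_int x₀ 0 k) (T.polar_add_int q.1 q.2 k) s)) α := by
    simp only [polarPath_apply, hτ']
    exact hα
  have htot : HasAngle (fun s => P.proj (T.polarPath ((τ.trans κ).trans τ'.symm) rfl
      (T.polar_add_int x₀ 0 k) s)) (α + β + -α) := by
    rw [T.polarPath_trans _ _ rfl (T.polar_add_int q.1 q.2 k), T.polarPath_trans _ _ rfl rfl]
    exact (HasAngle.trans hα hβ).trans hα'.symm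
  have h1 := P.angleHom_loopClass htot
  have h0 : P.angleHom (T.polar (x₀, 0)) (inclHom ⟨T.polar (x₀, 0), hfib⟩ g) = 1 :=
    P.angleHom_inclHom _ g
  rw [hg, map_mul, map_zpow, h0, P.angleHom_loopClass hθ, one_mul,
    ← ofAdd_zsmul] at h1
  have h2 : k • θ = α + β + -α := Multiplicative.ofAdd.injective h1
  have : (k : ℝ) * θ = β := by rw [← zsmul_eq_mul, h2]; ring
  rw [this]
  exact hβ

theorem mem_Ioo_of_circle_exp_ne_one {g : I → ℝ} (hg : Continuous g) (h0 : g 0 ∈ Ioo 0 (2 * Real.pi))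
    (h : ∀ s, Circle.exp (g s) ≠ 1) (s : I) : g s ∈ Ioo 0 (2 * Real.pi) := by
  constructor
  · by_contra hs
    obtain ⟨s', hs'⟩ := mem_range_of_exists_le_of_exists_ge hg ⟨s, not_lt.1 hs⟩ ⟨0, h0.1.le⟩
    exact h s' (by simp [hs'])
  · by_contra hs
    obtain ⟨s', hs'⟩ := mem_range_of_exists_le_of_exists_ge hg ⟨0, h0.2.le⟩ ⟨s, not_lt.1 hs⟩
    exact h s' (by simp [hs'])

theorem exists_floor_of_ne {y : ℝ} (h : ¬∃ k : ℤ, y = k * (2 * Real.pi)) :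
    ∃ k : ℤ, k * (2 * Real.pi) < y ∧ y < (k + 1) * (2 * Real.pi) := by
  have hpi : 0 < 2 * Real.pi := by positivity
  refine ⟨⌊y / (2 * Real.pi)⌋, lt_of_le_of_ne ?_ fun h' => h ⟨_, h'.symm⟩, ?_⟩
  · rw [← le_div_iff₀ hpi]; exact Int.floor_le _
  · rw [← div_lt_iff₀ hpi]; exact Int.lt_floor_add_one _

/-- A meridian generates the group of winding numbers: near a point of the fiber there is a loop
that crosses the fiber exactly once. -/
theorem IsAdapted.exists_int_mul_angle (hT : T.IsAdapted P) (hn : 1 ≤ n) {θ : ℝ}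
    (hθ : HasAngle (fun s => P.proj (T.meridianLoop (x₀, 0) 1 s)) θ) :
    ∃ k : ℤ, k * θ = 2 * Real.pi := by
  have := K.pathConnectedSpace hn
  have hpi := Real.pi_gt_three
  let p := T.polar (x₀, -1)
  have hp : P.proj p = 1 := (hT.proj_polar_eq_one_iff (by simp)).2 ⟨0, by simp⟩
  obtain ⟨e, he⟩ := P.locally_trivial 1
  let sec : ℝ → K.Compl := fun t => e.toOpenPartialHomeomorph.symm (Circle.exp t, (e p).2)
  let U : Set ℝ := {t | Circle.exp t ∈ e.baseSet}
  have hU : IsOpen U := e.open_baseSet.preimage (by fun_prop)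
  have hsec : ContinuousOn sec U := e.continuousOn_invFun.comp (by fun_prop) fun t ht =>
    e.mem_target.2 ht
  have hsec0 : sec 0 = p := by
    change e.toOpenPartialHomeomorph.symm (Circle.exp 0, (e p).2) = p
    have h1 : (Circle.exp 0, (e p).2) = (P.proj p, (e p).2) := by rw [Circle.exp_zero, hp]
    rw [h1]
    exact e.symm_apply_mk_proj (e.mem_source.2 (by rw [hp]; exact he))
  have hsecp : ∀ t ∈ U, P.proj (sec t) = Circle.exp t := fun t ht => e.proj_symm_apply' ht
  let W : Set K.Compl := {y | y.1 ∈ T.toFun '' {q | ‖q.2‖ < 1}}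
  have hWo : IsOpen W := (T.isOpenEmbedding.isOpenMap _
    (isOpen_lt (by fun_prop) continuous_const)).preimage continuous_subtype_val
  have hW : ∀ q, T.polar q ∈ W ↔ q.2.re < 0 := fun q => by
    change (T.polar q).1 ∈ T.toFun '' {q | ‖q.2‖ < 1} ↔ _
    rw [T.coe_polar, T.mem_image_iff, mem_ofPred_eq, Complex.norm_exp, Real.exp_lt_one_iff]
  have hWr : ∀ y ∈ W, y ∈ range T.polar := fun y hy => by
    obtain ⟨q, hq, hqy⟩ := hy
    exact T.exists_polar_of_mem_nbhd (by rw [← hqy, T.mem_nbhd_iff]; exact le_of_lt hq)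
  obtain ⟨δ', hδ', hball⟩ := Metric.isOpen_iff.1 (hsec.isOpen_inter_preimage hU hWo) 0
    ⟨by simpa [U] using he, by
      change sec 0 ∈ W
      rw [hsec0, hW]; simp⟩
  let δ := min (δ' / 2) 1
  have hδ : 0 < δ := lt_min (by positivity) one_pos
  have hδ1 : δ ≤ 1 := min_le_right _ _
  have hmem : ∀ s : I, (2 * s - 1) * δ ∈ U ∩ sec ⁻¹' W := fun s => by
    refine hball ?_
    rw [mem_ball_zero_iff, Real.norm_eq_abs, abs_mul, abs_of_pos hδ]
    have h1 : |2 * (s : ℝ) - 1| ≤ 1 := abs_le.2 ⟨by linarith [s.2.1], by linarith [s.2.2]⟩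
    have h2 : δ ≤ δ' / 2 := min_le_left _ _
    nlinarith [abs_nonneg (2 * (s : ℝ) - 1)]
  -- A short arc inside the open tube that crosses the fiber once, its angle running from -δ to δ.
  let c : I → K.Compl := fun s => sec ((2 * s - 1) * δ)
  have hc : Continuous c := hsec.comp_continuous (by fun_prop) fun s => (hmem s).1
  have hcp : ∀ s, P.proj (c s) = Circle.exp ((2 * s - 1) * δ) := fun s => hsecp _ (hmem s).1
  obtain ⟨q, hq⟩ := hWr _ (hmem 0).2
  obtain ⟨κ, hκ, hκc, -⟩ := T.exists_polar_lift hc (fun s => hWr _ (hmem s).2) hq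
  have hre : ∀ s, (κ s).2.re < 0 := fun s => by rw [← hW, hκc]; exact (hmem s).2
  have hne : ∀ s : I, Circle.exp ((2 * s - 1) * δ) ≠ 1 →
      ¬∃ k : ℤ, (κ s).2.im = k * (2 * Real.pi) := fun s hs h =>
    hs (by rw [← hcp, ← hκc]; exact (hT.proj_polar_eq_one_iff (hre s).le).2 h)
  have hexp : ∀ t : ℝ, t ≠ 0 → |t| ≤ 1 → Circle.exp t ≠ 1 := fun t ht ht1 h => by
    obtain ⟨k, hk⟩ := Circle.exp_eq_one.1 h
    rw [hk, abs_mul, abs_of_pos (by positivity : 0 < 2 * Real.pi)] at ht1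
    have hk0 : k ≠ 0 := by rintro rfl; simp at hk; exact ht hk
    have : (1 : ℝ) ≤ |(k : ℝ)| := by exact_mod_cast Int.one_le_abs hk0
    nlinarith
  obtain ⟨k₀, hk₀, hk₀'⟩ := exists_floor_of_ne (hne 0 (hexp _ (by simp [hδ.ne'])
    (by simpa [abs_of_pos hδ] using hδ1)))
  obtain ⟨k₁, hk₁, hk₁'⟩ := exists_floor_of_ne (hne 1 (hexp _ (by norm_num [hδ.ne'])
    (by norm_num [abs_of_pos hδ]; exact hδ1)))
  let κ₁ : Path (κ 0) (κ 1) := ⟨⟨κ, hκ⟩, rfl, rfl⟩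
  -- The ends of the arc lie off the fiber, in the open strips numbered `k₀` and `k₁`. This lift of
  -- the initial point lies in the strip of the final one, so a segment in the convex strip closes
  -- the loop without meeting the fiber.
  let q₂ : M × ℂ := ((κ 0).1, (κ 0).2 + (k₁ - k₀ : ℤ) * (2 * Real.pi * Complex.I))
  let a : Path (κ 1).1 (κ 0).1 := PathConnectedSpace.somePath _ _
  let κ₂ : Path (κ 1) q₂ :=
    { toFun := fun s => (a s, (1 - s : ℝ) * (κ 1).2 + (s : ℝ) * q₂.2)
      source' := by simp
      target' := by simp [q₂] }
  have hq₂re : q₂.2.re < 0 := by simpa [q₂] using hre 0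
  have hq₂im : q₂.2.im = (κ 0).2.im + (k₁ - k₀) * (2 * Real.pi) := by simp [q₂]
  have hκ₂ : ∀ s, P.proj (T.polar (κ₂ s)) ≠ 1 := fun s h => by
    have e1 : (κ₂ s).2.re = (1 - s : ℝ) * (κ 1).2.re + s * q₂.2.re := by
      simp [κ₂]
    have e2 : (κ₂ s).2.im = (1 - s : ℝ) * (κ 1).2.im + s * q₂.2.im := by
      simp [κ₂]
    have hs0 := s.2.1
    have hs1 : (0 : ℝ) ≤ 1 - s := by linarith [s.2.2]
    obtain ⟨k, hk⟩ := (hT.proj_polar_eq_one_iff (by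
      rw [e1]; nlinarith [hre 1])).1 h
    rw [e2, hq₂im] at hk
    have hlo : (k₁ : ℝ) * (2 * Real.pi) < k * (2 * Real.pi) := by
      rw [← hk]
      rcases eq_or_lt_of_le hs0 with h0 | h0
      · rw [← h0]; linarith
      · nlinarith
    have hhi : (k : ℝ) * (2 * Real.pi) < (k₁ + 1) * (2 * Real.pi) := by
      rw [← hk]
      rcases eq_or_lt_of_le hs0 with h0 | h0
      · rw [← h0]; linarith
      · nlinarith
    have h1 : k₁ < k := by exact_mod_cast lt_of_mul_lt_mul_right hlo (by positivity)
    have h2 : k < k₁ + 1 := by exact_mod_cast lt_of_mul_lt_mul_right hhi (by positivity)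
    omega
  have hA₁ : HasAngle (fun s => P.proj (T.polarPath κ₁ rfl rfl s)) (2 * δ) :=
    ⟨fun s => (2 * s - 1) * δ, by fun_prop, fun s => by
      rw [← hcp, ← hκc]; rfl, by norm_num; ring⟩
  -- The angle of the return path starts at δ, never leaves (0, 2π) and ends at -δ modulo 2π, hence
  -- at 2π - δ. The whole loop has angle 2π and winds `k₁ - k₀` times around K.
  have hA₂ : HasAngle (fun s => P.proj (T.polarPath κ₂ rfl rfl s)) (2 * Real.pi - 2 * δ) := by
    obtain ⟨g, hg, hgp, hg0⟩ := exists_lift_path (fun s => P.proj (T.polarPath κ₂ rfl rfl s))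
      (P.continuous_proj.comp (Path.continuous _)) δ (by
        simp only [Path.source]
        rw [hκc, hcp]; norm_num)
    have hIoo := mem_Ioo_of_circle_exp_ne_one hg (by rw [hg0]; exact ⟨hδ, by linarith⟩)
      (fun s => by rw [hgp]; exact hκ₂ s) 1
    have hg1 : Circle.exp (g 1) = Circle.exp (-δ) := by
      rw [hgp]
      simp only [Path.target]
      have : T.polar q₂ = c 0 := (T.polar_add_int _ _ _).trans (hκc 0)
      rw [this, hcp]; norm_num
    obtain ⟨j, hj⟩ := Circle.exp_eq_exp.1 hg1
    have hj1 : j = 1 := by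
      have h1 : (0 : ℝ) < j := by
        by_contra hneg
        have := hIoo.1
        rw [hj] at this
        nlinarith
      have h2 : (j : ℝ) < 2 := by
        by_contra hneg
        have := hIoo.2
        rw [hj] at this
        nlinarith
      have h1 : 0 < j := by exact_mod_cast h1
      have h2 : j < 2 := by exact_mod_cast h2
      omega
    refine ⟨g, hg, hgp, ?_⟩
    rw [hj, hg0, hj1]; push_cast; ring
  have hA := HasAngle.trans hA₁ hA₂
  rw [← T.polarPath_trans] at hA
  refine ⟨k₁ - k₀, ?_⟩
  have := (hT.hasAngle_polarPath hn hθ (κ₁.trans κ₂)).unique hA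
  rw [this]; ring

/-! ### The structure of the knot group -/

theorem IsAdapted.exists_zpow_mul (hT : T.IsAdapted P) (hn : 1 ≤ n)
    (g : PiOne K.Compl (T.polar (x₀, 0))) :
    ∃ (k : ℤ) (g' : PiOne P.Fiber ⟨T.polar (x₀, 0), hfib⟩),
      loopClass (T.meridianLoop (x₀, 0) 1) ^ k * g = inclHom _ g' := by
  have hθ := P.hasAngle_angleHom (T.meridianLoop (x₀, 0) 1)
  obtain ⟨k, hk⟩ := hT.exists_int_mul_angle hn hθ
  obtain ⟨γ, rfl⟩ := exists_loopClass g
  obtain ⟨l, hl⟩ := (P.hasAngle_angleHom γ).eq_int (by simp)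
  -- The loop has angle 2πl = lkθ, which this power of the meridian cancels.
  refine ⟨-(l * k), ?_⟩
  obtain ⟨g', hg'⟩ := P.exists_inclHom_eq ⟨T.polar (x₀, 0), hfib⟩
    (g := loopClass (T.meridianLoop (x₀, 0) 1) ^ (-(l * k)) * loopClass γ) (by
      rw [map_mul, map_zpow]
      apply Multiplicative.toAdd.injective
      rw [toAdd_mul, toAdd_zpow, hl, toAdd_one, zsmul_eq_mul, ← hk]
      push_cast; ring)
  exact ⟨g', hg'.symm⟩

theorem IsAdapted.eq_zero_of_zpow_eq (hT : T.IsAdapted P) (hn : 1 ≤ n) {k : ℤ}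
    {g : PiOne P.Fiber ⟨T.polar (x₀, 0), hfib⟩}
    (h : loopClass (T.meridianLoop (x₀, 0) 1) ^ k = inclHom _ g) : k = 0 := by
  have hθ := P.hasAngle_angleHom (T.meridianLoop (x₀, 0) 1)
  obtain ⟨l, hl⟩ := hT.exists_int_mul_angle hn hθ
  have h1 := congrArg (P.angleHom _) h
  have h0 : P.angleHom (T.polar (x₀, 0)) (inclHom ⟨T.polar (x₀, 0), hfib⟩ g) = 1 :=
    P.angleHom_inclHom _ g
  rw [h0, map_zpow] at h1
  have h2 := congrArg Multiplicative.toAdd h1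
  rw [toAdd_zpow, toAdd_one, zsmul_eq_mul] at h2
  rcases mul_eq_zero.1 h2 with h3 | h3
  · exact_mod_cast h3
  · rw [h3, mul_zero] at hl
    have := Real.pi_pos
    linarith

theorem IsAdapted.commute (hT : T.IsAdapted P) {g : PiOne P.Fiber ⟨T.polar (x₀, 0), hfib⟩}
    (hg : g ∈ collarLoops P T x₀ hfib) :
    Commute (inclHom _ g) (loopClass (T.meridianLoop (x₀, 0) 1)) := by
  obtain ⟨κ, hκ⟩ := hT.exists_polarPath_eq hfib hg
  rw [hκ, Commute, SemiconjBy, ← loopClass_trans, ← loopClass_trans, loopClass_eq_iff]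
  exact T.meridianLoop_homotopic κ 1

end Tube

end Fibrations

section Representatives

variable {n : ℕ} {M : Type*} [TopologicalSpace M] [ChartedSpace (EuclideanSpace ℝ (Fin n)) M]
  [IsManifold (𝓡 n) ∞ M] {K : NKnot n M} {P : Fibration K} {T : Tube K} {x₀ : M}

/-! ### Translation of paths in polar coordinates -/

/-- The translate of a path by a multiple of the period of the exponential function. -/
def shiftPath {q q' : M × ℂ} (κ : Path q q') (k : ℤ) :
    Path (q.1, q.2 + k * (2 * Real.pi * Complex.I)) (q'.1, q'.2 + k * (2 * Real.pi * Complex.I)) where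
  toFun s := ((κ s).1, (κ s).2 + k * (2 * Real.pi * Complex.I))
  source' := by simp
  target' := by simp

theorem Tube.polarPath_shiftPath (T : Tube K) {q q' : M × ℂ} {y y' : K.Compl} (κ : Path q q')
    (k : ℤ) (h : T.polar q = y) (h' : T.polar q' = y') :
    T.polarPath (shiftPath κ k) ((T.polar_add_int _ _ _).trans h)
      ((T.polar_add_int _ _ _).trans h') = T.polarPath κ h h' := by
  exact Path.ext (funext fun s => T.polar_add_int (κ s).1 (κ s).2 k)

/-! ### Nooses and elements of the knot group -/

namespace Noose

variable {b₀ : K.Compl}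

/-- The initial point of the path of a noose. -/
def basePt (a : Noose T b₀.1) : K.Compl :=
  ⟨a.disk.toFun (circlePt 0), T.bdry_disjoint (a.disk.circlePt_mem_bdry 0)⟩

/-- The path of a noose, as a path in the complement of the knot. -/
def complPath (a : Noose T b₀.1) : Path a.basePt b₀ where
  toFun s := ⟨a.path s, T.exterior_disjoint (a.path_mem s)⟩
  continuous_toFun := a.path.continuous.subtype_mk _
  source' := Subtype.ext a.path.source
  target' := Subtype.ext a.path.target

theorem homotopic_of_complPath (hn : 1 ≤ n) (a b : Noose T b₀.1) {q q' : M × ℂ}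
    (h : T.polar q = a.basePt) (h' : T.polar q' = b.basePt) (κ : Path q q')
    (H : a.complPath.Homotopic ((T.polarPath κ h h').trans b.complPath)) : Homotopic a b := by
  have key : ∀ (y y' : K.Compl) (α : Path y b₀) (β : Path y' b₀), (∀ s, (α s).1 = a.path s) →
      (∀ s, (β s).1 = b.path s) → ∀ (h : T.polar q = y) (h' : T.polar q' = y'),
      y.1 = a.disk.toFun (circlePt 0) → y'.1 = b.disk.toFun (circlePt 0) →
      α.Homotopic ((T.polarPath κ h h').trans β) → Homotopic a b := by
    rintro _ _ α β hα hβ rfl rfl hy hy' H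
    have eα : α = a.pathIn hy := Path.ext (funext fun s => Subtype.ext (hα s))
    have eβ : β = b.pathIn hy' := Path.ext (funext fun s => Subtype.ext (hβ s))
    rw [eα, eβ] at H
    exact homotopic_of_polarPath hn a b hy hy' κ H
  exact key _ _ a.complPath b.complPath (fun _ => rfl) (fun _ => rfl) h h' rfl rfl H

theorem Homotopic.exists_complPath {a b : Noose T b₀.1} (H : Homotopic a b) {q : M × ℂ}
    (h : T.polar q = a.basePt) :
    ∃ (q' : M × ℂ) (h' : T.polar q' = b.basePt) (κ : Path q q'),
      a.complPath.Homotopic ((T.polarPath κ h h').trans b.complPath) := by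
  obtain ⟨q', hq', κ, hκ⟩ := H.exists_polarPath (congrArg Subtype.val h)
  have h' : T.polar q' = b.basePt := Subtype.ext hq'
  have key : ∀ (y y' : K.Compl) (α : Path y b₀) (β : Path y' b₀), (∀ s, (α s).1 = a.path s) →
      (∀ s, (β s).1 = b.path s) → ∀ (h : T.polar q = y) (h' : T.polar q' = y'),
      α.Homotopic ((T.polarPath κ h h').trans β) := by
    rintro _ _ α β hα hβ rfl rfl
    have eα : α = a.pathIn (congrArg Subtype.val h) := Path.ext (funext fun s => Subtype.ext (hα s))
    have eβ : β = b.pathIn hq' := Path.ext (funext fun s => Subtype.ext (hβ s))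
    rwa [eα, eβ]
  exact ⟨q', h', κ, key _ _ _ _ (fun _ => rfl) (fun _ => rfl) h h'⟩

theorem coe_trans_apply {X : Type*} [TopologicalSpace X] {p : X → Prop} {x y z : {w // p w}}
    (γ : Path x y) (δ : Path y z) (s : I) : (γ.trans δ s).1 =
      (γ.map continuous_subtype_val).trans (δ.map continuous_subtype_val) s := by
  rw [← Path.map_trans]; rfl

theorem trans_complPath_op (a b : Noose T b₀.1) {y : K.Compl} (c : Path y a.basePt) :
    c.trans (y := (a.op b).basePt) (a.op b).complPath =
    c.trans (((a.complPath.trans b.complPath.symm).trans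
      (b.disk.boundaryPath (y := b.basePt) rfl)).trans b.complPath) := by
  refine Path.ext (funext fun s => path_trans_congr (fun _ => rfl) (fun s => Subtype.ext ?_) s)
  refine Eq.trans ?_ (coe_trans_apply _ _ s).symm
  refine path_trans_congr (fun s => ?_) (fun _ => rfl) s
  refine Eq.trans ?_ (coe_trans_apply _ _ s).symm
  refine path_trans_congr (fun s => ?_) (fun _ => rfl) s
  refine Eq.trans ?_ (coe_trans_apply _ _ s).symm
  exact path_trans_congr (fun _ => rfl) (fun _ => rfl) s

theorem boundaryPath_basePt_homotopic (hn : 1 ≤ n) (b : Noose T b₀.1) {x : M × ℂ} {q : M × ℂ}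
    (κ : Path x q) (h : T.polar q = b.basePt) :
    ((T.polarPath κ rfl h).trans (b.disk.boundaryPath (y := b.basePt) rfl)).Homotopic
      ((T.meridianLoop x 1).trans (T.polarPath κ rfl h)) := by
  have key : ∀ (y : K.Compl) (h : T.polar q = y) (hy : b.disk.toFun (circlePt 0) = y.1),
      ((T.polarPath κ rfl h).trans (b.disk.boundaryPath hy)).Homotopic
      ((T.meridianLoop x 1).trans (T.polarPath κ rfl h)) := by
    rintro _ rfl hy
    exact ((Path.Homotopic.refl _).hcomp (b.disk.boundaryPath_homotopic hn hy)).trans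
      (T.meridianLoop_homotopic κ 1)
  exact key _ h rfl

/-- A loop represents a noose if it consists of a path near the knot, which ends at the disk of the
noose, and of the path of the noose. -/
def Represents (x₀ : M) (a : Noose T (T.polar (x₀, 0)).1) (g : PiOne K.Compl (T.polar (x₀, 0))) :
    Prop :=
  ∃ (q : M × ℂ) (h : T.polar q = a.basePt) (κ : Path (x₀, (0 : ℂ)) q),
    g = loopClass ((T.polarPath κ rfl h).trans a.complPath)

variable {a b : Noose T (T.polar (x₀, 0)).1} {g g' : PiOne K.Compl (T.polar (x₀, 0))}

theorem exists_represents (hn : 1 ≤ n) (a : Noose T (T.polar (x₀, 0)).1) :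
    ∃ g, Represents x₀ a g := by
  have := K.pathConnectedSpace hn
  obtain ⟨q, hq⟩ := a.exists_polar
  exact ⟨_, q, Subtype.ext hq, PathConnectedSpace.somePath _ _, rfl⟩

/-- The connecting path may first go k times around the knot; afterwards its translate ends over the
same point of the disk boundary. -/
theorem Represents.zpow_mul (h : Represents x₀ a g) (k : ℤ) :
    Represents x₀ a (loopClass (T.meridianLoop (x₀, 0) 1) ^ k * g) := by
  obtain ⟨q, h, κ, rfl⟩ := h
  refine ⟨_, (T.polar_add_int q.1 q.2 k).trans h, (Tube.meridianPath x₀ 0 k).trans (shiftPath κ k), ?_⟩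
  rw [T.polarPath_trans _ _ rfl (T.polar_add_int x₀ 0 k), T.polarPath_shiftPath κ k rfl h,
    ← T.loopClass_meridianLoop, ← loopClass_trans, loopClass_eq_iff]
  exact Path.Homotopic.symm ⟨Path.Homotopy.transAssoc _ _ _⟩

-- With g = [κα] and g' = [κ'β], transport along κ' identifies κ'⁻¹ m κ' with ∂E, and the product
-- collapses to [κ · α β⁻¹ ∂E β].
open Path.Homotopic.Quotient in
theorem Represents.op (hn : 1 ≤ n) (h : Represents x₀ a g) (h' : Represents x₀ b g') :
    Represents x₀ (a.op b) (g * g'⁻¹ * loopClass (T.meridianLoop (x₀, 0) 1) * g') := by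
  obtain ⟨q, h, κ, rfl⟩ := h
  obtain ⟨q', h', κ', rfl⟩ := h'
  have e := congrArg loopClass (trans_complPath_op a b (T.polarPath κ rfl h))
  refine ⟨q, h, κ, Eq.trans ?_ e.symm⟩
  have hm := b.boundaryPath_basePt_homotopic hn κ' h'
  rw [← Path.Homotopic.Quotient.eq, mk_trans, mk_trans] at hm
  rw [← loopClass_symm, ← loopClass_trans, ← loopClass_trans, ← loopClass_trans,
    loopClass_eq_iff, ← Path.Homotopic.Quotient.eq]
  simp only [mk_trans, mk_symm, Path.trans_symm, trans_assoc]
  rw [← trans_assoc (Path.Homotopic.Quotient.mk (T.meridianLoop _ _)), ← hm, trans_assoc,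
    ← trans_assoc (Path.Homotopic.Quotient.symm _) (Path.Homotopic.Quotient.mk (T.polarPath κ' rfl h')), symm_trans, refl_trans]

-- The disk of `a` is slid along κ⁻¹ l κ', from its own boundary back to the base point, around `l`,
-- and out to the disk of `b`.
open Path.Homotopic.Quotient in
theorem Represents.homotopic (hn : 1 ≤ n) (h : Represents x₀ a g) (h' : Represents x₀ b g')
    (l : Path (x₀, (0 : ℂ)) (x₀, 0)) (hl : g = loopClass (T.polarPath l rfl rfl) * g') :
    Homotopic a b := by
  obtain ⟨q, h, κ, rfl⟩ := h
  obtain ⟨q', h', κ', rfl⟩ := h'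
  refine a.homotopic_of_complPath hn b h h' (κ.symm.trans (l.trans κ'))
    (homotopic_cancel_left (c := T.polarPath κ rfl h) ?_)
  rw [← loopClass_trans, loopClass_eq_iff, ← Path.Homotopic.Quotient.eq] at hl
  rw [← Path.Homotopic.Quotient.eq, hl, T.polarPath_trans _ _ h rfl, T.polarPath_trans _ _ rfl rfl,
    T.polarPath_symm]
  simp only [mk_trans, mk_symm, trans_assoc]
  rw [← trans_assoc (Path.Homotopic.Quotient.mk _) (Path.Homotopic.Quotient.symm _), trans_symm, refl_trans]

-- The loop `l` follows κ, then the track of the homotopy, and returns along κ'. The track and κ'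
-- end at lifts of the same point, which differ by k periods.
open Path.Homotopic.Quotient in
theorem Represents.exists_eq_mul (h : Represents x₀ a g) (h' : Represents x₀ b g')
    (H : Homotopic a b) :
    ∃ (k : ℤ) (l : Path (x₀, (0 : ℂ)) (x₀, 0 + k * (2 * Real.pi * Complex.I))),
      g = loopClass (T.polarPath l rfl (T.polar_add_int x₀ 0 k)) * g' := by
  obtain ⟨q, h, κ, rfl⟩ := h
  obtain ⟨q', h', κ', rfl⟩ := h'
  obtain ⟨r, hr, δ, hδ⟩ := H.exists_complPath h
  obtain ⟨k, rfl⟩ := T.polar_eq_iff.1 (hr.trans h'.symm)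
  refine ⟨k, (κ.trans δ).trans (shiftPath κ' k).symm, ?_⟩
  rw [T.polarPath_trans _ _ rfl hr, T.polarPath_trans _ _ rfl h, ← loopClass_trans,
    loopClass_eq_iff, ← Path.Homotopic.Quotient.eq]
  have e : T.polarPath (shiftPath κ' k).symm hr (T.polar_add_int x₀ 0 k) =
      (T.polarPath κ' rfl h').symm := by rw [← T.polarPath_shiftPath κ' k rfl h']; rfl
  rw [← Path.Homotopic.Quotient.eq] at hδ
  rw [e]
  simp only [mk_trans, mk_symm, trans_assoc, hδ]
  rw [← trans_assoc (Path.Homotopic.Quotient.symm _) (Path.Homotopic.Quotient.mk (T.polarPath κ' rfl h')), symm_trans, refl_trans]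

/-- Every element of the knot group is represented by a noose with a given disk. -/
theorem exists_represented (D : MeridionalDisk T) (hD : D.toFun (circlePt 0) = (T.polar (x₀, 0)).1)
    (g : PiOne K.Compl (T.polar (x₀, 0))) :
    ∃ a : Noose T (T.polar (x₀, 0)).1, Represents x₀ a g := by
  obtain ⟨γ, rfl⟩ := exists_loopClass g
  obtain ⟨R, hR, hR0, hR1, hRE⟩ := T.exists_retraction
  have hE : (T.polar (x₀, 0)).1 ∈ T.exterior :=
    T.bdry_subset_exterior (T.polar_mem_bdry_iff.2 (by simp))
  let γ' : Path (T.polar (x₀, 0)) (T.polar (x₀, 0)) :=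
    { toFun := fun s => R (1, γ s)
      continuous_toFun := by fun_prop
      source' := by rw [γ.source, hRE _ _ hE]
      target' := by rw [γ.target, hRE _ _ hE] }
  let a : Noose T (T.polar (x₀, 0)).1 :=
    ⟨D, (γ'.map continuous_subtype_val).cast hD rfl, fun s => hR1 _⟩
  have ha : T.polar (x₀, 0) = a.basePt := Subtype.ext hD.symm
  refine ⟨a, _, ha, Path.refl _, ?_⟩
  have hγ : γ.Homotopic γ' :=
    ⟨{  toFun := fun p => R (p.1, γ p.2)
        continuous_toFun := by fun_prop
        map_zero_left := fun s => hR0 _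
        map_one_left := fun s => rfl
        prop' := fun t s hs => by
          rcases hs with rfl | rfl
          · simp [hRE _ _ hE]
          · simp [hRE _ _ hE] }⟩
  rw [loopClass_eq_iff]
  have e : (T.polarPath (Path.refl (x₀, (0 : ℂ))) rfl ha).trans a.complPath =
      (Path.refl _).trans γ' :=
    Path.ext (funext fun s => path_trans_congr (fun _ => rfl) (fun _ => rfl) s)
  rw [e]
  exact hγ.trans (Path.Homotopic.symm ⟨Path.Homotopy.reflTrans _⟩)

end Noose

end Representatives

/-! ### The knot quandle -/

section Main

variable {n : ℕ} {M : Type*} [TopologicalSpace M] [ChartedSpace (EuclideanSpace ℝ (Fin n)) M]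
  [IsManifold (𝓡 n) ∞ M] {K : NKnot n M} {P : Fibration K} {T : Tube K}

/-- Reduces the monodromy to conjugation by the meridian in the knot group; injectivity of π₁(F)
gives the converse direction. -/
theorem isMonodromy_iff (D₀ : MeridionalDisk T) (p₀ : P.Fiber)
    (hp₀ : D₀.toFun (circlePt 0) = p₀.1.1) (φ : PiOne P.Fiber p₀ ≃* PiOne P.Fiber p₀) :
    IsMonodromy P D₀ p₀ hp₀ φ ↔ ∀ g, inclHom p₀ (φ g) =
      (loopClass (meridian D₀ p₀ hp₀))⁻¹ * inclHom p₀ g * loopClass (meridian D₀ p₀ hp₀) := by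
  have key : ∀ γ δ : Path p₀ p₀, Path.Homotopic
      (((meridian D₀ p₀ hp₀).symm.trans (γ.map continuous_subtype_val)).trans (meridian D₀ p₀ hp₀))
      (δ.map continuous_subtype_val) ↔ inclHom p₀ (loopClass δ) =
      (loopClass (meridian D₀ p₀ hp₀))⁻¹ * inclHom p₀ (loopClass γ) *
        loopClass (meridian D₀ p₀ hp₀) := fun γ δ => by
    rw [← loopClass_eq_iff, loopClass_trans, loopClass_trans, loopClass_symm, eq_comm]; rfl
  constructor
  · intro h g
    obtain ⟨γ, rfl⟩ := exists_loopClass g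
    obtain ⟨δ, hδ⟩ := exists_loopClass (φ (loopClass γ))
    rw [← hδ]
    exact (key γ δ).1 ((h γ δ).1 hδ.symm)
  · intro h γ δ
    rw [key, ← h, (P.inclHom_injective p₀).eq_iff, eq_comm]

/-- The monodromy exists and is unique. -/
theorem existsUnique_isMonodromy (D₀ : MeridionalDisk T) (p₀ : P.Fiber)
    (hp₀ : D₀.toFun (circlePt 0) = p₀.1.1) :
    ∃! φ : PiOne P.Fiber p₀ ≃* PiOne P.Fiber p₀, IsMonodromy P D₀ p₀ hp₀ φ := by
  -- Angles are unchanged by conjugation, and the image of π₁(F) is the kernel of the angle.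
  have hrange : ∀ m g, m⁻¹ * inclHom p₀ g * m ∈ (inclHom p₀).range := fun m g =>
    P.exists_inclHom_eq p₀ (by rw [map_mul, map_mul, map_inv, P.angleHom_inclHom]; simp)
  obtain ⟨φ, hφ⟩ := exists_mulEquiv_of_conj (P.inclHom_injective p₀) (hrange _)
    (m := loopClass (meridian D₀ p₀ hp₀)) fun g => by simpa using hrange _⁻¹ g
  refine ⟨φ, (isMonodromy_iff _ _ _ _).2 hφ, fun ψ hψ => ?_⟩
  ext1 g
  exact P.inclHom_injective p₀ (((isMonodromy_iff _ _ _ _).1 hψ g).trans (hφ g).symm)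

/-- Every base point on the boundary of a disk lies on the collar. -/
theorem Tube.IsAdapted.exists_polar_eq (hT : T.IsAdapted P) (p₀ : P.Fiber)
    (h : p₀.1.1 ∈ T.bdry) : ∃ x₀ : M, T.polar (x₀, 0) = p₀.1 := by
  have h1 : p₀.1.1 ∈ T.toFun '' {q | ∃ r : ℝ, 0 < r ∧ r ≤ 1 ∧ q.2 = (r : ℂ)} := by
    rw [← hT]
    exact ⟨⟨p₀.1, p₀.2, rfl⟩, T.bdry_subset_nbhd h⟩
  obtain ⟨⟨x, z⟩, ⟨r, hr, hr1, hz⟩, hx⟩ := h1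
  obtain rfl : z = r := hz
  rw [← hx, T.mem_bdry_iff] at h
  refine ⟨x, Subtype.ext ?_⟩
  rw [T.coe_polar, ← hx]
  have hr' : r = 1 := by simpa [abs_of_pos hr] using h
  simp [hr']

/-- The isomorphism, for a base point given in polar coordinates. -/
theorem exists_equiv_of_polar (hn : 1 ≤ n) (hT : T.IsAdapted P) {x₀ : M}
    (hfib : P.proj (T.polar (x₀, 0)) = 1) (D₀ : MeridionalDisk T)
    (hp₀ : D₀.toFun (circlePt 0) = (T.polar (x₀, 0)).1)
    (φ : PiOne P.Fiber ⟨T.polar (x₀, 0), hfib⟩ ≃* PiOne P.Fiber ⟨T.polar (x₀, 0), hfib⟩)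
    (hφ : ∀ g, inclHom _ (φ g) = (loopClass (T.meridianLoop (x₀, 0) 1))⁻¹ * inclHom _ g *
      loopClass (T.meridianLoop (x₀, 0) 1)) :
    ∃ hφ : ∀ h ∈ Tube.collarLoops P T x₀ hfib, φ h = h,
      ∃ e : KnotQuandle T (T.polar (x₀, 0)).1 ≃ RightCosets (Tube.collarLoops P T x₀ hfib),
        ∀ a b, e (KnotQuandle.op a b) =
          quotientAlexanderOp φ (Tube.collarLoops P T x₀ hfib) hφ (e a) (e b) := by
  have hφH : ∀ h ∈ Tube.collarLoops P T x₀ hfib, φ h = h := fun h hh =>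
    P.inclHom_injective _ (by
      rw [hφ, mul_assoc, (hT.commute hfib hh).eq, inv_mul_cancel_left])
  refine ⟨hφH, exists_equiv_rightCosets (fun _ _ => rfl) Noose.Homotopic.refl φ _ hφH
    (fun a g => Noose.Represents x₀ a (inclHom _ g)) (fun a => ?_) (fun g => ?_)
    (fun a b g g' ha hb h => ?_) (fun a b g g' ha hb h => ?_) fun a b g g' ha hb => ?_⟩
  · obtain ⟨γ, hγ⟩ := Noose.exists_represents hn a
    obtain ⟨k, g, hg⟩ := hT.exists_zpow_mul hfib hn γ
    exact ⟨g, hg ▸ hγ.zpow_mul k⟩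
  · exact Noose.exists_represented D₀ hp₀ _
  · obtain ⟨k, l, hl⟩ := ha.exists_eq_mul hb h
    obtain ⟨u, hu, hul⟩ := hT.exists_eq_mul_zpow hfib l
    rw [hul] at hl
    -- From g = u mᵏ g' with u in H, the power mᵏ lies in π₁(F), which forces k = 0 and g g'⁻¹ = u.
    have hk : loopClass (T.meridianLoop (x₀, 0) 1) ^ k = inclHom _ (u⁻¹ * (g * g'⁻¹)) := by
      rw [map_mul, map_mul, map_inv, map_inv, hl]; group
    obtain rfl := hT.eq_zero_of_zpow_eq hfib hn hk
    rw [zpow_zero, mul_one, ← map_mul] at hl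
    rw [P.inclHom_injective _ hl, mul_inv_cancel_right]
    exact hu
  · obtain ⟨l, hl⟩ := hT.exists_polarPath_eq hfib h
    exact ha.homotopic hn hb l (by rw [← hl, ← map_mul, inv_mul_cancel_right])
  -- The factor m⁻¹ brings the representative g g'⁻¹ m g' back into π₁(F), where it reads φ(g g'⁻¹)
  -- g'.
  · have := (ha.op hn hb).zpow_mul (-1)
    rw [map_mul, hφ, map_mul, map_inv]
    simpa only [zpow_neg_one, mul_assoc] using this

end Main

end FiberedKnot

end

theorem theorem3p1 (n : ℕ) (hn : 1 ≤ n) {M : Type*} [TopologicalSpace M]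
    [ChartedSpace (EuclideanSpace ℝ (Fin n)) M] [IsManifold (𝓡 n) ∞ M]
    (K : NKnot n M) (P : Fibration K) (T : Tube K) (hT : T.IsAdapted P)
    (D₀ : MeridionalDisk T) (p₀ : P.Fiber) (hp₀ : D₀.toFun (circlePt 0) = p₀.1.1) :
    (∃! φ : PiOne P.Fiber p₀ ≃* PiOne P.Fiber p₀, IsMonodromy P D₀ p₀ hp₀ φ) ∧
    ∀ φ : PiOne P.Fiber p₀ ≃* PiOne P.Fiber p₀, IsMonodromy P D₀ p₀ hp₀ φ →
      ∃ hφ : ∀ h ∈ peripheral P D₀ p₀ hp₀, φ h = h,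
        IsQuandle (KnotQuandle.op (T := T) (p := p₀.1.1)) ∧
        IsQuandle (quotientAlexanderOp φ (peripheral P D₀ p₀ hp₀) hφ) ∧
        ∃ e : KnotQuandle T p₀.1.1 ≃ RightCosets (peripheral P D₀ p₀ hp₀),
          ∀ a b, e (KnotQuandle.op a b) =
            quotientAlexanderOp φ (peripheral P D₀ p₀ hp₀) hφ (e a) (e b) := by
  refine ⟨existsUnique_isMonodromy D₀ p₀ hp₀, fun φ h => ?_⟩
  obtain ⟨x₀, hx₀⟩ := hT.exists_polar_eq p₀ (hp₀ ▸ D₀.circlePt_mem_bdry 0)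
  obtain ⟨y, hfib⟩ := p₀
  obtain rfl : T.polar (x₀, 0) = y := hx₀
  rw [isMonodromy_iff] at h
  -- The disk `D₀` is arbitrary, but its boundary is homotopic to the standard meridian of the tube
  -- through the same point.
  have hm : loopClass (meridian D₀ ⟨T.polar (x₀, 0), hfib⟩ hp₀) =
      loopClass (T.meridianLoop (x₀, 0) 1) :=
    loopClass_eq_iff.2 (D₀.boundaryPath_homotopic hn hp₀)
  rw [hm] at h
  obtain ⟨hφ, e, he⟩ := exists_equiv_of_polar hn hT hfib D₀ hp₀ φ h
  have hQ := isQuandle_quotientAlexanderOp φ _ hφ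
  exact ⟨hφ, hQ.of_equiv e he, hQ, e, he⟩
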